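/- **Setting.** Let $K$ be a finite triangulation of $[0,1]^2$, let $G\subset[0,1]^2$ be a connected geometric graph (a finite set of points and finitely many simple arcs joining them, disjoint from the points and from each other otherwise), and let $\rho$ be a piecewise linear function on $K$, given by its values at the vertices. "Deformation retracts" means: there is a homotopy from the identity to a map into the subspace that fixes the subspace pointwise at all times. *Noise model.* Let $\beta,\nu,\omega$ be real numbers with $\beta>2\nu$, and let $\Omega$ be a subcomplex of $K$ (also denoting its underlying space) that contains every simplex of $K$ all of whose vertices lie in $\Omega$, such that $G\subseteq\Omega$, every vertex of $\Omega$ is at distance at most $\omega$ from $G$, $\Omega$ deformation retracts to $G$, $\rho(v)\in[\beta,\beta+\nu]$ for each vertex $v$ of $\Omega$, and $\rho(v)\in[0,\nu]$ for each other vertex of $K$. Let $\delta\in[\nu,\beta-\nu)$. *Persistence.* Put $f=-\rho$ on vertices and $f(\sigma)=\max_{v\in\sigma}f(v)$ on simplices. Fix a lower-star filtration of $K$: list the vertices by non-decreasing $f$ (ties broken arbitrarily), and list all simplices so that faces precede cofaces and the simplices whose last vertex is $v_1$ come first, then those whose last vertex is $v_2$, and so on. In the persistence pairing of this filtration (homology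 modulo 2), a pair $(\sigma,\tau)$ has persistence $f(\tau)-f(\sigma)$, which is also called the persistence of $\sigma$ and of $\tau$; unpaired simplices have persistence $\infty$. *Output graph.* Let $\mathcal T$ be the spanning forest consisting of all vertices of $K$ and of the edges $e$ that occur in vertex-edge pairs $(v,e)$ of persistence at most $\delta$. The sink of a tree of $\mathcal T$ is its vertex that comes first in the list of vertices. $\hat G$ is the union, over all edges $e=\langle u,v\rangle$ of $K$ with persistence larger than $\delta$, of $e$ and of the paths in $\mathcal T$ from $u$ and from $v$ to the sinks of their trees. Let $H$ be the maximal set of edges of $\hat G$ whose deletion does not eliminate a cycle, that is, the edges of $\hat G$ lying on no cycle of $\hat G$. *Augmentation.* Let $K^+$ be the triangulation of the sphere obtained from $K$ by adding a vertex at infinity, joined to all vertices and edges of $K$ on the boundary of the square, all new simplices having value $f=\infty$ (pairs of new simplices having persistence $0$). Fix a lower-star filtration of $K^+$ that extends the order chosen on $K$. Let $(t_i)_i$ be the triangles of $K^+$ whose persistence in it is larger than $\delta$ (including the unpaired one). **Theorem.** There is a partition $\{R_i\}$ of the set of triangles of $K^+$, indexed as the $t_i$, with $t_i\in R_i$, such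 that, with $B_i=\partial R_i$ the boundary modulo 2 and $R_i\setminus t_i$ the complex of all faces of triangles in $R_i$ other than $t_i$ itself: 1. $\bigcup_i (R_i\setminus t_i)$ deformation retracts to $\Omega$; 2. $\bigcup_i B_i\cup H=\hat G$ (as sets of edges); 3. if $G$ is not contractible (i.e. $G$ contains a cycle), then $\Omega$ deformation retracts to $\bigcup_i B_i\cup H=\hat G$, and hence $\bigcup_i(R_i\setminus t_i)$ deformation retracts to $\hat G$. -/

import Mathlib

noncomputable section

namespace GraphReconstruction

/-! ### Simplicial chains modulo two, filtrations, persistence pairs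

Simplices are nonempty finite sets of vertices, a simplex with `k + 1` vertices having dimension
`k`.  A chain modulo two is identified with the set of simplices in it. -/

section Combinatorics

variable {V : Type*}

/-- The boundary modulo two of a (finite) chain `c`: the simplices that are a facet of an odd number
of members of `c`.  Vertices have empty boundary. -/
def boundary (c : Set (Finset V)) : Set (Finset V) :=
  {σ | σ.Nonempty ∧ Odd {τ ∈ c | σ ⊆ τ ∧ τ.card = σ.card + 1}.ncard}

/-- The extension of a vertex function to simplices by the maximum over the vertices. -/
def simplexValue (f : V → EReal) (σ : Finset V) : EReal := σ.sup f

/-- `r` enumerates (injectively, by natural numbers) the simplices of `K` in the order of a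
lower-star filtration of `K` with respect to `f`: faces come before cofaces, the vertices are sorted
by non-decreasing value of `f` (ties being broken in any way), and the simplices are listed in
consecutive blocks, the block of the vertex `v` consisting of all simplices whose last vertex
in the sorted list is `v`. -/
structure IsLowerStarFiltration (K : Set (Finset V)) (f : V → EReal) (r : Finset V → ℕ) :
    Prop where
  injOn : Set.InjOn r K
  face_lt : ∀ σ ∈ K, ∀ τ ∈ K, σ ⊂ τ → r σ < r τ
  vertex_sorted : ∀ u v : V, {u} ∈ K → {v} ∈ K → r {u} < r {v} → f u ≤ f v
  lower_star : ∀ σ ∈ K, ∀ v : V, {v} ∈ K → (∀ u ∈ σ, r {u} < r {v}) → r σ < r {v}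

/-- Some homology class (modulo two) that is created by `σ`, i.e. the class of a cycle which lies in
the subcomplex of the simplices up to `σ` and contains `σ`, is zero in the subcomplex of the
simplices up to `τ`. -/
def KilledBy (K : Set (Finset V)) (r : Finset V → ℕ) (σ τ : Finset V) : Prop :=
  ∃ c : Set (Finset V), c ⊆ {x ∈ K | x.card = σ.card + 1 ∧ r x ≤ r τ} ∧
    σ ∈ boundary c ∧ ∀ s ∈ boundary c, r s ≤ r σ

/-- `(σ, τ)` is a persistence pair of the simplexwise filtration `r` of `K`: a homology class is
created by `σ` and destroyed by `τ`. -/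
def IsPersistencePair (K : Set (Finset V)) (r : Finset V → ℕ) (σ τ : Finset V) : Prop :=
  σ ∈ K ∧ τ ∈ K ∧ τ.card = σ.card + 1 ∧ KilledBy K r σ τ ∧
    ∀ τ' ∈ K, τ'.card = σ.card + 1 → KilledBy K r σ τ' → r τ ≤ r τ'

/-- `(σ, τ)` is a persistence pair of persistence `f(τ) - f(σ) ≤ δ`.  (The subtraction is avoided
because `f` may take the value `⊤`; pairs of simplices of value `⊤` have persistence zero.) -/
def IsLowPair (K : Set (Finset V)) (f : V → EReal) (r : Finset V → ℕ) (δ : ℝ)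
    (σ τ : Finset V) : Prop :=
  IsPersistencePair K r σ τ ∧ simplexValue f τ ≤ simplexValue f σ + (δ : EReal)

/-- The persistence of `σ` is larger than `δ`: `σ` is in no pair of persistence at most `δ`.  Unpaired
simplices have persistence `∞`. -/
def HighPersistence (K : Set (Finset V)) (f : V → EReal) (r : Finset V → ℕ) (δ : ℝ)
    (σ : Finset V) : Prop :=
  ∀ τ, ¬ IsLowPair K f r δ σ τ ∧ ¬ IsLowPair K f r δ τ σ

/-! ### The reconstruction algorithm -/

/-- `x` is the unordered pair of endpoints of the simplex `e`. -/
def Spans (x : Sym2 V) (e : Finset V) : Prop := ∀ v, v ∈ x ↔ v ∈ e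

/-- The spanning forest: all vertices, together with the edges `e` that occur in a vertex-edge
persistence pair of persistence at most `δ`. -/
def spanningForest (K : Set (Finset V)) (f : V → EReal) (r : Finset V → ℕ) (δ : ℝ) :
    SimpleGraph V :=
  SimpleGraph.fromEdgeSet {x | ∃ e, Spans x e ∧ ∃ v : V, IsLowPair K f r δ {v} e}

/-- `s` is the sink (the vertex of lowest value, in the sorted list of vertices) of the component of
the forest `T` that contains `u`. -/
def IsSinkOf (T : SimpleGraph V) (r : Finset V → ℕ) (u s : V) : Prop :=
  T.Reachable u s ∧ ∀ w, T.Reachable u w → r {s} ≤ r {w}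

/-- The output graph of the algorithm: for every edge `e` of `K` with persistence larger than `δ`,
it contains `e` and the forest path from each endpoint `u` of `e` to the sink of the tree
containing `u`. -/
def outputGraph (K : Set (Finset V)) (f : V → EReal) (r : Finset V → ℕ) (δ : ℝ) :
    SimpleGraph V :=
  SimpleGraph.fromEdgeSet {x | ∃ e ∈ K, e.card = 2 ∧ HighPersistence K f r δ e ∧
    (Spans x e ∨ ∃ u ∈ e, ∃ s, IsSinkOf (spanningForest K f r δ) r u s ∧
      ∃ p : (spanningForest K f r δ).Walk u s, p.IsPath ∧ x ∈ p.edges)}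

/-- The edges of a graph as a set of 1-simplices. -/
def edgeSimplices (Γ : SimpleGraph V) : Set (Finset V) :=
  {e | ∃ x ∈ Γ.edgeSet, Spans x e}

/-- The maximal set of edges of `Γ` whose deletion does not eliminate a cycle of `Γ`. -/
def hairEdges (Γ : SimpleGraph V) : Set (Finset V) :=
  {e | ∃ x ∈ Γ.edgeSet, Spans x e ∧
    ∀ (v : V) (c : Γ.Walk v v), c.IsCycle → x ∉ c.edges}

/-- The simplicial complex (nonempty faces of members) generated by the triangles in `R`, with the
simplex `t` removed. -/
def regionMinus (R : Set (Finset V)) (t : Finset V) : Set (Finset V) :=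
  {s | s.Nonempty ∧ s ≠ t ∧ ∃ τ ∈ R, s ⊆ τ}

/-- The point-wise union of the simplices in `S`, their vertices being placed by `pos`. -/
def realize {X : Type*} [AddCommGroup X] [Module ℝ X] (pos : V → X) (S : Set (Finset V)) : Set X :=
  ⋃ s ∈ S, convexHull ℝ (pos '' (s : Set V))

end Combinatorics

/-! ### Deformation retractions and geometric graphs -/

/-- `X` deformation retracts to its subspace `A`: there is a homotopy from the identity
of `X` to a map into `A` that keeps the points of `A` fixed at all times. -/
def DeformationRetractsTo {Y : Type*} [TopologicalSpace Y] (X A : Set Y) : Prop :=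
  A ⊆ X ∧ ∃ F : C(unitInterval × X, X), (∀ x, F (0, x) = x) ∧ (∀ x, (F (1, x) : Y) ∈ A) ∧
    ∀ (t : unitInterval) (x : X), (x : Y) ∈ A → F (t, x) = x

/-- The plane. -/
abbrev Plane := EuclideanSpace ℝ (Fin 2)

/-- A geometric graph: finitely many points, and finitely many simple arcs that join such points and
are disjoint from them and from one another otherwise.  (A closed curve is subdivided by
further points.) -/
def IsGeometricGraph (G : Set Plane) : Prop :=
  ∃ (W : Finset Plane) (n : ℕ) (γ : Fin n → C(unitInterval, Plane)),
    (∀ i, Function.Injective (γ i)) ∧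
    (∀ i t, γ i t ∈ W ↔ t = 0 ∨ t = 1) ∧
    (∀ i j, i ≠ j → Set.range (γ i) ∩ Set.range (γ j) ⊆ W) ∧
    G = (W : Set Plane) ∪ ⋃ i, Set.range (γ i)

/-! ### The domain, its triangulation, and the augmentation to a sphere -/

/-- The domain `[0,1]²`. -/
def unitSquare : Set Plane := {x | ∀ i, 0 ≤ x i ∧ x i ≤ 1}

/-- `K` is a (finite) triangulation of the domain. -/
def IsTriangulation (K : Geometry.SimplicialComplex ℝ Plane) : Prop :=
  K.faces.Finite ∧ K.space = unitSquare

/-- A simplex of `K` as a simplex of the augmented complex, which has one further vertex `none`. -/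
def lift (σ : Finset Plane) : Finset (Option Plane) := σ.map Function.Embedding.some

/-- The triangulation of the sphere obtained from `K` by adding a vertex at infinity, `none`, and
joining it to all vertices and edges of `K` on the boundary of the square. -/
def augmented (K : Geometry.SimplicialComplex ℝ Plane) : Set (Finset (Option Plane)) :=
  lift '' K.faces ∪ {{none}} ∪
    Finset.insertNone '' {σ ∈ K.faces | convexHull ℝ (σ : Set Plane) ⊆ frontier unitSquare}

/-- The placement of the vertices of the augmented complex in space: the square lies at height `0`
and the vertex at infinity is the apex, at height `1`, of the pyramid over the square, so
that the augmented complex triangulates the surface of the pyramid. -/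
def pos : Option Plane → Plane × ℝ
  | none => (!₂[1 / 2, 1 / 2], 1)
  | some x => (x, 0)

/-- The function `f = -ρ` on the vertices of `K`. -/
def negDensity (ρ : Plane → ℝ) (x : Plane) : EReal := ((-ρ x : ℝ) : EReal)

/-- The function `f = -ρ`, extended by the value `∞` at the vertex at infinity. -/
def augmentedValue (ρ : Plane → ℝ) : Option Plane → EReal
  | none => ⊤
  | some x => negDensity ρ x

/-- The triangles of the augmented complex. -/
def triangles (K : Geometry.SimplicialComplex ℝ Plane) : Set (Finset (Option Plane)) :=
  {t ∈ augmented K | t.card = 3}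

/-- The triangles of the augmented complex that have persistence larger than `δ`. -/
def criticalTriangles (K : Geometry.SimplicialComplex ℝ Plane) (ρ : Plane → ℝ)
    (r : Finset (Option Plane) → ℕ) (δ : ℝ) : Set (Finset (Option Plane)) :=
  {t ∈ triangles K | HighPersistence (augmented K) (augmentedValue ρ) r δ t}

/-! ### The noise model -/

/-- The piecewise linear density given by the values of `ρ` at the vertices of `K` is a
`(β, ν, ω)`-approximation of `G`, the `ω`-neighborhood of `G` in the definition being the
subcomplex `Ω` of `K`.  As the neighborhood is a sublevel set of the lower-star filtration of `-ρ`, it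
contains each simplex of `K` all of whose vertices it contains. -/
structure IsApproximation (K Ω : Geometry.SimplicialComplex ℝ Plane) (G : Set Plane)
    (ρ : Plane → ℝ) (β ν ω : ℝ) : Prop where
  subcomplex : Ω.faces ⊆ K.faces
  full : ∀ σ ∈ K.faces, (∀ v ∈ σ, v ∈ Ω.vertices) → σ ∈ Ω.faces
  graph_subset : G ⊆ Ω.space
  dist_le : ∀ v ∈ Ω.vertices, Metric.infDist v G ≤ ω
  retracts : DeformationRetractsTo Ω.space G
  density_inside : ∀ v ∈ Ω.vertices, β ≤ ρ v ∧ ρ v ≤ β + ν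
  density_outside : ∀ v ∈ K.vertices, v ∉ Ω.vertices → 0 ≤ ρ v ∧ ρ v ≤ ν
  gap : 2 * ν < β

end GraphReconstruction

end

open scoped symmDiff

namespace GraphReconstruction

/-! ### Chains modulo two and their boundary. -/

section Chains

variable {V : Type*}

/-! The values of `f` on simplices of Ω lie in [-β-ν, -β], those on the other simplices of K in [-ν,
0], so Ω is an initial piece of the filtration. As ν ≤ δ < β-ν, a pair has persistence larger than δ
exactly if it begins in Ω and ends outside (`isLowPair_iff`), and δ leaves the argument. Ω is
connected, being retracted to the connected G; hence a component born in Ω dies in Ω, and only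
edge-triangle pairs can leave Ω. Their edges are the essential edges; the essential triangles are
their partners and the unpaired last triangle. The negative edges, those paired with vertices, form
a spanning tree of K⁺ whose part in Ω spans Ω. The output graph consists of the essential edges and
of tree paths inside Ω to one common sink (`output_structure`).

The topology of the sphere enters only through the facts gathered in `IsFilteredSphere`: an edge is
in two triangles, cycles of edges bound, the only nonzero cycle of triangles is the sum of all, and
vertices are linked. They are proved for K from plane geometry and carried over to the cone at
infinity.

The key lemma is `exists_matched_boundary`: a nonempty set X of triangles without essential ones has
a matched edge in its boundary, that is, an edge in an edge-triangle pair that does not leave Ω. Let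
t be the last triangle of X and m the last edge of its boundary. The edge m is not negative, because
∂X is a cycle ending in m. If m were essential, its partner would come no later than t, so t would
be outside Ω; then the partner of t would be outside Ω too, although it comes no later than m.

For the collapses, a family of matched edge-triangle pairs has as many edges as triangles, and the
key lemma always supplies a free edge, so all of its triangles can be removed
(`collapses_triangles`). Outside Ω only tree edges remain, and these are pruned
(`collapses_forest`). Inside Ω the same procedure ends at any subgraph that consists of the
essential edges and a connected part of the tree (`collapses_inside`). Collapses are deformation
retractions. If there are no essential edges, Ω collapses to a vertex and its retract G is
contractible; otherwise the output graph is an admissible target.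

The regions are the faces of the output graph on the sphere. The boundary of a union of faces has no
matched edge, so every nonempty union of faces contains an essential triangle. Each set of essential
edges is the trace of a cycle of the graph, and this cycle bounds; comparing the numbers of subsets
shows that every essential triangle other than the last is the only one in some union of faces. So
each face contains exactly one, and an edge on a cycle separates two different faces
(`exists_regions`). -/

theorem odd_ncard_symmDiff {α : Type*} {a b : Set α} (ha : a.Finite) (hb : b.Finite) :
    Odd (a ∆ b).ncard ↔ (Odd a.ncard ↔ ¬ Odd b.ncard) := by
  have h1 : (a ∆ b).ncard = (a \ b).ncard + (b \ a).ncard :=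
    Set.ncard_union_eq (disjoint_sdiff_sdiff) ha.sdiff hb.sdiff
  have h2 := Set.ncard_inter_add_ncard_sdiff_eq_ncard a b ha
  have h3 := Set.ncard_inter_add_ncard_sdiff_eq_ncard b a hb
  rw [Set.inter_comm] at h3
  simp only [Nat.odd_iff]
  omega

/-- Symmetric difference is addition modulo two, and incidence counts add. Finiteness matters
because `ncard` is zero on infinite sets. -/
theorem boundary_symmDiff {c d : Set (Finset V)} (hc : c.Finite) (hd : d.Finite) :
    boundary (c ∆ d) = boundary c ∆ boundary d := by
  ext σ
  have key : {τ ∈ c ∆ d | σ ⊆ τ ∧ τ.card = σ.card + 1} =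
      {τ ∈ c | σ ⊆ τ ∧ τ.card = σ.card + 1} ∆ {τ ∈ d | σ ⊆ τ ∧ τ.card = σ.card + 1} := by
    ext τ
    simp only [Set.mem_symmDiff, Set.mem_ofPred_eq]
    tauto
  have := odd_ncard_symmDiff (hc.subset (Set.sep_subset c fun τ => σ ⊆ τ ∧ τ.card = σ.card + 1))
    (hd.subset (Set.sep_subset d fun τ => σ ⊆ τ ∧ τ.card = σ.card + 1))
  simp only [← key] at this
  simp only [boundary, Set.mem_symmDiff (s := {σ | _}), Set.mem_ofPred_eq, this]
  tauto

theorem exists_mem_of_mem_boundary {c : Set (Finset V)} {s : Finset V} (h : s ∈ boundary c) :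
    ∃ t ∈ c, s ⊆ t ∧ t.card = s.card + 1 := by
  obtain ⟨t, ht⟩ : {τ ∈ c | s ⊆ τ ∧ τ.card = s.card + 1}.Nonempty := by
    by_contra hne
    rw [Set.not_nonempty_iff_eq_empty] at hne
    have := h.2
    rw [hne] at this
    simp at this
  exact ⟨t, ht.1, ht.2⟩

@[simp] theorem boundary_empty : boundary (∅ : Set (Finset V)) = ∅ := by
  ext s
  simp [boundary]

theorem mem_boundary_singleton {s t : Finset V} :
    s ∈ boundary {t} ↔ s.Nonempty ∧ s ⊆ t ∧ t.card = s.card + 1 := by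
  by_cases h : s ⊆ t ∧ t.card = s.card + 1
  · have : {τ ∈ ({t} : Set (Finset V)) | s ⊆ τ ∧ τ.card = s.card + 1} = {t} := by
      ext τ
      simp only [Set.mem_ofPred_eq, Set.mem_singleton_iff]
      constructor
      · exact fun h => h.1
      · rintro rfl
        exact ⟨rfl, h⟩
    simp only [boundary, Set.mem_ofPred_eq, this]
    simp [h]
  · constructor
    · intro h'
      obtain ⟨τ, rfl, hτ⟩ := exists_mem_of_mem_boundary h'
      exact absurd hτ h
    · exact fun h' => absurd h'.2 h

theorem boundary_finite {c : Set (Finset V)} (hc : c.Finite) : (boundary c).Finite := by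
  refine (hc.biUnion (t := fun t => {s | s ⊆ t}) fun t _ => ?_).subset fun s hs => ?_
  · exact (t.powerset.finite_toSet).subset fun s hs => by simpa using hs
  · obtain ⟨t, ht, hst, -⟩ := exists_mem_of_mem_boundary hs
    exact Set.mem_biUnion ht hst

theorem chain_induction {P : Set (Finset V) → Prop} (h0 : P ∅)
    (h1 : ∀ t c, c.Finite → P c → P ({t} ∆ c)) {c : Set (Finset V)} (hc : c.Finite) : P c := by
  induction c, hc using Set.Finite.induction_on with
  | empty => exact h0
  | @insert a s ha hs ih =>
    have : insert a s = {a} ∆ s := by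
      ext x
      simp only [Set.mem_insert_iff, Set.mem_symmDiff, Set.mem_singleton_iff]
      grind
    rw [this]
    exact h1 a s hs ih

/-- A face of codimension two lacks two vertices of `t`; adding one or the other gives the only two
facets of `t` in between. -/
theorem boundary_boundary_singleton (t : Finset V) :
    boundary (boundary {t}) = ∅ := by
  classical
  ext s
  simp only [Set.mem_empty_iff_false, iff_false]
  rintro ⟨hs, hodd⟩
  by_cases h : s ⊆ t ∧ t.card = s.card + 2
  · obtain ⟨hst, hcard⟩ := h
    have h2 : (t \ s).card = 2 := by rw [Finset.card_sdiff_of_subset hst]; omega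
    obtain ⟨a, b, hab, htab⟩ := Finset.card_eq_two.1 h2
    have ha : a ∈ t \ s := by rw [htab]; simp
    have hb : b ∈ t \ s := by rw [htab]; simp
    rw [Finset.mem_sdiff] at ha hb
    have : {τ ∈ boundary {t} | s ⊆ τ ∧ τ.card = s.card + 1} = {insert a s, insert b s} := by
      ext τ
      simp only [Set.mem_ofPred_eq, mem_boundary_singleton, Set.mem_insert_iff,
        Set.mem_singleton_iff]
      constructor
      · rintro ⟨⟨-, hτt, -⟩, hsτ, hc⟩
        obtain ⟨x, hx⟩ := Finset.card_eq_one.1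
          (show (τ \ s).card = 1 by rw [Finset.card_sdiff_of_subset hsτ]; omega)
        have hτ : τ = insert x s := by
          rw [← Finset.sdiff_union_of_subset hsτ, hx]; rfl
        have hxt : x ∈ t \ s := by
          have : x ∈ τ \ s := by rw [hx]; simp
          rw [Finset.mem_sdiff] at this ⊢
          exact ⟨hτt this.1, this.2⟩
        rw [htab] at hxt
        simp only [Finset.mem_insert, Finset.mem_singleton] at hxt
        rcases hxt with rfl | rfl
        · exact Or.inl hτ
        · exact Or.inr hτ
      · rintro (rfl | rfl)
        · rw [Finset.card_insert_of_notMem ha.2]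
          exact ⟨⟨by simp, Finset.insert_subset ha.1 hst, by omega⟩, by simp, rfl⟩
        · rw [Finset.card_insert_of_notMem hb.2]
          exact ⟨⟨by simp, Finset.insert_subset hb.1 hst, by omega⟩, by simp, rfl⟩
    rw [this, Set.ncard_pair] at hodd
    · exact absurd hodd (by decide)
    · intro heq
      have : a ∈ insert b s := heq ▸ Finset.mem_insert_self a s
      simp [hab, ha.2] at this
  · obtain ⟨τ, hτ, hsτ, hc⟩ := exists_mem_of_mem_boundary (c := boundary {t}) ⟨hs, hodd⟩
    rw [mem_boundary_singleton] at hτ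
    exact h ⟨hsτ.trans hτ.2.1, by omega⟩

theorem boundary_boundary {c : Set (Finset V)} (hc : c.Finite) : boundary (boundary c) = ∅ := by
  refine chain_induction (P := fun c => boundary (boundary c) = ∅) (by simp) ?_ hc
  intro t c hc ih
  rw [boundary_symmDiff (Set.finite_singleton t) hc,
    boundary_symmDiff (boundary_finite (Set.finite_singleton t)) (boundary_finite hc), ih,
    boundary_boundary_singleton, symmDiff_self]
  rfl

theorem symmDiff_subset {α : Type*} {a b c : Set α} (h : a ⊆ c) (h' : b ⊆ c) : a ∆ b ⊆ c :=
  symmDiff_le (h.trans Set.subset_union_right) (h'.trans Set.subset_union_right)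

end Chains

/-! ### Persistence pairs -/

section Persistence

variable {V : Type*} {K : Set (Finset V)} {r : Finset V → ℕ}

/-- The simplices of dimension `k - 1` of `K` that come no later than `τ`. -/
def upTo (K : Set (Finset V)) (r : Finset V → ℕ) (k : ℕ) (τ : Finset V) : Set (Finset V) :=
  {x ∈ K | x.card = k ∧ r x ≤ r τ}

/-- A finite family of nonempty sets closed under nonempty subsets, injectively ordered by `r`
with faces first. -/
structure IsFilteredComplex (K : Set (Finset V)) (r : Finset V → ℕ) : Prop where
  finite : K.Finite
  nonempty : ∀ s ∈ K, s.Nonempty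
  down_closed : ∀ s ∈ K, ∀ t ⊆ s, t.Nonempty → t ∈ K
  injOn : Set.InjOn r K
  face_lt : ∀ σ ∈ K, ∀ τ ∈ K, σ ⊂ τ → r σ < r τ

namespace IsFilteredComplex

theorem mem_of_mem_boundary (hK : IsFilteredComplex K r) {c : Set (Finset V)} (hc : c ⊆ K)
    {s : Finset V} (hs : s ∈ boundary c) : s ∈ K := by
  obtain ⟨t, ht, hst, -⟩ := exists_mem_of_mem_boundary hs
  exact hK.down_closed t (hc ht) s hst hs.1

theorem finite_upTo (hK : IsFilteredComplex K r) (k : ℕ) (τ : Finset V) :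
    (upTo K r k τ).Finite := hK.finite.subset (Set.sep_subset _ _)

theorem exists_max (hK : IsFilteredComplex K r) {c : Set (Finset V)} (hc : c ⊆ K)
    (hne : c.Nonempty) : ∃ τ ∈ c, ∀ x ∈ c, r x ≤ r τ :=
  (hK.finite.subset hc).exists_maximalFor r c hne |>.imp fun τ h =>
    ⟨h.1, fun x hx => by
      by_contra hlt
      exact hlt (h.2 hx (by omega))⟩

theorem card_of_mem_boundary {c : Set (Finset V)} {k : ℕ} (hc : ∀ t ∈ c, t.card = k + 1)
    {s : Finset V} (hs : s ∈ boundary c) : s.card = k := by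
  obtain ⟨t, ht, -, h⟩ := exists_mem_of_mem_boundary hs
  have := hc t ht
  omega

/-- Before `τ`, no class created by `σ` dies. -/
theorem not_killed_before (hK : IsFilteredComplex K r) {σ τ : Finset V}
    (h : IsPersistencePair K r σ τ) {d : Set (Finset V)}
    (hd : ∀ x ∈ d, x ∈ K ∧ x.card = σ.card + 1 ∧ r x < r τ) (hσ : σ ∈ boundary d) :
    ∃ s ∈ boundary d, r σ < r s := by
  by_contra! hmax
  obtain ⟨t, ht, -, -⟩ := exists_mem_of_mem_boundary hσ
  obtain ⟨m, hm, hmx⟩ := hK.exists_max (fun x hx => (hd x hx).1) ⟨t, ht⟩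
  have := h.2.2.2.2 m (hd m hm).1 (hd m hm).2.1
    ⟨d, fun x hx => ⟨(hd x hx).1, (hd x hx).2.1, hmx x hx⟩, hσ, hmax⟩
  have := (hd m hm).2.2
  omega

/-- A killing chain that avoided `τ` would kill the class before `τ`. -/
theorem exists_killing_chain (hK : IsFilteredComplex K r) {σ τ : Finset V}
    (h : IsPersistencePair K r σ τ) :
    ∃ d ⊆ upTo K r (σ.card + 1) τ, τ ∈ d ∧ σ ∈ boundary d ∧ ∀ s ∈ boundary d, r s ≤ r σ := by
  obtain ⟨d, hd, hσ, hmax⟩ := h.2.2.2.1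
  refine ⟨d, hd, ?_, hσ, hmax⟩
  by_contra hτ
  obtain ⟨s, hs, hlt⟩ := hK.not_killed_before h (d := d) (fun x hx => by
    obtain ⟨h1, h2, h3⟩ := hd hx
    refine ⟨h1, h2, lt_of_le_of_ne h3 fun heq => hτ ?_⟩
    rwa [← hK.injOn h1 h.2.1 heq]) hσ
  exact absurd (hmax s hs) (by omega)

theorem symmDiff_lt (hK : IsFilteredComplex K r) {k : ℕ} {τ : Finset V} {c d : Set (Finset V)}
    (hc : c ⊆ upTo K r k τ) (hd : d ⊆ upTo K r k τ) (hτc : τ ∈ c) (hτd : τ ∈ d) :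
    ∀ x ∈ c ∆ d, x ∈ K ∧ x.card = k ∧ r x < r τ := by
  intro x hx
  obtain ⟨h1, h2, h3⟩ := symmDiff_subset hc hd hx
  refine ⟨h1, h2, lt_of_le_of_ne h3 fun heq => ?_⟩
  have := hK.injOn h1 (hc hτc).1 heq
  subst this
  simp [Set.mem_symmDiff, hτc, hτd] at hx

/-- The main tool for pairs: no chain ending in `τ` has a boundary that lies entirely before `σ`.
Adding such a chain to a killing chain would cancel `τ` and leave `σ` as the last boundary simplex,
so `σ` would be killed too early. -/
theorem exists_le_boundary (hK : IsFilteredComplex K r) {σ τ : Finset V}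
    (h : IsPersistencePair K r σ τ) {c : Set (Finset V)} (hc : c ⊆ upTo K r (σ.card + 1) τ)
    (hτ : τ ∈ c) : ∃ s ∈ boundary c, r σ ≤ r s := by
  by_contra! hlt
  obtain ⟨d, hd, hτd, hσ, hmax⟩ := hK.exists_killing_chain h
  have hb := boundary_symmDiff ((hK.finite_upTo _ _).subset hd) ((hK.finite_upTo _ _).subset hc)
  obtain ⟨s, hs, hlt'⟩ := hK.not_killed_before h (hK.symmDiff_lt hd hc hτd hτ) (by
    rw [hb]
    exact Or.inl ⟨hσ, fun h' => lt_irrefl _ (hlt σ h')⟩)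
  rw [hb] at hs
  rcases hs with hs | hs
  · exact absurd (hmax s hs.1) (by omega)
  · exact absurd (hlt s hs.1) (by omega)

/-- This is the reduction of a column of the boundary matrix: starting from `{τ}`, the last boundary
simplex is cancelled again and again, and the induction is on a strict bound for the positions in
the boundary. -/
theorem exists_cycle_of_not_second (hK : IsFilteredComplex K r) {τ : Finset V} (hτ : τ ∈ K)
    (h : ∀ σ, ¬ IsPersistencePair K r σ τ) :
    ∃ c ⊆ upTo K r τ.card τ, τ ∈ c ∧ boundary c = ∅ := by
  suffices H : ∀ n : ℕ, ∀ c ⊆ upTo K r τ.card τ, τ ∈ c → (∀ s ∈ boundary c, r s < n) →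
      ∃ c ⊆ upTo K r τ.card τ, τ ∈ c ∧ boundary c = ∅ by
    refine H (r τ + 1) {τ} (by rintro x rfl; exact ⟨hτ, rfl, le_rfl⟩) rfl fun s hs => ?_
    rw [mem_boundary_singleton] at hs
    have := hK.face_lt s (hK.down_closed τ hτ s hs.2.1 hs.1) τ hτ
      (Finset.ssubset_iff_subset_ne.2 ⟨hs.2.1, by rintro rfl; omega⟩)
    omega
  intro n
  induction n with
  | zero =>
    intro c hc hτc hb
    refine ⟨c, hc, hτc, Set.eq_empty_iff_forall_notMem.2 fun s hs => ?_⟩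
    simpa using hb s hs
  | succ n ih =>
    intro c hc hτc hb
    by_cases hex : ∃ s ∈ boundary c, r s = n
    · obtain ⟨s, hs, rfl⟩ := hex
      have hcK : c ⊆ K := fun x hx => (hc hx).1
      have hsK := hK.mem_of_mem_boundary hcK hs
      have hcard : τ.card = s.card + 1 := by
        obtain ⟨t, ht, -, h⟩ := exists_mem_of_mem_boundary hs
        rw [← (hc ht).2.1, h]
      rw [hcard] at hc ⊢
      have hkill : KilledBy K r s τ := ⟨c, hc, hs, fun x hx => by have := hb x hx; omega⟩
      have := h s
      simp only [IsPersistencePair, hsK, hτ, hcard, hkill, true_and, not_forall] at this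
      -- The simplex `s` is killed by `τ` but not paired with it, so an earlier `τ'` kills it
      -- already. Adding the chain `d` for `τ'` cancels `s` and does not touch `τ`.
      obtain ⟨τ', hτ', hcard', ⟨d, hd, hsd, hmax⟩, hlt⟩ := this
      push Not at hlt
      have hd' : d ⊆ upTo K r (s.card + 1) τ := fun x hx =>
        ⟨(hd hx).1, (hd hx).2.1, (hd hx).2.2.trans hlt.le⟩
      rw [hcard] at ih
      refine ih (c ∆ d) (symmDiff_subset hc hd')
        (Or.inl ⟨hτc, fun h' => absurd (hd h').2.2 (by omega)⟩) fun x hx => ?_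
      rw [boundary_symmDiff ((hK.finite_upTo _ _).subset hc) ((hK.finite_upTo _ _).subset hd')]
        at hx
      have hxK : x ∈ K := by
        rcases hx with hx | hx
        · exact hK.mem_of_mem_boundary hcK hx.1
        · exact hK.mem_of_mem_boundary (fun y hy => (hd hy).1) hx.1
      have hle : r x ≤ r s := by
        rcases hx with hx | hx
        · have := hb x hx.1; omega
        · exact hmax x hx.1
      refine lt_of_le_of_ne hle fun heq => ?_
      have := hK.injOn hxK hsK heq
      subst this
      simp [Set.mem_symmDiff, hs, hsd] at hx
    · refine ih c hc hτc fun s hs => ?_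
      have := hb s hs
      have : r s ≠ n := fun h => hex ⟨s, hs, h⟩
      omega

theorem pair_of_killedBy (hK : IsFilteredComplex K r) {σ τ : Finset V} (hσ : σ ∈ K) (hτ : τ ∈ K)
    (hcard : τ.card = σ.card + 1) (h : KilledBy K r σ τ) :
    ∃ τ', IsPersistencePair K r σ τ' ∧ r τ' ≤ r τ := by
  have hfin : {τ' ∈ K | τ'.card = σ.card + 1 ∧ KilledBy K r σ τ'}.Finite :=
    hK.finite.subset (Set.sep_subset _ _)
  obtain ⟨τ', h', hmin⟩ := hfin.exists_minimalFor r _ ⟨τ, hτ, hcard, h⟩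
  have hmin' : ∀ x ∈ {τ' ∈ K | τ'.card = σ.card + 1 ∧ KilledBy K r σ τ'}, r τ' ≤ r x :=
    fun x hx => by
      by_contra hlt
      exact hlt (hmin hx (by omega))
  exact ⟨τ', ⟨hσ, h'.1, h'.2.1, h'.2.2, fun x hx hc hk => hmin' x ⟨hx, hc, hk⟩⟩,
    hmin' τ ⟨hτ, hcard, h⟩⟩

theorem pair_of_chain (hK : IsFilteredComplex K r) {σ τ : Finset V} {c : Set (Finset V)}
    (hc : c ⊆ upTo K r (σ.card + 1) τ) (hσ : σ ∈ boundary c)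
    (hmax : ∀ s ∈ boundary c, r s ≤ r σ) :
    ∃ τ', IsPersistencePair K r σ τ' ∧ r τ' ≤ r τ := by
  obtain ⟨t, ht, -, -⟩ := exists_mem_of_mem_boundary hσ
  have hcK : c ⊆ K := fun x hx => (hc hx).1
  obtain ⟨m, hm, hmx⟩ := hK.exists_max hcK ⟨t, ht⟩
  obtain ⟨τ', h1, h2⟩ := hK.pair_of_killedBy (hK.mem_of_mem_boundary hcK hσ) (hcK hm) (hc hm).2.1
    ⟨c, fun x hx => ⟨hcK hx, (hc hx).2.1, hmx x hx⟩, hσ, hmax⟩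
  exact ⟨τ', h1, h2.trans (hc hm).2.2⟩

theorem pair_right_unique (hK : IsFilteredComplex K r) {σ τ τ' : Finset V}
    (h : IsPersistencePair K r σ τ) (h' : IsPersistencePair K r σ τ') : τ = τ' :=
  hK.injOn h.2.1 h'.2.1 (le_antisymm (h.2.2.2.2 τ' h'.2.1 h'.2.2.1 h'.2.2.2.1)
    (h'.2.2.2.2 τ h.2.1 h.2.2.1 h.2.2.2.1))

/-- The killing chain of `(σ', τ)` ends in `τ` and has `σ'` as its last boundary simplex;
`exists_le_boundary` for `(σ, τ)` bounds that from below. -/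
theorem pair_left_le (hK : IsFilteredComplex K r) {σ σ' τ : Finset V}
    (h : IsPersistencePair K r σ τ) (h' : IsPersistencePair K r σ' τ) : r σ ≤ r σ' := by
  obtain ⟨d, hd, hτd, hσ, hmax⟩ := hK.exists_killing_chain h'
  have hcard : σ'.card = σ.card := by
    have := h.2.2.1
    have := h'.2.2.1
    omega
  rw [hcard] at hd
  obtain ⟨s, hs, hle⟩ := hK.exists_le_boundary h hd hτd
  exact hle.trans (hmax s hs)

theorem pair_left_unique (hK : IsFilteredComplex K r) {σ σ' τ : Finset V}
    (h : IsPersistencePair K r σ τ) (h' : IsPersistencePair K r σ' τ) : σ = σ' :=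
  hK.injOn h.1 h'.1 (le_antisymm (hK.pair_left_le h h') (hK.pair_left_le h' h))

/-- If `τ` were also killed later, the boundary of a killing chain would be a cycle ending in `τ`,
but `exists_le_boundary` gives every chain ending in `τ` a nonempty boundary. -/
theorem not_first_of_second (hK : IsFilteredComplex K r) {σ τ υ : Finset V}
    (h : IsPersistencePair K r σ τ) : ¬ IsPersistencePair K r τ υ := by
  intro h'
  obtain ⟨d, hd, -, hτ, hmax⟩ := hK.exists_killing_chain h'
  have hdK : d ⊆ K := fun x hx => (hd hx).1
  obtain ⟨s, hs, -⟩ := hK.exists_le_boundary h (c := boundary d) (fun s hs =>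
    ⟨hK.mem_of_mem_boundary hdK hs, by
      rw [card_of_mem_boundary (fun t ht => (hd ht).2.1) hs, h.2.2.1], hmax s hs⟩) hτ
  rw [boundary_boundary (hK.finite.subset hdK)] at hs
  exact hs

theorem pair_lt (hK : IsFilteredComplex K r) {σ τ : Finset V}
    (h : IsPersistencePair K r σ τ) : r σ < r τ := by
  obtain ⟨d, hd, -, hσ, -⟩ := hK.exists_killing_chain h
  obtain ⟨t, ht, hst, hc⟩ := exists_mem_of_mem_boundary hσ
  have := hK.face_lt σ h.1 t (hd ht).1 (Finset.ssubset_iff_subset_ne.2 ⟨hst, by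
    rintro rfl; omega⟩)
  exact this.trans_le (hd ht).2.2

end IsFilteredComplex

end Persistence

end GraphReconstruction

namespace GraphReconstruction

/-! ### Links of vertices and elementary collapses -/

section Collapses

variable {V : Type*} [DecidableEq V]

/-- `u` and `v` are joined by a path of edges in `E`. -/
def Linked (E : Set (Finset V)) : V → V → Prop :=
  Relation.ReflTransGen fun x y => x ≠ y ∧ ({x, y} : Finset V) ∈ E

theorem Linked.symm {E : Set (Finset V)} {u v : V} (h : Linked E u v) : Linked E v u := by
  induction h with
  | refl => exact .refl
  | @tail b c _ hbc ih => exact .head ⟨hbc.1.symm, Finset.pair_comm b c ▸ hbc.2⟩ ih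

theorem Linked.trans {E : Set (Finset V)} {u v w : V} (h : Linked E u v) (h' : Linked E v w) :
    Linked E u w := Relation.ReflTransGen.trans h h'

theorem Linked.mono {E E' : Set (Finset V)} (hE : E ⊆ E') {u v : V} (h : Linked E u v) :
    Linked E' u v := by
  induction h with
  | refl => exact .refl
  | tail _ hbc ih => exact .tail ih ⟨hbc.1, hE hbc.2⟩

theorem Linked.single {E : Set (Finset V)} {u v : V} (hne : u ≠ v)
    (h : ({u, v} : Finset V) ∈ E) : Linked E u v := Relation.ReflTransGen.single ⟨hne, h⟩

theorem Linked.refl {E : Set (Finset V)} {u : V} : Linked E u u := Relation.ReflTransGen.refl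

theorem Linked.exists_crossing {E : Set (Finset V)} {u v : V} (h : Linked E u v) {Z : Set V}
    (hu : u ∈ Z) (hv : v ∉ Z) : ∃ x ∈ Z, ∃ y ∉ Z, ({x, y} : Finset V) ∈ E := by
  induction h with
  | refl => exact absurd hu hv
  | @tail b c _ hbc ih =>
    by_cases hb : b ∈ Z
    · exact ⟨b, hb, c, hv, hbc.2⟩
    · exact ih hb

theorem boundary_pair {x y : V} (h : x ≠ y) :
    boundary {({x, y} : Finset V)} = {{x}} ∆ {{y}} := by
  ext s
  simp only [mem_boundary_singleton, Finset.card_pair h, Set.mem_symmDiff, Set.mem_singleton_iff]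
  constructor
  · rintro ⟨-, hs, hc⟩
    obtain ⟨z, rfl⟩ := Finset.card_eq_one.1 (show s.card = 1 by omega)
    simp only [Finset.singleton_subset_iff, Finset.mem_insert, Finset.mem_singleton] at hs
    rcases hs with rfl | rfl
    · exact Or.inl ⟨rfl, by simpa using h⟩
    · exact Or.inr ⟨rfl, by simpa using h.symm⟩
  · rintro (⟨rfl, -⟩ | ⟨rfl, -⟩) <;> simp

theorem Linked.exists_chain {E : Set (Finset V)} {u v : V} (h : Linked E u v) :
    ∃ c ⊆ E, c.Finite ∧ (∀ e ∈ c, e.card = 2) ∧ boundary c = {{u}} ∆ {{v}} := by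
  induction h with
  | refl => exact ⟨∅, Set.empty_subset _, Set.finite_empty, by simp, by simp⟩
  | @tail b d _ hbd ih =>
    obtain ⟨c, hc, hf, hcard, hb⟩ := ih
    refine ⟨c ∆ {{b, d}}, symmDiff_subset hc (by simpa using hbd.2),
      hf.symmDiff (Set.finite_singleton _), ?_, ?_⟩
    · rintro e (he | he)
      · exact hcard e he.1
      · rw [Set.mem_singleton_iff.1 he.1, Finset.card_pair hbd.1]
    · rw [boundary_symmDiff hf (Set.finite_singleton _), hb, boundary_pair hbd.1,
        symmDiff_assoc, symmDiff_symmDiff_cancel_left]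

theorem even_ncard_boundary {c : Set (Finset V)} (hc : c.Finite) (h : ∀ e ∈ c, e.card = 2) :
    ¬ Odd (boundary c).ncard := by
  induction c, hc using Set.Finite.induction_on with
  | empty => simp
  | @insert a s ha hs ih =>
    have hins : insert a s = {a} ∆ s := by
      ext x
      simp only [Set.mem_insert_iff, Set.mem_symmDiff, Set.mem_singleton_iff]
      grind
    have ih' := ih fun e he => h e (Or.inr he)
    obtain ⟨x, y, hxy, rfl⟩ := Finset.card_eq_two.1 (h a (Or.inl rfl))
    rw [hins, boundary_symmDiff (Set.finite_singleton _) hs,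
      odd_ncard_symmDiff (boundary_finite (Set.finite_singleton _)) (boundary_finite hs),
      boundary_pair hxy, odd_ncard_symmDiff (Set.finite_singleton _) (Set.finite_singleton _)]
    simp [ih']

/-- An edge of a cycle is not the only edge of the cycle across a cut. -/
theorem exists_other_crossing {c : Set (Finset V)} (hc : c.Finite) (h : ∀ e ∈ c, e.card = 2)
    (hb : boundary c = ∅) {Z : Set V} {x y : V} (hx : x ∈ Z) (hy : y ∉ Z)
    (hxy : ({x, y} : Finset V) ∈ c) :
    ∃ x' ∈ Z, ∃ y' ∉ Z, ({x', y'} : Finset V) ∈ c ∧ ({x', y'} : Finset V) ≠ {x, y} := by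
  by_contra! hno
  have hne : x ≠ y := fun h => hy (h ▸ hx)
  have hin : ∀ e ∈ c, e ≠ {x, y} → ∀ v ∈ e, v ∈ Z → ∀ w ∈ e, w ∈ Z := by
    intro e he hexy v hv hvZ w hw
    by_contra hwZ
    have hvw : v ≠ w := fun h => hwZ (h ▸ hvZ)
    have : ({v, w} : Finset V) = e := Finset.eq_of_subset_of_card_le
      (by intro z hz; simp only [Finset.mem_insert, Finset.mem_singleton] at hz; grind)
      (by rw [h e he, Finset.card_pair hvw])
    exact hexy (this ▸ hno v hvZ w hwZ (this ▸ he))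
  -- If `{x, y}` were the only crossing edge, then the part of `c` inside `Z` together with it would
  -- have the single boundary vertex `y`, against `even_ncard_boundary`.
  set d : Set (Finset V) := {e ∈ c | ∀ v ∈ e, v ∈ Z} with hd
  have hdf : d.Finite := hc.subset (Set.sep_subset _ _)
  have key : boundary (d ∆ {{x, y}}) = {{y}} := by
    ext s
    have hne' : d ∆ {{x, y}} = d ∪ {{x, y}} := by
      ext e
      simp only [Set.mem_symmDiff, Set.mem_union, Set.mem_singleton_iff]
      constructor
      · tauto
      · rintro (h1 | rfl)
        · exact Or.inl ⟨h1, by rintro rfl; exact hy (h1.2 y (by simp))⟩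
        · exact Or.inr ⟨rfl, fun h1 => hy (h1.2 y (by simp))⟩
    rw [hne', Set.mem_singleton_iff]
    by_cases hs : ∃ v ∈ Z, s = {v}
    · obtain ⟨v, hv, rfl⟩ := hs
      have : {τ ∈ d ∪ {{x, y}} | ({v} : Finset V) ⊆ τ ∧ τ.card = ({v} : Finset V).card + 1} =
          {τ ∈ c | ({v} : Finset V) ⊆ τ ∧ τ.card = ({v} : Finset V).card + 1} := by
        ext e
        simp only [Set.mem_ofPred_eq, Set.mem_union, Set.mem_singleton_iff,
          Finset.singleton_subset_iff]
        constructor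
        · rintro ⟨h1 | rfl, h2⟩
          · exact ⟨h1.1, h2⟩
          · exact ⟨hxy, h2⟩
        · rintro ⟨h1, h2⟩
          by_cases he : e = {x, y}
          · exact ⟨Or.inr he, h2⟩
          · exact ⟨Or.inl ⟨h1, hin e h1 he v h2.1 hv⟩, h2⟩
      have h2 : ({v} : Finset V) ∉ boundary c := by rw [hb]; simp
      rw [boundary, Set.mem_ofPred_eq, this]
      have hvy : ({v} : Finset V) ≠ {y} := by
        rw [Ne, Finset.singleton_inj]
        rintro rfl
        exact hy hv
      exact iff_of_false h2 hvy
    · constructor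
      · intro hs'
        obtain ⟨t, ht, hst, hcard⟩ := exists_mem_of_mem_boundary hs'
        rcases ht with ht | rfl
        · have hc1 : s.card = 1 := by have := h t ht.1; omega
          obtain ⟨v, rfl⟩ := Finset.card_eq_one.1 hc1
          exact absurd ⟨v, ht.2 v (by simpa using hst), rfl⟩ hs
        · have hc1 : s.card = 1 := by have := Finset.card_pair hne; omega
          obtain ⟨v, rfl⟩ := Finset.card_eq_one.1 hc1
          simp only [Finset.singleton_subset_iff, Finset.mem_insert, Finset.mem_singleton] at hst
          rcases hst with rfl | rfl
          · exact absurd ⟨v, hx, rfl⟩ hs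
          · rfl
      · rintro rfl
        have : {τ ∈ d ∪ {{x, y}} | ({y} : Finset V) ⊆ τ ∧ τ.card = ({y} : Finset V).card + 1} =
            {{x, y}} := by
          ext e
          simp only [Set.mem_ofPred_eq, Set.mem_union, Set.mem_singleton_iff,
            Finset.singleton_subset_iff]
          constructor
          · rintro ⟨h1 | h1, h2⟩
            · exact absurd (h1.2 y h2.1) hy
            · exact h1
          · rintro rfl
            simp [Finset.card_pair hne]
        refine ⟨by simp, ?_⟩
        rw [this]
        simp
  have := even_ncard_boundary (c := d ∆ {{x, y}}) (hdf.symmDiff (Set.finite_singleton _)) (by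
    rintro e (he | he)
    · exact h e he.1.1
    · rw [Set.mem_singleton_iff.1 he.1, Finset.card_pair hne])
  rw [key] at this
  simp at this

/-- A sequence of elementary collapses: a simplex `σ` and its only proper coface `insert a σ` are
removed. -/
inductive Collapses : Set (Finset V) → Set (Finset V) → Prop
  | refl (S : Set (Finset V)) : Collapses S S
  | step {S A : Set (Finset V)} (σ : Finset V) (a : V) (hσ : σ.Nonempty) (ha : a ∉ σ)
      (hmem : insert a σ ∈ S) (hfree : ∀ s ∈ S, σ ⊆ s → s = σ ∨ s = insert a σ)
      (h : Collapses (S \ {σ, insert a σ}) A) : Collapses S A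

theorem Collapses.trans {S A B : Set (Finset V)} (h : Collapses S A) (h' : Collapses A B) :
    Collapses S B := by
  induction h with
  | refl => exact h'
  | step σ a hσ ha hmem hfree _ ih => exact .step σ a hσ ha hmem hfree (ih h')

/-- Triangles can be removed through edges `P` if there are as many, and no set of these triangles
has a boundary avoiding `P`. -/
theorem collapses_triangles {B P Q : Set (Finset V)} (hP : P.Finite) (hQ : Q.Finite)
    (hPc : ∀ e ∈ P, e.card = 2) (hQc : ∀ t ∈ Q, t.card = 3) (hcard : P.ncard = Q.ncard)
    (hU : ∀ X ⊆ Q, X.Nonempty → ∃ e ∈ P, e ∈ boundary X) (hB : ∀ s ∈ B, ∀ e ∈ P, ¬ e ⊆ s)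
    (htwo : ∀ e ∈ P, {t ∈ Q | e ⊆ t}.ncard ≤ 2) : Collapses (B ∪ P ∪ Q) B := by
  induction hn : Q.ncard generalizing P Q with
  | zero =>
    rw [hn, Set.ncard_eq_zero hP] at hcard
    rw [Set.ncard_eq_zero hQ] at hn
    simpa [hn, hcard] using Collapses.refl B
  | succ n ih =>
    have hne : Q.Nonempty := by
      rw [Set.nonempty_iff_ne_empty]
      rintro rfl
      simp at hn
    obtain ⟨e, heP, heb⟩ := hU Q subset_rfl hne
    have hset : {t ∈ Q | e ⊆ t ∧ t.card = e.card + 1} = {t ∈ Q | e ⊆ t} := by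
      ext t
      simp only [Set.mem_ofPred_eq]
      constructor
      · exact fun h => ⟨h.1, h.2.1⟩
      · exact fun h => ⟨h.1, h.2, by rw [hQc t h.1, hPc e heP]⟩
    have hone : {t ∈ Q | e ⊆ t}.ncard = 1 := by
      have h1 := htwo e heP
      have h2 := heb.2
      rw [hset, Nat.odd_iff] at h2
      omega
    obtain ⟨t, ht⟩ := Set.ncard_eq_one.1 hone
    have htm : t ∈ Q ∧ e ⊆ t := by
      have : t ∈ {t ∈ Q | e ⊆ t} := by rw [ht]; rfl
      exact this
    have huniq : ∀ s ∈ Q, e ⊆ s → s = t := fun s hs hes => by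
      have : s ∈ {t ∈ Q | e ⊆ t} := ⟨hs, hes⟩
      rwa [ht] at this
    obtain ⟨a, hat, hae⟩ : ∃ a ∈ t, a ∉ e := Finset.exists_mem_notMem_of_card_lt_card (by
      rw [hQc t htm.1, hPc e heP]; norm_num)
    have hins : insert a e = t := Finset.eq_of_subset_of_card_le
      (Finset.insert_subset hat htm.2)
      (by rw [Finset.card_insert_of_notMem hae, hQc t htm.1, hPc e heP])
    have heq : (B ∪ P ∪ Q) \ {e, insert a e} = B ∪ (P \ {e}) ∪ (Q \ {t}) := by
      rw [hins]
      ext s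
      have h1 : s ∈ B → s ≠ e := by rintro h rfl; exact hB s h s heP subset_rfl
      have h2 : s ∈ B → s ≠ t := by rintro h rfl; exact hB s h e heP htm.2
      have h3 : s ∈ P → s ≠ t := by
        rintro h rfl; have := hPc s h; have := hQc s htm.1; omega
      have h4 : s ∈ Q → s ≠ e := by
        rintro h rfl; have := hPc s heP; have := hQc s h; omega
      simp only [Set.mem_sdiff, Set.mem_union, Set.mem_insert_iff, Set.mem_singleton_iff]
      tauto
    refine .step e a (Finset.card_pos.1 (by rw [hPc e heP]; norm_num)) hae
      (Or.inr (hins ▸ htm.1)) ?_ ?_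
    · rintro s ((hs | hs) | hs) hes
      · exact absurd hes (hB s hs e heP)
      · exact Or.inl (Finset.eq_of_subset_of_card_le hes (by rw [hPc e heP, hPc s hs])).symm
      · exact Or.inr (hins ▸ huniq s hs hes)
    · rw [heq]
      refine ih hP.sdiff hQ.sdiff (fun f hf => hPc f hf.1) (fun f hf => hQc f hf.1) ?_ ?_ ?_ ?_ ?_
      · rw [Set.ncard_sdiff_singleton_of_mem heP, Set.ncard_sdiff_singleton_of_mem htm.1, hcard]
      · intro X hX hXne
        obtain ⟨f, hf, hfb⟩ := hU X (hX.trans Set.sdiff_subset) hXne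
        -- The edge found for `X` differs from `e`, since the only triangle at `e` has been removed.
        refine ⟨f, ⟨hf, ?_⟩, hfb⟩
        rintro rfl
        obtain ⟨s, hs, hfs, -⟩ := exists_mem_of_mem_boundary hfb
        exact (hX hs).2 (huniq s (hX hs).1 hfs)
      · exact fun s hs f hf => hB s hs f hf.1
      · intro f hf
        have hsub : {s ∈ Q \ {t} | f ⊆ s} ⊆ {s ∈ Q | f ⊆ s} := fun s hs => ⟨hs.1.1, hs.2⟩
        exact (Set.ncard_le_ncard hsub (hQ.subset (Set.sep_subset _ _))).trans (htwo f hf.1)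
      · rw [Set.ncard_sdiff_singleton_of_mem htm.1, hn]; rfl

/-- A complex collapses to a subcomplex `A` if the other simplices are vertices and edges of a
forest `N` which connects each vertex to `A` and the vertices of `A` in `A`. -/
theorem collapses_forest {S A N : Set (Finset V)} (hSf : S.Finite)
    (hSd : ∀ s ∈ S, ∀ t ⊆ s, t.Nonempty → t ∈ S) (hAS : A ⊆ S)
    (hAd : ∀ s ∈ A, ∀ t ⊆ s, t.Nonempty → t ∈ A)
    (hSA : ∀ s ∈ S, s ∉ A → s.card = 1 ∨ s ∈ N) (hNc : ∀ e ∈ N, e.card = 2)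
    (hN : ∀ X ⊆ N, X.Finite → boundary X = ∅ → X = ∅)
    (hlA : ∀ u v, {u} ∈ A → {v} ∈ A → Linked (A ∩ N) u v)
    (hlS : ∀ u, {u} ∈ S → ∃ v, {v} ∈ A ∧ Linked (S ∩ N) u v) : Collapses S A := by
  -- The induction enlarges `A` instead of shrinking `S`: a leaf is attached to `A`, the result is
  -- reached from `S` by induction, and the leaf is collapsed at the end.
  induction hn : (S \ A).ncard using Nat.strong_induction_on generalizing A with
  | _ n ih =>
    by_cases hall : ∀ u, {u} ∈ S → {u} ∈ A
    · have : S = A := by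
        refine Set.Subset.antisymm (fun s hs => ?_) hAS
        by_contra hsA
        rcases hSA s hs hsA with h | h
        · obtain ⟨u, rfl⟩ := Finset.card_eq_one.1 h
          exact hsA (hall u hs)
        · obtain ⟨x, y, hxy, rfl⟩ := Finset.card_eq_two.1 (hNc s h)
          -- An edge of `N` outside `A` with both endpoints in `A` would close a cycle with a path
          -- in `A ∩ N`.
          obtain ⟨c, hc, hcf, -, hcb⟩ := (hlA x y (hall x (hSd _ hs _ (by simp) (by simp)))
            (hall y (hSd _ hs _ (by simp) (by simp)))).exists_chain
          have h0 := hN (c ∆ {{x, y}}) (symmDiff_subset (fun e he => (hc he).2) (by simpa using h))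
            (hcf.symmDiff (Set.finite_singleton _)) (by
              rw [boundary_symmDiff hcf (Set.finite_singleton _), hcb, boundary_pair hxy,
                symmDiff_self]; rfl)
          have : ({x, y} : Finset V) ∈ c ∆ {{x, y}} := Or.inr ⟨rfl, fun h' => hsA (hc h').1⟩
          rw [h0] at this
          exact this
      rw [this]
      exact .refl A
    · push Not at hall
      obtain ⟨u, hu, huA⟩ := hall
      obtain ⟨v, hv, hlink⟩ := hlS u hu
      -- The path from `u` to `A` has an edge that enters `A`; its outer endpoint `x` is the new
      -- leaf.
      obtain ⟨x, hx, y, hy, hxy⟩ := hlink.exists_crossing (Z := {x | ({x} : Finset V) ∉ A}) huA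
        (fun h => h hv)
      have hyA : {y} ∈ A := not_not.1 hy
      have hxA : ({x} : Finset V) ∉ A := hx
      have hne : x ≠ y := fun h => hy (h ▸ hx)
      have hxyA : ({x, y} : Finset V) ∉ A := fun h => hxA (hAd _ h _ (by simp) (by simp))
      have hins : insert y ({x} : Finset V) = {x, y} := Finset.pair_comm y x
      set A' : Set (Finset V) := A ∪ {{x}, {x, y}} with hA'
      have hAA' : A ⊆ A' := Set.subset_union_left
      have hxS : {x} ∈ S := hSd _ hxy.1 _ (by simp) (by simp)
      have hA'S : A' ⊆ S := by
        refine Set.union_subset hAS ?_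
        rintro s (rfl | rfl)
        · exact hxS
        · exact hxy.1
      have hxyl : Linked (A' ∩ N) x y := Linked.single hne ⟨Or.inr (Or.inr rfl), hxy.2⟩
      have hvert : ∀ w, {w} ∈ A' → ∃ w', {w'} ∈ A ∧ Linked (A' ∩ N) w w' := by
        rintro w (hw | hw | hw)
        · exact ⟨w, hw, .refl⟩
        · rw [Finset.singleton_inj] at hw
          exact ⟨y, hyA, hw ▸ hxyl⟩
        · have := congrArg Finset.card hw
          rw [Finset.card_pair hne] at this
          simp at this
      have h1 : Collapses S A' := by
        refine ih (S \ A').ncard ?_ hA'S ?_ (fun s hs hsA => hSA s hs fun h => hsA (hAA' h)) ?_ ?_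
          rfl
        · rw [← hn]
          refine Set.ncard_lt_ncard ⟨Set.sdiff_subset_sdiff_right hAA', fun h => ?_⟩ hSf.sdiff
          exact (h ⟨hxS, hxA⟩).2 (Or.inr (Or.inl rfl))
        · rintro s (hs | rfl | rfl) t hts htne
          · exact hAA' (hAd s hs t hts htne)
          · exact Or.inr (Or.inl (by simpa [htne.ne_empty] using Finset.subset_singleton_iff.1 hts))
          · by_cases hc : t.card = 2
            · exact Or.inr (Or.inr (Finset.eq_of_subset_of_card_le hts
                (by rw [hc, Finset.card_pair hne])))
            · have h2 := Finset.card_le_card hts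
              rw [Finset.card_pair hne] at h2
              have h3 := htne.card_pos
              obtain ⟨z, rfl⟩ := Finset.card_eq_one.1 (show t.card = 1 by omega)
              simp only [Finset.singleton_subset_iff, Finset.mem_insert,
                Finset.mem_singleton] at hts
              rcases hts with rfl | rfl
              · exact Or.inr (Or.inl rfl)
              · exact hAA' hyA
        · intro w w' hw hw'
          obtain ⟨z, hz, hl⟩ := hvert w hw
          obtain ⟨z', hz', hl'⟩ := hvert w' hw'
          exact (hl.trans ((hlA z z' hz hz').mono
            (Set.inter_subset_inter_left _ hAA'))).trans hl'.symm
        · intro w hw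
          obtain ⟨w', hw', hl⟩ := hlS w hw
          exact ⟨w', hAA' hw', hl⟩
      refine h1.trans (.step {x} y (by simp) (by simpa using hne.symm) ?_ ?_ ?_)
      · rw [hins]
        exact Or.inr (Or.inr rfl)
      · rintro s (hs | hs | hs) hxs
        · exact absurd (hAd s hs _ hxs (by simp)) hxA
        · exact Or.inl hs
        · exact Or.inr (by rw [hins]; exact hs)
      · have : A' \ {{x}, insert y {x}} = A := by
          rw [hins, hA']
          ext s
          simp only [Set.mem_sdiff, Set.mem_union, Set.mem_insert_iff, Set.mem_singleton_iff]
          constructor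
          · tauto
          · intro hs
            refine ⟨Or.inl hs, ?_⟩
            rintro (rfl | rfl)
            · exact hxA hs
            · exact hxyA hs
        rw [this]
        exact .refl A

end Collapses

end GraphReconstruction

namespace GraphReconstruction

/-! ### Filtered triangulations of the sphere -/

section Sphere

variable {V : Type*} [DecidableEq V]

/-- The simplices with `k` vertices. -/
def ofCard (L : Set (Finset V)) (k : ℕ) : Set (Finset V) := {s ∈ L | s.card = k}

/-- A filtered complex with the combinatorial properties of a triangulated sphere and a connected
proper subcomplex `Ω` at the beginning of the filtration. -/
structure IsFilteredSphere (L Ω : Set (Finset V)) (r : Finset V → ℕ) : Prop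
    extends IsFilteredComplex L r where
  card_le : ∀ s ∈ L, s.card ≤ 3
  two : ∀ e ∈ L, e.card = 2 → {t ∈ ofCard L 3 | e ⊆ t}.ncard = 2
  bounds : ∀ z ⊆ ofCard L 2, boundary z = ∅ → ∃ X ⊆ ofCard L 3, boundary X = z
  dual : ∀ X ⊆ ofCard L 3, X.Nonempty → boundary X = ∅ → X = ofCard L 3
  linked : ∀ u v, {u} ∈ L → {v} ∈ L → Linked L u v
  sub : Ω ⊆ L
  sub_down : ∀ s ∈ Ω, ∀ t ⊆ s, t.Nonempty → t ∈ Ω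
  initial : ∀ σ ∈ L, ∀ τ ∈ Ω, r σ ≤ r τ → σ ∈ Ω
  sub_linked : ∀ u v, {u} ∈ Ω → {v} ∈ Ω → Linked Ω u v
  sub_nonempty : ∃ v, {v} ∈ Ω
  outside : ∃ t ∈ ofCard L 3, t ∉ Ω

/-- The edges that destroy a component. -/
def negativeEdges (L : Set (Finset V)) (r : Finset V → ℕ) : Set (Finset V) :=
  {e ∈ ofCard L 2 | ∃ v : V, IsPersistencePair L r {v} e}

/-- The edges of `Ω` paired with triangles outside. -/
def essentialEdges (L Ω : Set (Finset V)) (r : Finset V → ℕ) : Set (Finset V) :=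
  {e ∈ ofCard L 2 | ∃ t, IsPersistencePair L r e t ∧ e ∈ Ω ∧ t ∉ Ω}

/-- The triangles that are not paired, or are outside `Ω` and paired with an edge of `Ω`. -/
def essentialTriangles (L Ω : Set (Finset V)) (r : Finset V → ℕ) : Set (Finset V) :=
  {t ∈ ofCard L 3 | ∀ e, IsPersistencePair L r e t → e ∈ Ω ∧ t ∉ Ω}

/-- The other edges that are paired with triangles. -/
def matchedEdges (L Ω : Set (Finset V)) (r : Finset V → ℕ) : Set (Finset V) :=
  {e ∈ ofCard L 2 | ∃ t, IsPersistencePair L r e t ∧ ¬ (e ∈ Ω ∧ t ∉ Ω)}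

-- The pairing is a bijection from its first members to its second members, also when restricted to
-- the pairs with property `C`. This provides the equal numbers needed for collapsing and for
-- counting the regions.
omit [DecidableEq V] in
theorem IsFilteredComplex.ncard_pairs {L : Set (Finset V)} {r : Finset V → ℕ}
    (hL : IsFilteredComplex L r) (C : Finset V → Finset V → Prop) (k : ℕ) :
    {e ∈ ofCard L k | ∃ t, IsPersistencePair L r e t ∧ C e t}.ncard =
      {t ∈ ofCard L (k + 1) | ∃ e, IsPersistencePair L r e t ∧ C e t}.ncard := by
  have hex : ∀ e (he : e ∈ {e ∈ ofCard L k | ∃ t, IsPersistencePair L r e t ∧ C e t}),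
      ∃ t, IsPersistencePair L r e t ∧ C e t := fun e he => he.2
  choose f hf using hex
  refine Set.ncard_congr f ?_ ?_ ?_
  · exact fun e he => ⟨⟨(hf e he).1.2.1, by rw [(hf e he).1.2.2.1, he.1.2]⟩, e, hf e he⟩
  · exact fun e e' he he' h => hL.pair_left_unique (hf e he).1 (h ▸ (hf e' he').1)
  · rintro t ⟨ht, e, hp, hC⟩
    have he : e ∈ {e ∈ ofCard L k | ∃ t, IsPersistencePair L r e t ∧ C e t} :=
      ⟨⟨hp.1, by have := hp.2.2.1; have := ht.2; omega⟩, t, hp, hC⟩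
    exact ⟨e, he, hL.pair_right_unique (hf e he).1 hp⟩

namespace IsFilteredSphere

variable {L Ω : Set (Finset V)} {r : Finset V → ℕ}

theorem finite_ofCard (h : IsFilteredSphere L Ω r) (k : ℕ) : (ofCard L k).Finite :=
  h.finite.subset (Set.sep_subset _ _)

/-- The last edge of a cycle cannot be paired with a vertex, because `exists_le_boundary` would then
give the cycle a boundary. -/
theorem negative_acyclic (h : IsFilteredSphere L Ω r) {X : Set (Finset V)}
    (hX : X ⊆ negativeEdges L r) (hb : boundary X = ∅) : X = ∅ := by
  by_contra hne
  have hXL : X ⊆ L := fun x hx => (hX hx).1.1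
  obtain ⟨e, he, hmax⟩ := h.exists_max hXL (Set.nonempty_iff_ne_empty.2 hne)
  obtain ⟨v, hv⟩ := (hX he).2
  obtain ⟨s, hs, -⟩ := h.exists_le_boundary hv (c := X) (fun x hx =>
    ⟨hXL hx, by rw [(hX hx).1.2]; rfl, hmax x hx⟩) he
  rw [hb] at hs
  exact hs

/-- An edge that destroys nothing is the last edge of a cycle. On the sphere this cycle bounds, so
the class it creates dies. -/
theorem negative_or_paired (h : IsFilteredSphere L Ω r) {e : Finset V} (he : e ∈ ofCard L 2) :
    e ∈ negativeEdges L r ∨ ∃ t, IsPersistencePair L r e t := by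
  by_cases hn : ∃ σ, IsPersistencePair L r σ e
  · obtain ⟨σ, hσ⟩ := hn
    obtain ⟨v, rfl⟩ := Finset.card_eq_one.1
      (show σ.card = 1 by have := hσ.2.2.1; have := he.2; omega)
    exact Or.inl ⟨he, v, hσ⟩
  · push Not at hn
    obtain ⟨c, hc, hec, hb⟩ := h.exists_cycle_of_not_second he.1 hn
    rw [he.2] at hc
    obtain ⟨X, hX, hXb⟩ := h.bounds c (fun x hx => ⟨(hc hx).1, (hc hx).2.1⟩) hb
    have heX : e ∈ boundary X := hXb ▸ hec
    obtain ⟨t, ht, -, -⟩ := exists_mem_of_mem_boundary heX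
    obtain ⟨m, -, hmx⟩ := h.exists_max (fun x hx => (hX hx).1) ⟨t, ht⟩
    obtain ⟨τ, hτ, -⟩ := h.pair_of_chain (τ := m) (fun x hx =>
      ⟨(hX hx).1, by rw [(hX hx).2, he.2], hmx x hx⟩) heX (by
        rw [hXb]
        exact fun s hs => (hc hs).2.2)
    exact Or.inr ⟨τ, hτ⟩

theorem not_negative_of_paired (h : IsFilteredSphere L Ω r) {e t : Finset V}
    (ht : IsPersistencePair L r e t) : e ∉ negativeEdges L r := by
  rintro ⟨-, v, hv⟩
  exact h.not_first_of_second hv ht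

theorem edge_cases (h : IsFilteredSphere L Ω r) {e : Finset V} (he : e ∈ ofCard L 2) :
    e ∈ negativeEdges L r ∨ e ∈ essentialEdges L Ω r ∨ e ∈ matchedEdges L Ω r := by
  rcases h.negative_or_paired he with h1 | ⟨t, ht⟩
  · exact Or.inl h1
  · by_cases hc : e ∈ Ω ∧ t ∉ Ω
    · exact Or.inr (Or.inl ⟨he, t, ht, hc⟩)
    · exact Or.inr (Or.inr ⟨he, t, ht, hc⟩)

theorem not_matched_of_negative (h : IsFilteredSphere L Ω r) {e : Finset V}
    (he : e ∈ negativeEdges L r) : e ∉ matchedEdges L Ω r :=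
  fun ⟨_, _, ht, _⟩ => h.not_negative_of_paired ht he

theorem not_matched_of_essential (h : IsFilteredSphere L Ω r) {e : Finset V}
    (he : e ∈ essentialEdges L Ω r) : e ∉ matchedEdges L Ω r := by
  rintro ⟨-, t, ht, hn⟩
  obtain ⟨-, t', ht', hc⟩ := he
  exact hn (h.pair_right_unique ht ht' ▸ hc)

/-- The two triangles at an edge. -/
theorem exists_two_sides (h : IsFilteredSphere L Ω r) {e : Finset V} (he : e ∈ ofCard L 2) :
    ∃ t ∈ ofCard L 3, ∃ t' ∈ ofCard L 3, t ≠ t' ∧ e ⊆ t ∧ e ⊆ t' ∧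
      (∀ s ∈ ofCard L 3, e ⊆ s → s = t ∨ s = t') ∧
      ∀ X ⊆ ofCard L 3, e ∈ boundary X ↔ ¬ (t ∈ X ↔ t' ∈ X) := by
  obtain ⟨t, t', hne, htt⟩ := Set.ncard_eq_two.1 (h.two e he.1 he.2)
  have ht : t ∈ {t ∈ ofCard L 3 | e ⊆ t} := by rw [htt]; simp
  have ht' : t' ∈ {t ∈ ofCard L 3 | e ⊆ t} := by rw [htt]; simp
  refine ⟨t, ht.1, t', ht'.1, hne, ht.2, ht'.2, fun s hs hes => ?_, fun X hX => ?_⟩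
  · have : s ∈ {t ∈ ofCard L 3 | e ⊆ t} := ⟨hs, hes⟩
    rw [htt] at this
    exact this
  · have hset : {τ ∈ X | e ⊆ τ ∧ τ.card = e.card + 1} = X ∩ {t, t'} := by
      rw [← htt]
      ext s
      simp only [Set.mem_ofPred_eq, Set.mem_inter_iff]
      constructor
      · exact fun hs => ⟨hs.1, hX hs.1, hs.2.1⟩
      · exact fun hs => ⟨hs.1, hs.2.2, by rw [(hX hs.1).2, he.2]⟩
    have hne' : e.Nonempty := h.nonempty e he.1
    simp only [boundary, Set.mem_ofPred_eq, hset, hne', true_and]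
    by_cases h1 : t ∈ X <;> by_cases h2 : t' ∈ X
    · have : X ∩ {t, t'} = {t, t'} := by
        rw [Set.inter_eq_right]
        rintro s (rfl | rfl) <;> assumption
      simp [this, h1, h2, Set.ncard_pair hne]
    · have : X ∩ {t, t'} = {t} := by
        ext s
        simp only [Set.mem_inter_iff, Set.mem_insert_iff, Set.mem_singleton_iff]
        grind
      simp [this, h1, h2]
    · have : X ∩ {t, t'} = {t'} := by
        ext s
        simp only [Set.mem_inter_iff, Set.mem_insert_iff, Set.mem_singleton_iff]
        grind
      simp [this, h1, h2]
    · have : X ∩ {t, t'} = ∅ := by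
        ext s
        simp only [Set.mem_inter_iff, Set.mem_insert_iff, Set.mem_singleton_iff,
          Set.mem_empty_iff_false]
        grind
      simp [this, h1, h2]

theorem mem_ofCard_of_mem_boundary (h : IsFilteredSphere L Ω r) {X : Set (Finset V)} {k : ℕ}
    (hX : X ⊆ ofCard L (k + 1)) {e : Finset V} (he : e ∈ boundary X) : e ∈ ofCard L k :=
  ⟨h.mem_of_mem_boundary (fun _ hx => (hX hx).1) he,
    IsFilteredComplex.card_of_mem_boundary (fun _ hx => (hX hx).2) he⟩

theorem boundary_all (h : IsFilteredSphere L Ω r) : boundary (ofCard L 3) = ∅ := by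
  refine Set.eq_empty_iff_forall_notMem.2 fun e he => ?_
  obtain ⟨t, ht, t', ht', -, -, -, -, hb⟩ :=
    h.exists_two_sides (h.mem_ofCard_of_mem_boundary subset_rfl he)
  exact (hb _ subset_rfl).1 he (iff_of_true ht ht')

/-- The last triangle. -/
theorem exists_last (h : IsFilteredSphere L Ω r) : ∃ t₀ ∈ ofCard L 3, t₀ ∉ Ω ∧
    (∀ t ∈ ofCard L 3, r t ≤ r t₀) ∧ (∀ e, ¬ IsPersistencePair L r e t₀) ∧
    ∀ t ∈ ofCard L 3, t ≠ t₀ → ∃ e, IsPersistencePair L r e t := by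
  obtain ⟨t₁, ht₁, ht₁Ω⟩ := h.outside
  obtain ⟨t₀, ht₀, hmax⟩ := h.exists_max (c := ofCard L 3) (fun _ hx => hx.1) ⟨t₁, ht₁⟩
  refine ⟨t₀, ht₀, fun hΩ => ht₁Ω (h.initial t₁ ht₁.1 t₀ hΩ (hmax t₁ ht₁)), hmax, ?_, ?_⟩
  -- The sum of all triangles is a cycle that ends in `t₀`, so `t₀` kills nothing.
  · intro e he
    obtain ⟨s, hs, -⟩ := h.exists_le_boundary he (c := ofCard L 3) (fun x hx =>
      ⟨hx.1, by rw [hx.2, ← he.2.2.1, ht₀.2], hmax x hx⟩) ht₀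
    rw [h.boundary_all] at hs
    exact hs
  -- A triangle without partner ends a cycle; by `dual` this cycle contains all triangles, so the
  -- triangle is the last one.
  · intro t ht hne
    by_contra! hno
    obtain ⟨c, hc, htc, hb⟩ := h.exists_cycle_of_not_second ht.1 hno
    rw [ht.2] at hc
    have := h.dual c (fun x hx => ⟨(hc hx).1, (hc hx).2.1⟩) ⟨t, htc⟩ hb
    have h1 := (hc (this ▸ ht₀)).2.2
    exact hne (h.injOn ht.1 ht₀.1 (le_antisymm (hmax t ht) h1))

/-- A set of triangles without essential ones has a matched edge in its boundary. -/
theorem exists_matched_boundary (h : IsFilteredSphere L Ω r) {X : Set (Finset V)}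
    (hX : X ⊆ ofCard L 3) (hne : X.Nonempty) (hT : ∀ t ∈ X, t ∉ essentialTriangles L Ω r) :
    ∃ e ∈ boundary X, e ∈ matchedEdges L Ω r ∧ (¬ X ⊆ Ω → e ∉ Ω) := by
  have hXL : X ⊆ L := fun x hx => (hX hx).1
  obtain ⟨t, ht, htmax⟩ := h.exists_max hXL hne
  have hpair : ∃ e, IsPersistencePair L r e t ∧ ¬ (e ∈ Ω ∧ t ∉ Ω) := by
    by_contra! hno
    refine hT t ht ⟨hX ht, fun e he => ?_⟩
    by_contra hc
    exact (hno e he).2 (by_contra fun htΩ => hc ⟨(hno e he).1, htΩ⟩)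
  obtain ⟨e, hpair, hΩ⟩ := hpair
  have he2 : e.card = 2 := by have := hpair.2.2.1; have := (hX ht).2; omega
  obtain ⟨s, hs, hes⟩ := h.exists_le_boundary hpair (c := X) (fun x hx =>
    ⟨hXL hx, by rw [(hX hx).2, he2], htmax x hx⟩) ht
  have hbL : boundary X ⊆ L := fun x hx => h.mem_of_mem_boundary hXL hx
  obtain ⟨m, hm, hmax⟩ := h.exists_max hbL ⟨s, hs⟩
  have hm2 := h.mem_ofCard_of_mem_boundary hX hm
  refine ⟨m, hm, ?_, ?_⟩
  -- The edge `m` is the last one of the cycle `∂X`, so it is not negative. If it were essential,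
  -- `X` would show that its partner comes no later than `t`; then `t` and with it `e` would be
  -- outside `Ω`, although `e` comes no later than `m`.
  · rcases h.edge_cases hm2 with ⟨-, v, hv⟩ | ⟨-, t', hp, hmΩ, ht'Ω⟩ | h3
    · obtain ⟨x, hx, -⟩ := h.exists_le_boundary hv (c := boundary X) (fun x hx =>
        ⟨hbL hx, by rw [(h.mem_ofCard_of_mem_boundary hX hx).2]; rfl, hmax x hx⟩) hm
      rw [boundary_boundary (h.finite.subset hXL)] at hx
      exact absurd hx (Set.notMem_empty x)
    · exfalso
      obtain ⟨τ, hτ, hle⟩ := h.pair_of_chain (τ := t) (σ := m) (c := X) (fun x hx =>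
        ⟨hXL hx, by rw [(hX hx).2, hm2.2], htmax x hx⟩) hm hmax
      rw [h.pair_right_unique hτ hp] at hle
      have htΩ : t ∉ Ω := fun htΩ => ht'Ω (h.initial t' hp.2.1 t htΩ hle)
      have heΩ : e ∉ Ω := fun he => hΩ ⟨he, htΩ⟩
      exact heΩ (h.initial e hpair.1 m hmΩ (hes.trans (hmax s hs)))
    · exact h3
  -- If `X` leaves `Ω`, so does its last triangle `t`, hence also its partner `e`, hence also `m`,
  -- which does not come before `e`.
  · intro hXΩ hmΩ
    obtain ⟨x, hx, hxΩ⟩ := Set.not_subset.1 hXΩ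
    have htΩ : t ∉ Ω := fun htΩ => hxΩ (h.initial x (hXL hx) t htΩ (htmax x hx))
    have heΩ : e ∉ Ω := fun he => hΩ ⟨he, htΩ⟩
    exact heΩ (h.initial e hpair.1 m hmΩ (hes.trans (hmax s hs)))

/-! #### Connectivity of the forest -/

/-- The first edge across a cut is negative. -/
theorem exists_negative_crossing (h : IsFilteredSphere L Ω r) {Z : Set V} {x y : V} (hx : x ∈ Z)
    (hy : y ∉ Z) (hxy : ({x, y} : Finset V) ∈ L) :
    ∃ x' ∈ Z, ∃ y' ∉ Z, ({x', y'} : Finset V) ∈ negativeEdges L r ∧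
      r {x', y'} ≤ r {x, y} := by
  set C : Set (Finset V) := {e ∈ L | ∃ x ∈ Z, ∃ y ∉ Z, e = {x, y}}
  have hfin : C.Finite := h.finite.subset (Set.sep_subset _ _)
  obtain ⟨e, ⟨he, x', hx', y', hy', rfl⟩, hmin⟩ :=
    hfin.exists_minimalFor r _ ⟨{x, y}, hxy, x, hx, y, hy, rfl⟩
  have hmin' : ∀ s ∈ C, r {x', y'} ≤ r s := fun s hs => by
    by_contra hlt
    exact hlt (hmin hs (by omega))
  have hne : x' ≠ y' := fun h => hy' (h ▸ hx')
  have he2 : ({x', y'} : Finset V) ∈ ofCard L 2 := ⟨he, Finset.card_pair hne⟩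
  refine ⟨x', hx', y', hy', ?_, hmin' _ ⟨hxy, x, hx, y, hy, rfl⟩⟩
  refine ⟨he2, ?_⟩
  by_contra! hno
  -- Otherwise the edge would close a cycle of edges that come no later. This cycle crosses the cut
  -- a second time, which contradicts the choice of the first crossing edge.
  obtain ⟨c, hc, hec, hb⟩ := h.exists_cycle_of_not_second he (fun σ hσ => by
    obtain ⟨v, rfl⟩ := Finset.card_eq_one.1
      (show σ.card = 1 by have := hσ.2.2.1; have := he2.2; omega)
    exact hno v hσ)
  rw [he2.2] at hc
  obtain ⟨a, ha, b, hb', hab, hne'⟩ := exists_other_crossing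
    ((h.finite_upTo _ _).subset hc) (fun e he => (hc he).2.1) hb hx' hy' hec
  exact hne' (h.injOn (hc hab).1 he
    (le_antisymm (hc hab).2.2 (hmin' _ ⟨(hc hab).1, a, ha, b, hb', rfl⟩)))

/-- The negative crossing edge found comes no later than a crossing edge of `Ω`, so it is in `Ω`,
which is initial. -/
theorem negative_linked_sub (h : IsFilteredSphere L Ω r) {u v : V} (hu : {u} ∈ Ω)
    (hv : {v} ∈ Ω) : Linked (Ω ∩ negativeEdges L r) u v := by
  by_contra hno
  obtain ⟨x, hx, y, hy, hxy⟩ := (h.sub_linked u v hu hv).exists_crossing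
    (Z := {w | Linked (Ω ∩ negativeEdges L r) u w}) Linked.refl hno
  obtain ⟨x', hx', y', hy', hneg, hle⟩ := h.exists_negative_crossing hx hy (h.sub hxy)
  exact hy' (Linked.trans hx' (Linked.single (fun heq => hy' (heq ▸ hx'))
    ⟨h.initial _ hneg.1.1 _ hxy hle, hneg⟩))

theorem negative_linked (h : IsFilteredSphere L Ω r) {u v : V} (hu : {u} ∈ L)
    (hv : {v} ∈ L) : Linked (negativeEdges L r) u v := by
  by_contra hno
  obtain ⟨x, hx, y, hy, hxy⟩ := (h.linked u v hu hv).exists_crossing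
    (Z := {w | Linked (negativeEdges L r) u w}) Linked.refl hno
  obtain ⟨x', hx', y', hy', hneg, hle⟩ := h.exists_negative_crossing hx hy hxy
  exact hy' (Linked.trans hx' (Linked.single (fun heq => hy' (heq ▸ hx')) hneg))

/-! #### Collapses -/

theorem card_cases (h : IsFilteredSphere L Ω r) {s : Finset V} (hs : s ∈ L) :
    s.card = 1 ∨ s ∈ ofCard L 2 ∨ s ∈ ofCard L 3 := by
  have h1 := h.card_le s hs
  have h2 := (h.nonempty s hs).card_pos
  by_cases h3 : s.card = 1
  · exact Or.inl h3
  · by_cases h4 : s.card = 2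
    · exact Or.inr (Or.inl ⟨hs, h4⟩)
    · exact Or.inr (Or.inr ⟨hs, by omega⟩)

theorem triangles_at_edge_le (h : IsFilteredSphere L Ω r) {Q : Set (Finset V)}
    (hQ : Q ⊆ ofCard L 3) {e : Finset V} (he : e ∈ ofCard L 2) :
    {t ∈ Q | e ⊆ t}.ncard ≤ 2 := by
  rw [← h.two e he.1 he.2]
  exact Set.ncard_le_ncard (fun t ht => ⟨hQ ht.1, ht.2⟩)
    ((h.finite_ofCard 3).subset (Set.sep_subset _ _))

theorem not_essential_iff (_ : IsFilteredSphere L Ω r) {t : Finset V} (ht : t ∈ ofCard L 3) :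
    t ∉ essentialTriangles L Ω r ↔ ∃ e, IsPersistencePair L r e t ∧ ¬ (e ∈ Ω ∧ t ∉ Ω) := by
  simp only [essentialTriangles, Set.mem_ofPred_eq, ht, true_and, not_forall, exists_prop]

/-- Removing the essential triangles, the sphere collapses to `Ω`. -/
theorem collapses_outside (h : IsFilteredSphere L Ω r) :
    Collapses (L \ essentialTriangles L Ω r) Ω := by
  set N := negativeEdges L r
  -- The collapse passes through `B`, which keeps `Ω`, all vertices and all tree edges. The edges
  -- `P` and triangles `Q` removed before are the members of the pairs whose edge is outside `Ω`.
  set B : Set (Finset V) := {s ∈ L | s ∈ Ω ∨ s.card = 1 ∨ s ∈ N} with hB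
  set P : Set (Finset V) := {e ∈ ofCard L 2 | ∃ t, IsPersistencePair L r e t ∧ e ∉ Ω} with hP
  set Q : Set (Finset V) := {t ∈ ofCard L 3 | ∃ e, IsPersistencePair L r e t ∧ e ∉ Ω} with hQ
  have hout : ∀ {σ τ}, IsPersistencePair L r σ τ → σ ∉ Ω → τ ∉ Ω := fun hp hσ hτ =>
    hσ (h.initial _ hp.1 _ hτ (h.pair_lt hp).le)
  have hin : ∀ t ∈ ofCard L 3, t ∉ essentialTriangles L Ω r → t ∉ Q → t ∈ Ω := by
    intro t ht hte htQ
    obtain ⟨e, he, hn⟩ := (h.not_essential_iff ht).1 hte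
    by_contra htΩ
    exact htQ ⟨ht, e, he, fun heΩ => hn ⟨heΩ, htΩ⟩⟩
  have heq : L \ essentialTriangles L Ω r = B ∪ P ∪ Q := by
    ext s
    constructor
    · rintro ⟨hs, hse⟩
      rcases h.card_cases hs with h1 | h1 | h1
      · exact Or.inl (Or.inl ⟨hs, Or.inr (Or.inl h1)⟩)
      · by_cases hsΩ : s ∈ Ω
        · exact Or.inl (Or.inl ⟨hs, Or.inl hsΩ⟩)
        · rcases h.negative_or_paired h1 with h2 | ⟨t, ht⟩
          · exact Or.inl (Or.inl ⟨hs, Or.inr (Or.inr h2)⟩)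
          · exact Or.inl (Or.inr ⟨h1, t, ht, hsΩ⟩)
      · by_cases hsQ : s ∈ Q
        · exact Or.inr hsQ
        · exact Or.inl (Or.inl ⟨hs, Or.inl (hin s h1 hse hsQ)⟩)
    · rintro ((hs | hs) | hs)
      · refine ⟨hs.1, fun hse => ?_⟩
        rcases hs.2 with h1 | h1 | h1
        · obtain ⟨t₀, ht₀, ht₀Ω, -, -, hp⟩ := h.exists_last
          obtain ⟨e, he⟩ := hp s hse.1 (fun heq => ht₀Ω (heq ▸ h1))
          exact (hse.2 e he).2 h1
        · have := hse.1.2; omega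
        · have := hse.1.2; have := h1.1.2; omega
      · exact ⟨hs.1.1, fun hse => by have := hse.1.2; have := hs.1.2; omega⟩
      · obtain ⟨hs3, e, he, heΩ⟩ := hs
        exact ⟨hs3.1, fun hse => heΩ (hse.2 e he).1⟩
  have hNl : ∀ e ∈ N, e.card = 2 := fun e he => he.1.2
  have hBL : B ⊆ L := fun s hs => hs.1
  have hΩB : Ω ⊆ B := fun s hs => ⟨h.sub hs, Or.inl hs⟩
  rw [heq]
  refine (collapses_triangles (h.finite.subset fun s hs => hs.1.1)
    (h.finite.subset fun s hs => hs.1.1) (fun e he => he.1.2) (fun t ht => ht.1.2)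
    (h.ncard_pairs (fun e _ => e ∉ Ω) 2) ?_ ?_ (fun e he => h.triangles_at_edge_le
      (fun t ht => ht.1) he.1)).trans ?_
  · intro X hX hne
    obtain ⟨e, heb, hem, heΩ⟩ := h.exists_matched_boundary (fun t ht => (hX ht).1) hne (by
      rintro t ht hte
      obtain ⟨-, e, he, heΩ⟩ := hX ht
      exact heΩ (hte.2 e he).1)
    refine ⟨e, ⟨hem.1, ?_⟩, heb⟩
    obtain ⟨-, t', hp, -⟩ := hem
    obtain ⟨x, hx⟩ := hne
    obtain ⟨-, e', he', he'Ω⟩ := hX hx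
    exact ⟨t', hp, heΩ fun hXΩ => hout he' he'Ω (hXΩ hx)⟩
  · rintro s ⟨-, hs | hs | hs⟩ e ⟨he2, t, ht, heΩ⟩ hes
    · exact heΩ (h.sub_down s hs e hes (h.nonempty e he2.1))
    · have := Finset.card_le_card hes
      have := he2.2
      omega
    · have := Finset.eq_of_subset_of_card_le hes (by rw [hs.1.2, he2.2])
      exact h.not_negative_of_paired ht (this ▸ hs)
  · refine collapses_forest (N := N) (h.finite.subset hBL) ?_ hΩB h.sub_down ?_ hNl
      (fun X hX _ hb => h.negative_acyclic hX hb) (fun u v hu hv => h.negative_linked_sub hu hv) ?_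
    · rintro s ⟨hsL, hs⟩ t hts htne
      refine ⟨h.down_closed s hsL t hts htne, ?_⟩
      rcases hs with hs | hs | hs
      · exact Or.inl (h.sub_down s hs t hts htne)
      · have := Finset.card_le_card hts
        have := htne.card_pos
        exact Or.inr (Or.inl (by omega))
      · by_cases hc : t.card = 1
        · exact Or.inr (Or.inl hc)
        · have := Finset.card_le_card hts
          have := htne.card_pos
          have hs2 := hs.1.2
          exact Or.inr (Or.inr (Finset.eq_of_subset_of_card_le hts (by omega) ▸ hs))
    · rintro s ⟨-, hs⟩ hsΩ
      exact hs.resolve_left hsΩ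
    · intro u hu
      obtain ⟨v, hv⟩ := h.sub_nonempty
      exact ⟨v, hv, Linked.mono (E' := B ∩ N) (fun e he => ⟨⟨he.1.1, Or.inr (Or.inr he)⟩, he⟩)
        (h.negative_linked (hBL hu) (h.sub hv))⟩

/-- `Ω` collapses to a subgraph that contains the essential edges and otherwise is a tree. -/
theorem collapses_inside (h : IsFilteredSphere L Ω r) {A : Set (Finset V)} (hA : A ⊆ Ω)
    (hAd : ∀ s ∈ A, ∀ t ⊆ s, t.Nonempty → t ∈ A) (hEA : essentialEdges L Ω r ⊆ A)
    (hA1 : ∀ s ∈ A, s.card = 1 ∨ s ∈ negativeEdges L r ∨ s ∈ essentialEdges L Ω r)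
    (hAne : ∃ v, {v} ∈ A)
    (hlA : ∀ u v, {u} ∈ A → {v} ∈ A → Linked (A ∩ negativeEdges L r) u v) :
    Collapses Ω A := by
  set N := negativeEdges L r
  set C := essentialEdges L Ω r
  -- The pairs within `Ω`, with edges `P` and triangles `Q`, are removed first. What is left is the
  -- graph `B`, which is then pruned to `A`.
  set B : Set (Finset V) := {s ∈ Ω | s.card = 1 ∨ s ∈ N ∨ s ∈ C} with hB
  set P : Set (Finset V) := {e ∈ ofCard L 2 | ∃ t, IsPersistencePair L r e t ∧ t ∈ Ω} with hP
  set Q : Set (Finset V) := {t ∈ ofCard L 3 | ∃ e, IsPersistencePair L r e t ∧ t ∈ Ω} with hQ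
  have hPΩ : P ⊆ Ω := by
    rintro e ⟨he, t, hp, ht⟩
    exact h.initial e hp.1 t ht (h.pair_lt hp).le
  have heq : Ω = B ∪ P ∪ Q := by
    ext s
    constructor
    · intro hs
      rcases h.card_cases (h.sub hs) with h1 | h1 | h1
      · exact Or.inl (Or.inl ⟨hs, Or.inl h1⟩)
      · rcases h.edge_cases h1 with h2 | h2 | ⟨-, t, hp, hn⟩
        · exact Or.inl (Or.inl ⟨hs, Or.inr (Or.inl h2)⟩)
        · exact Or.inl (Or.inl ⟨hs, Or.inr (Or.inr h2)⟩)
        · exact Or.inl (Or.inr ⟨h1, t, hp, by_contra fun ht => hn ⟨hs, ht⟩⟩)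
      · obtain ⟨t₀, ht₀, ht₀Ω, -, -, hp⟩ := h.exists_last
        obtain ⟨e, he⟩ := hp s h1 (fun heq => ht₀Ω (heq ▸ hs))
        exact Or.inr ⟨h1, e, he, hs⟩
    · rintro ((hs | hs) | ⟨-, e, he, hs⟩)
      · exact hs.1
      · exact hPΩ hs
      · exact hs
  have hcard : ∀ s ∈ B, s.card ≤ 2 := by
    rintro s ⟨-, h1 | h1 | h1⟩
    · omega
    · exact h1.1.2.le
    · exact h1.1.2.le
  have hAB : A ⊆ B := fun s hs => ⟨hA hs, hA1 s hs⟩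
  rw [heq]
  refine (collapses_triangles (h.finite.subset fun s hs => hs.1.1)
    (h.finite.subset fun s hs => hs.1.1) (fun e he => he.1.2) (fun t ht => ht.1.2)
    (h.ncard_pairs (fun _ t => t ∈ Ω) 2) ?_ ?_ (fun e he => h.triangles_at_edge_le
      (fun t ht => ht.1) he.1)).trans ?_
  · intro X hX hne
    obtain ⟨e, heb, hem, -⟩ := h.exists_matched_boundary (fun t ht => (hX ht).1) hne (by
      rintro t ht hte
      obtain ⟨-, e, he, htΩ⟩ := hX ht
      exact (hte.2 e he).2 htΩ)
    obtain ⟨t, ht, het, -⟩ := exists_mem_of_mem_boundary heb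
    obtain ⟨-, -, -, htΩ⟩ := hX ht
    have heΩ := h.sub_down t htΩ e het (h.nonempty e hem.1.1)
    obtain ⟨he2, t', hp, hn⟩ := hem
    exact ⟨e, ⟨he2, t', hp, by_contra fun ht' => hn ⟨heΩ, ht'⟩⟩, heb⟩
  · rintro s hs e ⟨he2, t, ht, htΩ⟩ hes
    have := Finset.eq_of_subset_of_card_le hes (by rw [he2.2]; exact hcard s hs)
    subst this
    rcases hs.2 with h1 | h1 | h1
    · have := he2.2; omega
    · exact h.not_negative_of_paired ht h1
    · exact h.not_matched_of_essential h1 ⟨he2, t, ht, fun hc => hc.2 htΩ⟩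
  · refine collapses_forest (N := N) (h.finite.subset fun s hs => h.sub hs.1) ?_ hAB hAd ?_
      (fun e he => he.1.2) (fun X hX _ hb => h.negative_acyclic hX hb) hlA ?_
    · intro s hs t hts htne
      refine ⟨h.sub_down s hs.1 t hts htne, ?_⟩
      by_cases hc : t.card = 1
      · exact Or.inl hc
      · have h1 := hcard s hs
        have := htne.card_pos
        have := Finset.eq_of_subset_of_card_le hts (by omega)
        exact this ▸ hs.2
    · rintro s ⟨-, hs | hs | hs⟩ hsA
      · exact Or.inl hs
      · exact Or.inr hs
      · exact absurd (hEA hs) hsA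
    · intro u hu
      obtain ⟨v, hv⟩ := hAne
      exact ⟨v, hv, Linked.mono (E' := B ∩ N) (fun e he => ⟨⟨he.1, Or.inr (Or.inl he.2)⟩, he.2⟩)
        (h.negative_linked_sub hu.1 (hA hv))⟩

end IsFilteredSphere

end Sphere

end GraphReconstruction

namespace GraphReconstruction

/-! ### The faces of the output graph on the sphere. -/

section Regions

variable {V : Type*} [DecidableEq V] {L Ω : Set (Finset V)} {r : Finset V → ℕ}

/-- The sets of triangles that are unions of faces of the graph `Γ` on the sphere. -/
def IsFaceUnion (L Γ X : Set (Finset V)) : Prop :=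
  X ⊆ ofCard L 3 ∧ ∀ e ∈ ofCard L 2, e ∉ Γ → ∀ t ∈ ofCard L 3, ∀ t' ∈ ofCard L 3,
    e ⊆ t → e ⊆ t' → t ∈ X → t' ∈ X

namespace IsFilteredSphere

/-- An edge outside the boundary of `X` has both of its triangles in `X` or none. -/
theorem isFaceUnion_of_boundary (h : IsFilteredSphere L Ω r) {Γ X : Set (Finset V)}
    (hX : X ⊆ ofCard L 3) (hb : boundary X ⊆ Γ) : IsFaceUnion L Γ X := by
  refine ⟨hX, fun e he heΓ t ht t' ht' het het' htX => ?_⟩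
  obtain ⟨a, -, b, -, -, -, -, hall, hmem⟩ := h.exists_two_sides he
  have : e ∉ boundary X := fun h' => heΓ (hb h')
  rw [hmem X hX, not_not] at this
  rcases hall t ht het with rfl | rfl <;> rcases hall t' ht' het' with rfl | rfl <;> tauto

theorem boundary_subset_of_isFaceUnion (h : IsFilteredSphere L Ω r) {Γ X : Set (Finset V)}
    (hX : IsFaceUnion L Γ X) : boundary X ⊆ Γ := by
  intro e he
  by_contra heΓ
  have he2 := h.mem_ofCard_of_mem_boundary hX.1 he
  obtain ⟨a, ha, b, hb, -, hea, heb, -, hmem⟩ := h.exists_two_sides he2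
  exact (hmem X hX.1).1 he ⟨hX.2 e he2 heΓ a ha b hb hea heb, hX.2 e he2 heΓ b hb a ha heb hea⟩

omit [DecidableEq V] in
theorem _root_.GraphReconstruction.IsFaceUnion.inter {Γ X Y : Set (Finset V)}
    (hX : IsFaceUnion L Γ X) (hY : IsFaceUnion L Γ Y) : IsFaceUnion L Γ (X ∩ Y) :=
  ⟨fun _ ht => hX.1 ht.1, fun e he hΓ t ht t' ht' h1 h2 hm =>
    ⟨hX.2 e he hΓ t ht t' ht' h1 h2 hm.1, hY.2 e he hΓ t ht t' ht' h1 h2 hm.2⟩⟩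

omit [DecidableEq V] in
theorem _root_.GraphReconstruction.IsFaceUnion.sdiff {Γ X Y : Set (Finset V)}
    (hX : IsFaceUnion L Γ X) (hY : IsFaceUnion L Γ Y) : IsFaceUnion L Γ (X \ Y) :=
  ⟨fun _ ht => hX.1 ht.1, fun e he hΓ t ht t' ht' h1 h2 hm =>
    ⟨hX.2 e he hΓ t ht t' ht' h1 h2 hm.1,
      fun h' => hm.2 (hY.2 e he hΓ t' ht' t ht h2 h1 h')⟩⟩

omit [DecidableEq V] in
theorem _root_.GraphReconstruction.IsFaceUnion.biUnion {ι : Type*} {Γ : Set (Finset V)}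
    {S : Set ι} {X : ι → Set (Finset V)} (hX : ∀ i ∈ S, IsFaceUnion L Γ (X i)) :
    IsFaceUnion L Γ (⋃ i ∈ S, X i) := by
  refine ⟨Set.iUnion₂_subset fun i hi => (hX i hi).1, fun e he hΓ t ht t' ht' h1 h2 hm => ?_⟩
  obtain ⟨i, hi, hti⟩ := Set.mem_iUnion₂.1 hm
  exact Set.mem_iUnion₂.2 ⟨i, hi, (hX i hi).2 e he hΓ t ht t' ht' h1 h2 hti⟩

omit [DecidableEq V] in
theorem _root_.GraphReconstruction.isFaceUnion_all {Γ : Set (Finset V)} :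
    IsFaceUnion L Γ (ofCard L 3) :=
  ⟨subset_rfl, fun _ _ _ _ _ _ ht' _ _ _ => ht'⟩

/-- A nonempty union of faces contains an essential triangle. -/
theorem exists_essential_of_isFaceUnion (h : IsFilteredSphere L Ω r) {Γ X : Set (Finset V)}
    (hΓ : ∀ e ∈ Γ, e ∉ matchedEdges L Ω r) (hX : IsFaceUnion L Γ X) (hne : X.Nonempty) :
    ∃ t ∈ X, t ∈ essentialTriangles L Ω r := by
  by_contra! hno
  obtain ⟨e, he, hem, -⟩ := h.exists_matched_boundary hX.1 hne hno
  exact hΓ e (h.boundary_subset_of_isFaceUnion hX he) hem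

/-- Each essential edge closes a cycle with a path of negative edges in `Γ`. Sums of such cycles
have any prescribed trace on the essential edges, because negative edges are not essential. -/
theorem exists_cycle_with_essential (h : IsFilteredSphere L Ω r) {Γ : Set (Finset V)}
    (hΓ2 : Γ ⊆ ofCard L 2) (hEΓ : essentialEdges L Ω r ⊆ Γ)
    (hl : ∀ e ∈ essentialEdges L Ω r, ∀ u ∈ e, ∀ v ∈ e, Linked (Γ ∩ negativeEdges L r) u v)
    {A : Set (Finset V)} (hA : A ⊆ essentialEdges L Ω r) :
    ∃ z ⊆ Γ, boundary z = ∅ ∧ z ∩ essentialEdges L Ω r = A := by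
  have hAf : A.Finite := h.finite.subset fun e he => (hA he).1.1
  induction A, hAf using Set.Finite.induction_on with
  | empty => exact ⟨∅, Set.empty_subset _, boundary_empty, Set.empty_inter _⟩
  | @insert e A he _ ih =>
    obtain ⟨z, hz, hzb, hzA⟩ := ih ((Set.subset_insert _ _).trans hA)
    have heE := hA (Set.mem_insert e A)
    obtain ⟨x, y, hxy, rfl⟩ := Finset.card_eq_two.1 heE.1.2
    obtain ⟨c, hc, hcf, -, hcb⟩ := (hl _ heE x (by simp) y (by simp)).exists_chain
    have hzf : z.Finite := h.finite.subset fun s hs => (hΓ2 (hz hs)).1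
    refine ⟨(c ∆ {{x, y}}) ∆ z, symmDiff_subset (symmDiff_subset (fun s hs => (hc hs).1)
      (by simpa using hEΓ heE)) hz, ?_, ?_⟩
    · rw [boundary_symmDiff (hcf.symmDiff (Set.finite_singleton _)) hzf,
        boundary_symmDiff hcf (Set.finite_singleton _), hcb, hzb, boundary_pair hxy,
        symmDiff_self]
      exact bot_symmDiff _
    · ext s
      have hcE : s ∈ c → s ∉ essentialEdges L Ω r := fun hs ⟨_, t, ht, _⟩ =>
        h.not_negative_of_paired ht (hc hs).2
      have hz' : s ∈ z ∧ s ∈ essentialEdges L Ω r ↔ s ∈ A := by rw [← hzA]; rfl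
      have hxyc : s = {x, y} → s ∈ essentialEdges L Ω r := by rintro rfl; exact heE
      have hxyA : s = {x, y} → s ∉ A := by rintro rfl; exact he
      simp only [Set.mem_inter_iff, Set.mem_symmDiff, Set.mem_singleton_iff, Set.mem_insert_iff]
      tauto

/-- Each essential triangle is the only one in some union of faces. -/
theorem exists_separating (h : IsFilteredSphere L Ω r) {Γ : Set (Finset V)}
    (hΓ2 : Γ ⊆ ofCard L 2) (hΓ : ∀ e ∈ Γ, e ∉ matchedEdges L Ω r)
    (hEΓ : essentialEdges L Ω r ⊆ Γ)
    (hl : ∀ e ∈ essentialEdges L Ω r, ∀ u ∈ e, ∀ v ∈ e, Linked (Γ ∩ negativeEdges L r) u v)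
    {t₀ t : Finset V} (ht₀ : ∀ e, ¬ IsPersistencePair L r e t₀) (ht₀L : t₀ ∈ ofCard L 3)
    (hpair : ∀ t ∈ ofCard L 3, t ≠ t₀ → ∃ e, IsPersistencePair L r e t)
    (ht : t ∈ essentialTriangles L Ω r) (hne : t ≠ t₀) :
    ∃ X, IsFaceUnion L Γ X ∧ X ∩ essentialTriangles L Ω r = {t} := by
  classical
  set E := essentialEdges L Ω r
  set T := essentialTriangles L Ω r
  have hEf : E.Finite := h.finite.subset fun e he => he.1.1
  have hTf : (T \ {t₀}).Finite := h.finite.subset fun e he => he.1.1.1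
  have hTeq : T \ {t₀} =
      {t ∈ ofCard L 3 | ∃ e, IsPersistencePair L r e t ∧ e ∈ Ω ∧ t ∉ Ω} := by
    ext s
    constructor
    · rintro ⟨hs, hs0⟩
      obtain ⟨e, he⟩ := hpair s hs.1 hs0
      exact ⟨hs.1, e, he, hs.2 e he⟩
    · rintro ⟨hs, e, he, hc⟩
      refine ⟨⟨hs, fun e' he' => h.pair_left_unique he he' ▸ hc⟩, ?_⟩
      rintro rfl
      exact ht₀ e he
  have hcard : hTf.toFinset.card = hEf.toFinset.card := by
    rw [← Set.ncard_eq_toFinset_card _ hTf, ← Set.ncard_eq_toFinset_card _ hEf, hTeq]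
    exact (h.ncard_pairs (fun e t => e ∈ Ω ∧ t ∉ Ω) 2).symm
  -- A cycle with trace `A` on the essential edges bounds two complementary sets of triangles; the
  -- one without `t₀` is taken.
  have hex : ∀ A ∈ hEf.toFinset.powerset, ∃ X, IsFaceUnion L Γ X ∧ t₀ ∉ X ∧
      boundary X ∩ E = (A : Set (Finset V)) := by
    intro A hA
    have hAE : (A : Set (Finset V)) ⊆ E := fun e he => by
      simpa using Finset.mem_powerset.1 hA he
    obtain ⟨z, hz, hzb, hzA⟩ := h.exists_cycle_with_essential hΓ2 hEΓ hl hAE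
    obtain ⟨X, hX, hXb⟩ := h.bounds z (hz.trans hΓ2) hzb
    by_cases h0 : t₀ ∈ X
    · have hXf : X.Finite := h.finite.subset fun s hs => (hX hs).1
      have hb : boundary (ofCard L 3 ∆ X) = z := by
        rw [boundary_symmDiff (h.finite_ofCard 3) hXf, h.boundary_all, hXb]
        exact bot_symmDiff z
      refine ⟨ofCard L 3 ∆ X, h.isFaceUnion_of_boundary (symmDiff_subset subset_rfl hX)
        (hb ▸ hz), ?_, by rw [hb, hzA]⟩
      simp [Set.mem_symmDiff, h0, ht₀L]
    · exact ⟨X, h.isFaceUnion_of_boundary hX (hXb ▸ hz), h0, by rw [hXb, hzA]⟩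
  choose! X hX using hex
  -- Sending `A` to the essential triangles in `X A` is a map between power sets of equal size. It
  -- is injective: if two of the sets contain the same essential triangles, their differences are
  -- face unions without essential triangles, hence empty. Surjectivity then yields `{t}`.
  have hsurj := Finset.surjOn_of_injOn_of_card_le
    (s := hEf.toFinset.powerset) (t := hTf.toFinset.powerset)
    (fun A => {t ∈ hTf.toFinset | t ∈ X A}) (fun A _ => by
      rw [Finset.mem_coe, Finset.mem_powerset]
      exact Finset.filter_subset _ _) (by
      intro A hA B hB hAB
      have hempty : ∀ C ∈ hEf.toFinset.powerset, ∀ D ∈ hEf.toFinset.powerset,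
          ({t ∈ hTf.toFinset | t ∈ X C} = {t ∈ hTf.toFinset | t ∈ X D}) → X C ⊆ X D := by
        intro C hC D hD hCD
        by_contra hsub
        obtain ⟨s, hs, hsT⟩ := h.exists_essential_of_isFaceUnion hΓ
          ((hX C hC).1.sdiff (hX D hD).1) (Set.sdiff_nonempty.2 hsub)
        have hs0 : s ≠ t₀ := fun heq => (hX C hC).2.1 (heq ▸ hs.1)
        have : s ∈ {t ∈ hTf.toFinset | t ∈ X C} := by
          rw [Finset.mem_filter, Set.Finite.mem_toFinset]
          exact ⟨⟨hsT, hs0⟩, hs.1⟩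
        rw [hCD, Finset.mem_filter] at this
        exact hs.2 this.2
      have heq : X A = X B := (hempty A hA B hB hAB).antisymm (hempty B hB A hA hAB.symm)
      have h1 := (hX A hA).2.2
      rw [heq, (hX B hB).2.2] at h1
      exact (Finset.coe_injective h1).symm)
    (by rw [Finset.card_powerset, Finset.card_powerset, hcard])
  obtain ⟨A, hA, hAt⟩ := hsurj (show ({t} : Finset (Finset V)) ∈ _ by
    rw [Finset.mem_coe, Finset.mem_powerset, Finset.singleton_subset_iff,
      Set.Finite.mem_toFinset]
    exact ⟨ht, hne⟩)
  refine ⟨X A, (hX A hA).1, ?_⟩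
  ext s
  have hiff : s ∈ {t ∈ hTf.toFinset | t ∈ X A} ↔ s ∈ ({t} : Finset (Finset V)) := by
    rw [← hAt]
  rw [Finset.mem_filter, Set.Finite.mem_toFinset, Finset.mem_singleton] at hiff
  have hs0 : s ∈ X A → s ≠ t₀ := fun hs heq => (hX A hA).2.1 (heq ▸ hs)
  simp only [Set.mem_sdiff, Set.mem_singleton_iff] at hiff
  simp only [Set.mem_inter_iff, Set.mem_singleton_iff]
  tauto

/-- The faces of the graph `Γ`: each contains one essential triangle, and together their
boundaries cover the cycles of `Γ`. -/
theorem exists_regions (h : IsFilteredSphere L Ω r) {Γ : Set (Finset V)}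
    (hΓ2 : Γ ⊆ ofCard L 2) (hΓ : ∀ e ∈ Γ, e ∉ matchedEdges L Ω r)
    (hEΓ : essentialEdges L Ω r ⊆ Γ)
    (hl : ∀ e ∈ essentialEdges L Ω r, ∀ u ∈ e, ∀ v ∈ e,
      Linked (Γ ∩ negativeEdges L r) u v) :
    ∃ R : Finset V → Set (Finset V),
      (∀ t ∈ essentialTriangles L Ω r, t ∈ R t) ∧
      (essentialTriangles L Ω r).PairwiseDisjoint R ∧
      (⋃ t ∈ essentialTriangles L Ω r, R t) = ofCard L 3 ∧
      (∀ t ∈ essentialTriangles L Ω r, boundary (R t) ⊆ Γ) ∧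
      ∀ z ⊆ Γ, boundary z = ∅ → ∀ e ∈ z, ∃ t ∈ essentialTriangles L Ω r, e ∈ boundary (R t) := by
  classical
  set T := essentialTriangles L Ω r
  obtain ⟨t₀, ht₀L, ht₀Ω, -, ht₀, hpair⟩ := h.exists_last
  have ht₀T : t₀ ∈ T := ⟨ht₀L, fun e he => absurd he (ht₀ e)⟩
  have hex : ∀ t, t ∈ T \ {t₀} → ∃ X, IsFaceUnion L Γ X ∧ X ∩ T = {t} := fun t ht =>
    h.exists_separating hΓ2 hΓ hEΓ hl ht₀ ht₀L hpair ht.1 ht.2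
  choose! X hX using hex
  -- The last triangle gets as its region what the others leave over.
  set Y : Finset V → Set (Finset V) := fun t =>
    if t = t₀ then ofCard L 3 \ ⋃ s ∈ T \ {t₀}, X s else X t with hY
  have hY0 : Y t₀ = ofCard L 3 \ ⋃ s ∈ T \ {t₀}, X s := if_pos rfl
  have hY1 : ∀ t, t ≠ t₀ → Y t = X t := fun t ht => if_neg ht
  have hmem : ∀ t ∈ T \ {t₀}, ∀ s ∈ T, s ∈ X t ↔ s = t := by
    intro t ht s hs
    have : s ∈ X t ∩ T ↔ s ∈ ({t} : Set (Finset V)) := by rw [(hX t ht).2]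
    simpa [hs] using this
  have hYf : ∀ t ∈ T, IsFaceUnion L Γ (Y t) := by
    intro t ht
    by_cases h0 : t = t₀
    · rw [h0, hY0]
      exact isFaceUnion_all.sdiff (IsFaceUnion.biUnion fun s hs => (hX s hs).1)
    · rw [hY1 t h0]
      exact (hX t ⟨ht, h0⟩).1
  have hYT : ∀ t ∈ T, ∀ s ∈ T, s ∈ Y t ↔ s = t := by
    intro t ht s hs
    by_cases h0 : t = t₀
    · subst h0
      rw [hY0]
      constructor
      · intro h1
        by_contra hst
        exact h1.2 (Set.mem_iUnion₂.2 ⟨s, ⟨hs, hst⟩, (hmem s ⟨hs, hst⟩ s hs).2 rfl⟩)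
      · rintro rfl
        refine ⟨ht₀L, fun h1 => ?_⟩
        obtain ⟨t, ht', hst⟩ := Set.mem_iUnion₂.1 h1
        exact ht'.2 ((hmem t ht' s hs).1 hst).symm
    · rw [hY1 t h0]
      exact hmem t ⟨ht, h0⟩ s hs
  have hdisj : T.PairwiseDisjoint Y := by
    intro s hs t ht hst
    rw [Function.onFun, Set.disjoint_iff_inter_eq_empty]
    by_contra hne
    obtain ⟨x, hx, hxT⟩ := h.exists_essential_of_isFaceUnion hΓ
      ((hYf s hs).inter (hYf t ht)) (Set.nonempty_iff_ne_empty.2 hne)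
    exact hst (((hYT s hs x hxT).1 hx.1).symm.trans ((hYT t ht x hxT).1 hx.2))
  have hunion : (⋃ t ∈ T, Y t) = ofCard L 3 := by
    refine Set.Subset.antisymm (Set.iUnion₂_subset fun t ht => (hYf t ht).1) fun x hx => ?_
    by_cases hx0 : x ∈ ⋃ s ∈ T \ {t₀}, X s
    · obtain ⟨s, hs, hxs⟩ := Set.mem_iUnion₂.1 hx0
      exact Set.mem_iUnion₂.2 ⟨s, hs.1, by rwa [hY1 s hs.2]⟩
    · exact Set.mem_iUnion₂.2 ⟨t₀, ht₀T, by rw [hY0]; exact ⟨hx, hx0⟩⟩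
  refine ⟨Y, fun t ht => (hYT t ht t ht).2 rfl, hdisj, hunion,
    fun t ht => h.boundary_subset_of_isFaceUnion (hYf t ht), ?_⟩
  intro z hz hzb e hez
  obtain ⟨Z, hZ, hZb⟩ := h.bounds z (hz.trans hΓ2) hzb
  have hZf : IsFaceUnion L Γ Z := h.isFaceUnion_of_boundary hZ (hZb ▸ hz)
  obtain ⟨a, ha, b, hb, -, -, -, -, hside⟩ := h.exists_two_sides (hΓ2 (hz hez))
  have hab := (hside Z hZ).1 (hZb ▸ hez)
  -- The set `Z` bounded by the cycle cannot cut a region: both parts would be nonempty face unions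
  -- and would contain different essential triangles of the same region.
  have hsplit : ∀ c ∈ ofCard L 3, ∀ d ∈ ofCard L 3, c ∈ Z → d ∉ Z → ∃ t ∈ T, c ∈ Y t ∧ d ∉ Y t := by
    intro c hc d hd hcZ hdZ
    rw [← hunion] at hc
    obtain ⟨t, ht, hct⟩ := Set.mem_iUnion₂.1 hc
    refine ⟨t, ht, hct, fun hdt => ?_⟩
    obtain ⟨x, hx, hxT⟩ := h.exists_essential_of_isFaceUnion hΓ ((hYf t ht).inter hZf)
      ⟨c, hct, hcZ⟩
    obtain ⟨y, hy, hyT⟩ := h.exists_essential_of_isFaceUnion hΓ ((hYf t ht).sdiff hZf)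
      ⟨d, hdt, hdZ⟩
    have h1 := (hYT t ht x hxT).1 hx.1
    have h2 := (hYT t ht y hyT).1 hy.1
    exact hy.2 (h2 ▸ h1 ▸ hx.2)
  by_cases haZ : a ∈ Z
  · obtain ⟨t, ht, h1, h2⟩ := hsplit a ha b hb haZ (fun hbZ => hab (iff_of_true haZ hbZ))
    exact ⟨t, ht, (hside _ (hYf t ht).1).2 fun hiff => h2 (hiff.1 h1)⟩
  · have hbZ : b ∈ Z := by_contra fun hbZ => hab (iff_of_false haZ hbZ)
    obtain ⟨t, ht, h1, h2⟩ := hsplit b hb a ha hbZ haZ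
    exact ⟨t, ht, (hside _ (hYf t ht).1).2 fun hiff => h2 (hiff.2 h1)⟩

end IsFilteredSphere

end Regions

end GraphReconstruction

namespace GraphReconstruction

/-! ### Deformation retractions -/

section Retractions

/-- In terms of homotopies relative to `A`, two retractions can be concatenated by
`HomotopyRel.trans`. -/
theorem deformationRetractsTo_iff {Y : Type*} [TopologicalSpace Y] {X A : Set Y} :
    DeformationRetractsTo X A ↔ A ⊆ X ∧ ∃ f : C(X, X), (∀ x, (f x : Y) ∈ A) ∧
      Nonempty (ContinuousMap.HomotopyRel (ContinuousMap.id X) f {x | (x : Y) ∈ A}) := by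
  constructor
  · rintro ⟨hA, F, h0, h1, hrel⟩
    refine ⟨hA, ⟨fun x => F (1, x), by fun_prop⟩, h1, ⟨⟨⟨F, h0, fun _ => rfl⟩, ?_⟩⟩⟩
    exact fun t x hx => hrel t x hx
  · rintro ⟨hA, f, hf, ⟨F⟩⟩
    refine ⟨hA, F.toContinuousMap, fun x => F.map_zero_left x, fun x => ?_,
      fun t x hx => F.prop t x hx⟩
    have : F (1, x) = f x := F.map_one_left x
    exact this ▸ hf x

theorem DeformationRetractsTo.refl {Y : Type*} [TopologicalSpace Y] (X : Set Y) :
    DeformationRetractsTo X X :=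
  deformationRetractsTo_iff.2 ⟨subset_rfl, ContinuousMap.id X, fun x => x.2, ⟨.refl _ _⟩⟩

theorem DeformationRetractsTo.trans {Y : Type*} [TopologicalSpace Y] {X A B : Set Y}
    (h : DeformationRetractsTo X A) (h' : DeformationRetractsTo A B) :
    DeformationRetractsTo X B := by
  rw [deformationRetractsTo_iff] at h
  obtain ⟨hA, f, hf, ⟨F⟩⟩ := h
  obtain ⟨hB, G, hG0, hG1, hGrel⟩ := h'
  let f' : C(X, A) := ⟨fun x => ⟨f x, hf x⟩, by fun_prop⟩
  have hfix : ∀ x : X, (x : Y) ∈ A → f x = x := fun x hx => by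
    have := F.eq_snd 1 hx
    exact (F.fst_eq_snd hx).symm
  let g : C(X, X) := ⟨fun x => ⟨G (1, f' x), hA (G (1, f' x)).2⟩, by fun_prop⟩
  have hf' : ∀ x : X, (x : Y) ∈ B → (f' x : Y) = x := fun x hx =>
    congrArg Subtype.val (hfix x (hB hx))
  have hval : ∀ t, ∀ x : X, (x : Y) ∈ B → ((G (t, f' x) : A) : Y) = x := fun t x hx => by
    rw [hGrel t (f' x) (by rw [hf' x hx]; exact hx), hf' x hx]
  -- The second homotopy is run on the image of the first retraction; it is relative to `B` because
  -- `f` fixes `A`, which contains `B`.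
  let H : ContinuousMap.HomotopyRel f g {x | (x : Y) ∈ B} :=
    { toFun := fun p => ⟨G (p.1, f' p.2), hA (G (p.1, f' p.2)).2⟩
      continuous_toFun := by fun_prop
      map_zero_left := fun x => Subtype.ext (congrArg (Subtype.val : A → Y) (hG0 (f' x)))
      map_one_left := fun x => rfl
      prop' := fun t x hx => Subtype.ext ((hval t x hx).trans
        (congrArg Subtype.val (hfix x (hB hx))).symm) }
  let F' : ContinuousMap.HomotopyRel (ContinuousMap.id X) f {x | (x : Y) ∈ B} :=
    { toHomotopy := F.toHomotopy
      prop' := fun t x hx => F.prop' t x (hB hx) }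
  exact deformationRetractsTo_iff.2 ⟨hB.trans hA, g, fun x => hG1 (f' x), ⟨F'.trans H⟩⟩

end Retractions

/-! ### Geometric realizations and elementary collapses. -/

section Realization

variable {V : Type*} {E : Type*} [NormedAddCommGroup E] [NormedSpace ℝ E]

/-- The vertices of the complex `L` are placed by `pos` so that the simplices are nondegenerate and
meet in common faces. -/
structure IsGeometricRealization (L : Set (Finset V)) (pos : V → E) : Prop where
  indep : ∀ s ∈ L, AffineIndependent ℝ fun v : s => pos v
  inter : ∀ s ∈ L, ∀ t ∈ L, convexHull ℝ (pos '' (s : Set V)) ∩ convexHull ℝ (pos '' (t : Set V)) ⊆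
    convexHull ℝ (pos '' ((s : Set V) ∩ t))

theorem mem_convexHull_image_iff {pos : V → E} {s : Finset V} (hinj : Set.InjOn pos s) {x : E} :
    x ∈ convexHull ℝ (pos '' (s : Set V)) ↔
      ∃ w : V → ℝ, (∀ v ∈ s, 0 ≤ w v) ∧ ∑ v ∈ s, w v = 1 ∧ ∑ v ∈ s, w v • pos v = x := by
  classical
  rw [← Finset.coe_image, Finset.mem_convexHull']
  constructor
  · rintro ⟨w, h0, h1, h2⟩
    rw [Finset.sum_image hinj] at h1 h2
    exact ⟨fun v => w (pos v), fun v hv => h0 _ (Finset.mem_image_of_mem _ hv), h1, h2⟩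
  · rintro ⟨w, h0, h1, h2⟩
    rcases s.eq_empty_or_nonempty with rfl | ⟨v₀, hv₀⟩
    · simp at h1
    have : Nonempty V := ⟨v₀⟩
    have hinv : ∀ v ∈ s, Function.invFunOn pos s (pos v) = v := fun v hv =>
      hinj.leftInvOn_invFunOn hv
    refine ⟨fun y => w (Function.invFunOn pos s y), ?_, ?_, ?_⟩
    · intro y hy
      obtain ⟨v, hv, rfl⟩ := Finset.mem_image.1 hy
      dsimp only
      rw [hinv v hv]
      exact h0 v hv
    · rw [Finset.sum_image hinj, ← h1]
      exact Finset.sum_congr rfl fun v hv => by rw [hinv v hv]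
    · rw [Finset.sum_image hinj, ← h2]
      exact Finset.sum_congr rfl fun v hv => by dsimp only; rw [hinv v hv]

theorem injOn_of_affineIndependent {pos : V → E} {s : Finset V}
    (h : AffineIndependent ℝ fun v : s => pos v) : Set.InjOn pos s := by
  intro u hu v hv huv
  exact congrArg Subtype.val (h.injective (a₁ := ⟨u, hu⟩) (a₂ := ⟨v, hv⟩) huv)

/-- The vertices extend to an affine basis of the whole space, whose coordinate functions are
continuous in finite dimension. So barycentric coordinates are continuous beyond the simplex. -/
theorem exists_barycentric [FiniteDimensional ℝ E] {pos : V → E} {s : Finset V}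
    (h : AffineIndependent ℝ fun v : s => pos v) :
    ∃ ℓ : V → E → ℝ, (∀ v, Continuous (ℓ v)) ∧ ∀ w : V → ℝ, ∑ v ∈ s, w v = 1 →
      ∀ v ∈ s, ℓ v (∑ u ∈ s, w u • pos u) = w v := by
  classical
  obtain ⟨t, hst, hti, htop⟩ := exists_subset_affineIndependent_affineSpan_eq_top h.range
  let b : AffineBasis t ℝ E := ⟨Subtype.val, hti, by rwa [Subtype.range_coe]⟩
  have hmem : ∀ v ∈ s, pos v ∈ t := fun v hv => hst ⟨⟨v, hv⟩, rfl⟩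
  have hb : ∀ i : t, b i = (i : E) := fun i => rfl
  refine ⟨fun v => if hv : pos v ∈ t then b.coord ⟨pos v, hv⟩ else 0, fun v => ?_, ?_⟩
  · dsimp only
    split_ifs with hv
    · exact (b.coord ⟨pos v, hv⟩).continuous_of_finiteDimensional
    · exact continuous_const
  · intro w hw v hv
    have hinj := injOn_of_affineIndependent h
    dsimp only
    rw [dif_pos (hmem v hv)]
    set f := b.coord ⟨pos v, hmem v hv⟩
    have hdec : ∀ x, f x = f.linear x + f 0 := fun x => congrFun (AffineMap.decomp f) x
    have hval : ∀ u ∈ s, f (pos u) = if u = v then 1 else 0 := by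
      intro u hu
      have : pos u = b ⟨pos u, hmem u hu⟩ := rfl
      rw [this, b.coord_apply]
      simp only [Subtype.mk.injEq, hinj.eq_iff hv hu, eq_comm]
    calc f (∑ u ∈ s, w u • pos u) = ∑ u ∈ s, w u * f.linear (pos u) + (∑ u ∈ s, w u) * f 0 := by
          rw [hdec, map_sum, hw, one_mul]
          simp
      _ = ∑ u ∈ s, w u * f (pos u) := by
          rw [Finset.sum_mul, ← Finset.sum_add_distrib]
          exact Finset.sum_congr rfl fun u _ => by rw [hdec (pos u), mul_add]
      _ = w v := by
          rw [Finset.sum_congr rfl fun u hu => by rw [hval u hu]]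
          simp [hv]

theorem isClosed_realize {pos : V → E} {S : Set (Finset V)} (hS : S.Finite) :
    IsClosed (realize pos S) :=
  hS.isClosed_biUnion fun s _ => (s.finite_toSet.image pos).isClosed_convexHull ℝ

/-- An elementary collapse is a deformation retraction. -/
theorem deformationRetractsTo_of_free_face [FiniteDimensional ℝ E] [DecidableEq V]
    {L S : Set (Finset V)} {pos : V → E}
    (hL : IsGeometricRealization L pos) (hS : S.Finite) (hSL : S ⊆ L)
    (hSd : ∀ s ∈ S, ∀ t ⊆ s, t.Nonempty → t ∈ S) {σ : Finset V} {a : V} (hσ : σ.Nonempty)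
    (ha : a ∉ σ) (hmem : insert a σ ∈ S)
    (hfree : ∀ s ∈ S, σ ⊆ s → s = σ ∨ s = insert a σ) :
    DeformationRetractsTo (realize pos S) (realize pos (S \ {σ, insert a σ})) := by
  set τ := insert a σ with hτ
  set S' := S \ {σ, τ} with hS'
  have hind := hL.indep τ (hSL hmem)
  have hinj := injOn_of_affineIndependent hind
  obtain ⟨ℓ, hℓc, hℓ⟩ := exists_barycentric hind
  set D : Set E := convexHull ℝ (pos '' (τ : Set V)) with hD
  have hDcl : IsClosed D := (τ.finite_toSet.image pos).isClosed_convexHull ℝ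
  have hDS : D ⊆ realize pos S := Set.subset_biUnion_of_mem (u := fun s : Finset V =>
    convexHull ℝ (pos '' (s : Set V))) hmem
  have hcover : realize pos S = D ∪ realize pos S' := by
    apply Set.Subset.antisymm
    · refine Set.iUnion₂_subset fun s hs => ?_
      by_cases h1 : s = σ ∨ s = τ
      · refine Set.subset_union_of_subset_left (convexHull_mono (Set.image_mono ?_)) _
        rcases h1 with rfl | rfl
        · exact Finset.coe_subset.2 (Finset.subset_insert _ _)
        · exact subset_rfl
      · exact Set.subset_union_of_subset_right
          (Set.subset_biUnion_of_mem (u := fun s : Finset V =>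
            convexHull ℝ (pos '' (s : Set V))) (show s ∈ S' from ⟨hs, h1⟩)) _
    · exact Set.union_subset hDS (Set.biUnion_subset_biUnion_left Set.sdiff_subset)
  -- The smallest coordinate at a vertex of `σ`. It vanishes on the remaining complex, because there
  -- each simplex omits a vertex of `σ`.
  set m : E → ℝ := fun x => σ.inf' hσ fun v => ℓ v x with hm
  have hmc : Continuous m := Continuous.finset_inf'_apply hσ fun v _ => hℓc v
  have hστ : ∀ v ∈ σ, v ∈ τ := fun v hv => Finset.mem_insert_of_mem hv
  have hm0 : ∀ x ∈ D, 0 ≤ m x := by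
    intro x hx
    obtain ⟨w, hw0, hw1, rfl⟩ := (mem_convexHull_image_iff hinj).1 hx
    refine Finset.le_inf' hσ _ fun v hv => ?_
    rw [hℓ w hw1 v (hστ v hv)]
    exact hw0 v (hστ v hv)
  have hmS' : ∀ x ∈ D, x ∈ realize pos S' → m x = 0 := by
    intro x hx hxS
    obtain ⟨s, hs, hxs⟩ := Set.mem_iUnion₂.1 hxS
    have hx' := hL.inter τ (hSL hmem) s (hSL hs.1) ⟨hx, hxs⟩
    rw [← Finset.coe_inter] at hx'
    obtain ⟨w, hw0, hw1, rfl⟩ := (mem_convexHull_image_iff (hinj.mono (by simp))).1 hx'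
    obtain ⟨v, hv, hvs⟩ : ∃ v ∈ σ, v ∉ s := by
      by_contra! hsub
      exact hs.2 (hfree s hs.1 hsub)
    refine le_antisymm ?_ (hm0 _ hx)
    refine (Finset.inf'_le _ hv).trans (le_of_eq ?_)
    set w' : V → ℝ := fun u => if u ∈ s then w u else 0 with hw'
    have e1 : ∑ u ∈ τ, w' u = 1 := by
      rw [← hw1, hw', ← Finset.sum_filter, Finset.filter_mem_eq_inter]
    have e2 : ∑ u ∈ τ, w' u • pos u = ∑ u ∈ τ ∩ s, w u • pos u := by
      rw [← Finset.filter_mem_eq_inter, Finset.sum_filter]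
      exact Finset.sum_congr rfl fun u _ => by simp only [hw']; split_ifs <;> simp
    rw [← e2, hℓ w' e1 v (hστ v hv)]
    simp [hw', hvs]
  classical
  -- Extended by zero, `m` is continuous on the complex by gluing over two closed pieces.
  set M : E → ℝ := fun x => if x ∈ D then m x else 0 with hM
  have hMD : ∀ x ∈ D, M x = m x := fun x hx => if_pos hx
  have hMS' : ∀ x ∈ realize pos S', M x = 0 := by
    intro x hx
    by_cases hxD : x ∈ D
    · rw [hMD x hxD, hmS' x hxD hx]
    · exact if_neg hxD
  have hMc : ContinuousOn M (realize pos S) := by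
    rw [hcover]
    exact (hmc.continuousOn.congr hMD).union_of_isClosed (continuousOn_const.congr hMS') hDcl
      (isClosed_realize hS.sdiff)
  -- Adding `t • w₀` lowers every coordinate on `σ` by `t` and raises the one at `a` by `t` times
  -- the number of vertices of `σ`. The retraction moves `x` by `m x • w₀`.
  set w₀ : E := ∑ v ∈ σ, (pos a - pos v) with hw₀
  have hmove : ∀ t : ℝ, ∀ w : V → ℝ, ∑ v ∈ τ, w v = 1 → ∃ w' : V → ℝ,
      w' a = w a + t * σ.card ∧ (∀ v ∈ σ, w' v = w v - t) ∧ ∑ v ∈ τ, w' v = 1 ∧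
      ∑ v ∈ τ, w' v • pos v = ∑ v ∈ τ, w v • pos v + t • w₀ := by
    intro t w hw
    set w' : V → ℝ := fun v => if v = a then w a + t * σ.card else w v - t with hw'
    have h1 : w' a = w a + t * σ.card := if_pos rfl
    have h2 : ∀ v ∈ σ, w' v = w v - t := fun v hv =>
      if_neg (show ¬ v = a from fun h => ha (h ▸ hv))
    refine ⟨w', h1, h2, ?_, ?_⟩
    · rw [hτ, Finset.sum_insert ha] at hw ⊢
      rw [Finset.sum_congr rfl h2, h1, Finset.sum_sub_distrib, Finset.sum_const, nsmul_eq_mul]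
      linarith
    · have e : ∑ v ∈ σ, w' v • pos v = ∑ v ∈ σ, w v • pos v - t • ∑ v ∈ σ, pos v := by
        rw [Finset.smul_sum, ← Finset.sum_sub_distrib]
        exact Finset.sum_congr rfl fun v hv => by rw [h2 v hv, sub_smul]
      rw [hτ, Finset.sum_insert ha, Finset.sum_insert ha, e, h1, hw₀, Finset.sum_sub_distrib,
        Finset.sum_const, ← Nat.cast_smul_eq_nsmul ℝ, smul_sub, smul_smul, add_smul]
      abel
  have hmin : ∀ w : V → ℝ, ∑ v ∈ τ, w v = 1 → ∀ v ∈ σ, m (∑ v ∈ τ, w v • pos v) ≤ w v := by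
    intro w hw v hv
    refine (Finset.inf'_le _ hv).trans (le_of_eq ?_)
    exact hℓ w hw v (hστ v hv)
  have hin : ∀ t : ℝ, 0 ≤ t → t ≤ 1 → ∀ x ∈ D, x + (t * m x) • w₀ ∈ D := by
    intro t ht0 ht1 x hx
    have hmx := hm0 x hx
    obtain ⟨w, hw0, hw1, rfl⟩ := (mem_convexHull_image_iff hinj).1 hx
    have htm : t * m (∑ v ∈ τ, w v • pos v) ≤ m (∑ v ∈ τ, w v • pos v) :=
      mul_le_of_le_one_left hmx ht1
    obtain ⟨w', hwa, hwσ, h1, h2⟩ := hmove (t * m (∑ v ∈ τ, w v • pos v)) w hw1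
    refine (mem_convexHull_image_iff hinj).2 ⟨w', fun v hv => ?_, h1, h2⟩
    rcases Finset.mem_insert.1 hv with rfl | hvσ
    · have := hw0 v (Finset.mem_insert_self v σ)
      rw [hwa]
      positivity
    · have := hmin w hw1 v hvσ
      rw [hwσ v hvσ]
      linarith
  -- At the end the coordinate at a vertex `u` where the minimum is attained is zero, so the point
  -- is in the face of `τ` opposite to `u`.
  have hend : ∀ x ∈ D, x + m x • w₀ ∈ realize pos S' := by
    intro x hx
    have hxD := hin 1 zero_le_one le_rfl x hx
    have hmx := hm0 x hx
    obtain ⟨w, hw0, hw1, rfl⟩ := (mem_convexHull_image_iff hinj).1 hx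
    obtain ⟨u, hu, hmu⟩ := Finset.exists_mem_eq_inf' hσ fun v => ℓ v (∑ v ∈ τ, w v • pos v)
    have hmu' : m (∑ v ∈ τ, w v • pos v) = w u := by
      rw [hm]
      dsimp only
      rw [hmu, hℓ w hw1 u (hστ u hu)]
    obtain ⟨w', hwa, hwσ, h1, h2⟩ := hmove (m (∑ v ∈ τ, w v • pos v)) w hw1
    have hua : u ≠ a := fun h => ha (h ▸ hu)
    have hmemS : τ.erase u ∈ S' := by
      refine ⟨hSd τ hmem _ (Finset.erase_subset _ _) ⟨a, ?_⟩, ?_⟩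
      · exact Finset.mem_erase.2 ⟨hua.symm, Finset.mem_insert_self a σ⟩
      · rintro (h | h)
        · have : a ∈ τ.erase u := Finset.mem_erase.2 ⟨hua.symm, Finset.mem_insert_self a σ⟩
          rw [h] at this
          exact ha this
        · have : u ∈ τ.erase u := by rw [h]; exact hστ u hu
          exact Finset.notMem_erase u τ this
    refine Set.mem_iUnion₂.2 ⟨τ.erase u, hmemS, ?_⟩
    have hz : w' u = 0 := by rw [hwσ u hu, hmu', sub_self]
    refine (mem_convexHull_image_iff (hinj.mono (by simp))).2 ⟨w', fun v hv => ?_, ?_, ?_⟩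
    · rcases Finset.mem_insert.1 (Finset.mem_of_mem_erase hv) with rfl | hvσ
      · have := hw0 v (Finset.mem_insert_self v σ)
        rw [hwa]
        positivity
      · have := hmin w hw1 v hvσ
        rw [hwσ v hvσ]
        linarith
    · rw [Finset.sum_erase _ hz]
      exact h1
    · rw [Finset.sum_erase _ (by rw [hz, zero_smul])]
      exact h2
  have hFmem : ∀ t : unitInterval, ∀ x ∈ realize pos S,
      x + ((t : ℝ) * M x) • w₀ ∈ realize pos S := by
    intro t x hx
    by_cases hxD : x ∈ D
    · rw [hMD x hxD]
      exact hDS (hin t t.2.1 t.2.2 x hxD)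
    · have : M x = 0 := if_neg hxD
      rw [this, mul_zero, zero_smul, add_zero]
      exact hx
  refine ⟨Set.biUnion_subset_biUnion_left Set.sdiff_subset,
    ⟨fun p => ⟨p.2 + ((p.1 : ℝ) * M p.2) • w₀, hFmem p.1 p.2 p.2.2⟩, ?_⟩, ?_, ?_, ?_⟩
  · have hMc' : Continuous fun x : realize pos S => M x := continuousOn_iff_continuous_domRestrict.1 hMc
    refine Continuous.subtype_mk ?_ _
    exact (continuous_subtype_val.comp continuous_snd).add
      (((continuous_subtype_val.comp continuous_fst).mul (hMc'.comp continuous_snd)).smul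
        continuous_const)
  · intro x
    simp
  · intro x
    change (x : E) + (((1 : unitInterval) : ℝ) * M x) • w₀ ∈ _
    rw [Set.Icc.coe_one, one_mul]
    by_cases hxD : (x : E) ∈ D
    · rw [hMD x hxD]
      exact hend x hxD
    · have : M x = 0 := if_neg hxD
      rw [this, zero_smul, add_zero]
      have hx : (x : E) ∈ D ∪ realize pos S' := by
        rw [← hcover]
        exact x.2
      exact hx.resolve_left hxD
  · intro t x hx
    refine Subtype.ext ?_
    change (x : E) + ((t : ℝ) * M x) • w₀ = x
    rw [hMS' x hx, mul_zero, zero_smul, add_zero]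

/-- A complex deformation retracts to each complex it collapses to. -/
theorem Collapses.deformationRetractsTo [FiniteDimensional ℝ E] [DecidableEq V]
    {L S A : Set (Finset V)} {pos : V → E}
    (hL : IsGeometricRealization L pos) (h : Collapses S A) (hS : S.Finite) (hSL : S ⊆ L)
    (hSd : ∀ s ∈ S, ∀ t ⊆ s, t.Nonempty → t ∈ S) :
    DeformationRetractsTo (realize pos S) (realize pos A) := by
  induction h with
  | refl S => exact .refl _
  | @step S A σ a hσ ha hmem hfree _ ih =>
    refine (deformationRetractsTo_of_free_face hL hS hSL hSd hσ ha hmem hfree).trans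
      (ih hS.sdiff (Set.sdiff_subset.trans hSL) ?_)
    rintro s ⟨hs, hns⟩ t hts htne
    refine ⟨hSd s hs t hts htne, ?_⟩
    intro ht
    have hσt : σ ⊆ t := by
      rcases ht with rfl | rfl
      · exact subset_rfl
      · exact Finset.subset_insert _ _
    exact hns (hfree s hs (hσt.trans hts))

end Realization

end GraphReconstruction

namespace GraphReconstruction

/-! ### Planar complexes -/

section Planar

open MeasureTheory Geometry

variable {K : SimplicialComplex ℝ Plane}

theorem weights_unique {s : Finset Plane} (hs : AffineIndependent ℝ ((↑) : s → Plane))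
    {w w' : Plane → ℝ} (hw : ∑ v ∈ s, w v = 1) (hw' : ∑ v ∈ s, w' v = 1)
    (h : ∑ v ∈ s, w v • v = ∑ v ∈ s, w' v • v) : ∀ v ∈ s, w v = w' v := by
  obtain ⟨ℓ, -, hℓ⟩ := exists_barycentric (pos := id) hs
  intro v hv
  have h1 := hℓ w hw v hv
  have h2 := hℓ w' hw' v hv
  simp only [id] at h1 h2
  rw [← h1, ← h2, h]

/-- A point interior to `s` that lies in `t` lies in the hull of the common vertices; by uniqueness
of barycentric coordinates, no vertex of `s` is missing from `t`. -/
theorem subset_of_pos_weights {s t : Finset Plane} (hs : s ∈ K.faces) (ht : t ∈ K.faces)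
    {w : Plane → ℝ} (hw : ∀ v ∈ s, 0 < w v) (hw1 : ∑ v ∈ s, w v = 1)
    (hx : ∑ v ∈ s, w v • v ∈ convexHull ℝ (t : Set Plane)) : s ⊆ t := by
  classical
  have hx' := K.inter_subset_convexHull hs ht ⟨(Finset.mem_convexHull'.2
    ⟨w, fun v hv => (hw v hv).le, hw1, rfl⟩), hx⟩
  rw [← Finset.coe_inter, Finset.mem_convexHull'] at hx'
  obtain ⟨w', h0, h1, h2⟩ := hx'
  set w'' : Plane → ℝ := fun u => if u ∈ t then w' u else 0 with hw''
  have e1 : ∑ u ∈ s, w'' u = 1 := by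
    rw [← h1, hw'', ← Finset.sum_filter, Finset.filter_mem_eq_inter]
  have e2 : ∑ u ∈ s, w'' u • u = ∑ u ∈ s ∩ t, w' u • u := by
    rw [← Finset.filter_mem_eq_inter, Finset.sum_filter]
    exact Finset.sum_congr rfl fun u _ => by simp only [hw'']; split_ifs <;> simp
  intro v hv
  by_contra hvt
  have := weights_unique (K.indep hs) hw1 e1 (by rw [e2, h2]) v hv
  simp only [hw'', if_neg hvt] at this
  exact (hw v hv).ne' this

theorem card_le_three {s : Finset Plane} (hs : s ∈ K.faces) : s.card ≤ 3 := by
  have h := (K.indep hs).card_le_finrank_succ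
  have h2 := Submodule.finrank_le (vectorSpan ℝ (Set.range ((↑) : s → Plane)))
  rw [finrank_euclideanSpace_fin] at h2
  rw [Fintype.card_coe] at h
  omega

/-- Twice the signed area of a triangle. -/
def orient (a b c : Plane) : ℝ := (b 0 - a 0) * (c 1 - a 1) - (b 1 - a 1) * (c 0 - a 0)

theorem orient_swap (a b c : Plane) : orient b a c = - orient a b c := by
  simp only [orient]; ring

theorem continuous_orient (a b : Plane) : Continuous fun x => orient a b x := by
  unfold orient
  fun_prop

theorem sum_triple {M : Type*} [AddCommMonoid M] [DecidableEq Plane] {a b c : Plane} (hab : a ≠ b)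
    (hac : a ≠ c) (hbc : b ≠ c) (f : Plane → M) :
    ∑ v ∈ ({a, b, c} : Finset Plane), f v = f a + (f b + f c) := by
  rw [Finset.sum_insert (by simp [hab, hac]), Finset.sum_pair hbc]

theorem plane_ext {x y : Plane} (h0 : x 0 = y 0) (h1 : x 1 = y 1) : x = y := by
  ext i
  fin_cases i
  · exact h0
  · exact h1

/-- If the area vanished, `c` would be an affine combination of `a` and `b`, against affine
independence. -/
theorem orient_ne_zero [DecidableEq Plane] {a b c : Plane} (hab : a ≠ b) (hac : a ≠ c)
    (hbc : b ≠ c) (h : ({a, b, c} : Finset Plane) ∈ K.faces) : orient a b c ≠ 0 := by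
  intro h0
  obtain ⟨k, hk⟩ : ∃ k : ℝ, c = (1 - k) • a + k • b := by
    simp only [orient] at h0
    by_cases hx : b 0 = a 0
    · have hy : b 1 - a 1 ≠ 0 := fun hy => hab (plane_ext hx.symm (by linarith))
      have hc0 : c 0 = a 0 := by
        rw [hx, sub_self, zero_mul, zero_sub, neg_eq_zero, mul_eq_zero] at h0
        linarith [h0.resolve_left hy]
      refine ⟨(c 1 - a 1) / (b 1 - a 1), plane_ext ?_ ?_⟩
      · simp only [PiLp.add_apply, PiLp.smul_apply, smul_eq_mul, hx, hc0]
        ring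
      · simp only [PiLp.add_apply, PiLp.smul_apply, smul_eq_mul]
        field_simp
        ring
    · have hx' : b 0 - a 0 ≠ 0 := sub_ne_zero.2 hx
      refine ⟨(c 0 - a 0) / (b 0 - a 0), plane_ext ?_ ?_⟩
      · simp only [PiLp.add_apply, PiLp.smul_apply, smul_eq_mul]
        field_simp
        ring
      · simp only [PiLp.add_apply, PiLp.smul_apply, smul_eq_mul]
        field_simp
        linarith
  have := weights_unique (K.indep h) (w := fun v => if v = c then 1 else 0)
    (w' := fun v => if v = a then 1 - k else if v = b then k else 0)
    (by rw [sum_triple hab hac hbc]; simp [hac, hbc])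
    (by rw [sum_triple hab hac hbc]; simp [hab.symm, hac.symm, hbc.symm])
    (by
      rw [sum_triple hab hac hbc, sum_triple hab hac hbc]
      simp [hac, hbc, hab.symm, hac.symm, hbc.symm]
      exact hk) c (by simp)
  simp [hac.symm, hbc.symm] at this

theorem volume_affineSpan_eq_zero {s : Finset Plane} (hs : s.card ≤ 2) :
    volume (affineSpan ℝ (s : Set Plane) : Set Plane) = 0 := by
  refine Measure.addHaar_affineSubspace _ _ fun htop => ?_
  rcases s.eq_empty_or_nonempty with rfl | hne
  · simp at htop
  · have h1 : vectorSpan ℝ (s : Set Plane) = ⊤ := by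
      rw [← direction_affineSpan, htop, AffineSubspace.direction_top]
    have h2 : Module.finrank ℝ (vectorSpan ℝ (s : Set Plane)) ≤ 1 := by
      obtain ⟨n, hn⟩ : ∃ n, s.card = n + 1 := ⟨s.card - 1, by have := hne.card_pos; omega⟩
      have := finrank_vectorSpan_range_le ℝ ((↑) : s → Plane) (n := n)
        (by rw [Fintype.card_coe, hn])
      rw [Subtype.range_coe_subtype] at this
      exact this.trans (by omega)
    rw [h1, finrank_top, finrank_euclideanSpace_fin] at h2
    omega

theorem volume_convexHull_eq_zero {s : Finset Plane} (hs : s.card ≤ 2) :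
    volume (convexHull ℝ (s : Set Plane)) = 0 :=
  measure_mono_null (convexHull_subset_affineSpan _) (volume_affineSpan_eq_zero hs)

theorem isClosed_face (s : Finset Plane) : IsClosed (convexHull ℝ (s : Set Plane)) :=
  s.finite_toSet.isClosed_convexHull ℝ

/-- A point at the border of an open subset of the square is in a triangle that meets the open
subset. -/
theorem exists_triangle_near (hK : IsTriangulation K) {O : Set Plane} (hO : IsOpen O)
    (hOs : O ⊆ unitSquare) {x : Plane} (hx : x ∈ closure O) :
    ∃ t ∈ K.faces, t.card = 3 ∧ x ∈ convexHull ℝ (t : Set Plane) ∧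
      (O ∩ convexHull ℝ (t : Set Plane)).Nonempty := by
  by_contra! hno
  -- The faces that miss `x` form a closed set, so near `x` the set `O` has positive measure outside
  -- them. Without a suitable triangle, vertices and edges alone would cover this part, but they
  -- have measure zero.
  set A : Set (Finset Plane) := {t ∈ K.faces | x ∉ convexHull ℝ (t : Set Plane)}
  have hAc : IsClosed (⋃ t ∈ A, convexHull ℝ (t : Set Plane)) :=
    (hK.1.subset (Set.sep_subset _ _)).isClosed_biUnion fun t _ => isClosed_face t
  have hxU : x ∈ (⋃ t ∈ A, convexHull ℝ (t : Set Plane))ᶜ := by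
    intro h
    obtain ⟨t, ht, hxt⟩ := Set.mem_iUnion₂.1 h
    exact ht.2 hxt
  have hne := mem_closure_iff.1 hx _ hAc.isOpen_compl hxU
  have hpos := (hAc.isOpen_compl.inter hO).measure_pos volume hne
  have hsub : (⋃ t ∈ A, convexHull ℝ (t : Set Plane))ᶜ ∩ O ⊆
      ⋃ t ∈ {t ∈ K.faces | t.card ≤ 2}, convexHull ℝ (t : Set Plane) := by
    rintro y ⟨hyU, hyO⟩
    have hy : y ∈ K.space := hK.2 ▸ hOs hyO
    obtain ⟨t, ht, hyt⟩ := SimplicialComplex.mem_space_iff.1 hy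
    refine Set.mem_iUnion₂.2 ⟨t, ⟨ht, ?_⟩, hyt⟩
    by_contra hc
    have h3 := card_le_three ht
    by_cases hxt : x ∈ convexHull ℝ (t : Set Plane)
    · have := hno t ht (by omega) hxt
      exact (this ▸ (⟨hyO, hyt⟩ : y ∈ O ∩ convexHull ℝ (t : Set Plane)) : y ∈ (∅ : Set Plane))
    · exact hyU (Set.mem_iUnion₂.2 ⟨t, ⟨ht, hxt⟩, hyt⟩)
  have hzero : volume (⋃ t ∈ {t ∈ K.faces | t.card ≤ 2}, convexHull ℝ (t : Set Plane)) = 0 :=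
    (measure_biUnion_null_iff (hK.1.subset (Set.sep_subset _ _)).countable).2
      fun t ht => volume_convexHull_eq_zero ht.2
  exact hpos.ne' (measure_mono_null hsub hzero)

theorem orient_combo [DecidableEq Plane] {a b c x : Plane} (hab : a ≠ b) (hac : a ≠ c)
    (hbc : b ≠ c) (hx : x ∈ convexHull ℝ (({a, b, c} : Finset Plane) : Set Plane)) :
    ∃ γ : ℝ, 0 ≤ γ ∧ orient a b x = γ * orient a b c := by
  obtain ⟨w, h0, h1, rfl⟩ := Finset.mem_convexHull'.1 hx
  rw [sum_triple hab hac hbc] at h1 ⊢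
  refine ⟨w c, h0 c (by simp), ?_⟩
  simp only [orient, PiLp.add_apply, PiLp.smul_apply, smul_eq_mul]
  have : w a = 1 - w b - w c := by linarith
  rw [this]
  ring

theorem midpoint_eq_sum [DecidableEq Plane] {a b : Plane} (hab : a ≠ b) :
    midpoint ℝ a b = ∑ v ∈ ({a, b} : Finset Plane), (1 / 2 : ℝ) • v := by
  rw [Finset.sum_pair hab, midpoint_eq_smul_add, smul_add, one_div, invOf_eq_inv]

theorem edge_subset_of_midpoint [DecidableEq Plane] {a b : Plane} (hab : a ≠ b)
    {t : Finset Plane} (he : ({a, b} : Finset Plane) ∈ K.faces) (ht : t ∈ K.faces)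
    (hm : midpoint ℝ a b ∈ convexHull ℝ (t : Set Plane)) : {a, b} ⊆ t := by
  rw [midpoint_eq_sum hab] at hm
  exact subset_of_pos_weights he ht (fun _ _ => by norm_num)
    (by rw [Finset.sum_pair hab]; norm_num) hm

theorem exists_eq_triple [DecidableEq Plane] {a b : Plane} (hab : a ≠ b) {t : Finset Plane}
    (ht : t.card = 3) (hsub : {a, b} ⊆ t) : ∃ c, a ≠ c ∧ b ≠ c ∧ t = {a, b, c} := by
  obtain ⟨c, hct, hc⟩ := Finset.exists_mem_notMem_of_card_lt_card
    (show ({a, b} : Finset Plane).card < t.card by rw [Finset.card_pair hab, ht]; norm_num)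
  simp only [Finset.mem_insert, Finset.mem_singleton, not_or] at hc
  refine ⟨c, Ne.symm hc.1, Ne.symm hc.2, (Finset.eq_of_subset_of_card_le ?_ ?_).symm⟩
  · intro x hx
    simp only [Finset.mem_insert, Finset.mem_singleton] at hx
    rcases hx with rfl | rfl | rfl
    · exact hsub (by simp)
    · exact hsub (by simp)
    · exact hct
  · rw [ht, Finset.card_insert_of_notMem (by simp [hab, Ne.symm hc.1]),
      Finset.card_pair (Ne.symm hc.2)]

/-- There is at most one triangle on a side of an edge. -/
theorem third_vertex_unique [DecidableEq Plane] {a b c c' : Plane} (hab : a ≠ b) (hac : a ≠ c)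
    (hbc : b ≠ c) (hac' : a ≠ c') (hbc' : b ≠ c')
    (h : ({a, b, c} : Finset Plane) ∈ K.faces) (h' : ({a, b, c'} : Finset Plane) ∈ K.faces)
    (hs : 0 < orient a b c * orient a b c') : c = c' := by
  by_contra hcc
  have hD' : orient a b c' ≠ 0 := fun h0 => by simp [h0] at hs
  have hD : orient a b c ≠ 0 := fun h0 => by simp [h0] at hs
  -- By Cramer's rule, `γ` and `β` are the affine coordinates of `c` at `c'` and `b` with respect to
  -- `a`, `b`, `c'`; `γ` is positive because `c` and `c'` are on the same side.
  set γ := orient a b c / orient a b c' with hγ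
  have hγ0 : 0 < γ := by
    rw [hγ]
    have : orient a b c / orient a b c' = orient a b c * orient a b c' / orient a b c' ^ 2 := by
      field_simp
    rw [this]
    positivity
  set β := orient a c c' / orient a b c' with hβ
  have hc : c = (1 - β - γ) • a + β • b + γ • c' := by
    apply plane_ext
    · simp only [PiLp.add_apply, PiLp.smul_apply, smul_eq_mul, hγ, hβ]
      field_simp
      simp only [orient]
      ring
    · simp only [PiLp.add_apply, PiLp.smul_apply, smul_eq_mul, hγ, hβ]
      field_simp
      simp only [orient]
      ring
  -- The point `p` is the midpoint of the edge moved slightly towards `c`. The chosen `ε` satisfies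
  -- (1-ε)/2 = ε(1+|β|+γ), which keeps the coordinates of `p` in the second triangle nonnegative.
  obtain ⟨ε, hε0, hε1, hεa, hεb⟩ : ∃ ε : ℝ, 0 < ε ∧ ε ≤ 1 ∧
      0 ≤ (1 - ε) / 2 + ε * (1 - β - γ) ∧ 0 ≤ (1 - ε) / 2 + ε * β := by
    have hB : 0 < 1 + 2 * (1 + |β| + γ) := by positivity
    have hε0 : 0 < 1 / (1 + 2 * (1 + |β| + γ)) := by positivity
    refine ⟨1 / (1 + 2 * (1 + |β| + γ)), hε0, ?_, ?_, ?_⟩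
    · rw [div_le_one hB]
      have := abs_nonneg β
      linarith
    · have h1 : 1 / (1 + 2 * (1 + |β| + γ)) * (1 + 2 * (1 + |β| + γ)) = 1 := by field_simp
      nlinarith [neg_abs_le β, le_abs_self β]
    · have h1 : 1 / (1 + 2 * (1 + |β| + γ)) * (1 + 2 * (1 + |β| + γ)) = 1 := by field_simp
      nlinarith [neg_abs_le β, le_abs_self β]
  set p : Plane := ((1 - ε) / 2) • a + (((1 - ε) / 2) • b + ε • c) with hp
  have hp1 : p ∈ convexHull ℝ (({a, b, c} : Finset Plane) : Set Plane) := by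
    refine Finset.mem_convexHull'.2 ⟨fun v => if v = c then ε else (1 - ε) / 2, ?_, ?_, ?_⟩
    · intro v _
      dsimp only
      split_ifs
      · exact hε0.le
      · linarith
    · rw [sum_triple hab hac hbc]
      simp [hac, hbc]
      ring
    · rw [sum_triple hab hac hbc]
      simp [hac, hbc, hp]
  have hp2 : p ∈ convexHull ℝ (({a, b, c'} : Finset Plane) : Set Plane) := by
    refine Finset.mem_convexHull'.2 ⟨fun v => if v = a then (1 - ε) / 2 + ε * (1 - β - γ) else
      if v = b then (1 - ε) / 2 + ε * β else ε * γ, ?_, ?_, ?_⟩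
    · intro v _
      dsimp only
      split_ifs
      · exact hεa
      · exact hεb
      · positivity
    · rw [sum_triple hab hac' hbc']
      simp [hab.symm, hac'.symm, hbc'.symm]
      ring
    · rw [sum_triple hab hac' hbc']
      simp only [if_true, hab.symm, hac'.symm, hbc'.symm, if_false, hp]
      have hεc : ε • c = ε • ((1 - β - γ) • a + β • b + γ • c') := congrArg _ hc
      rw [hεc]
      module
  -- If `c ≠ c'`, the two triangles share at most `a` and `b`, so they meet on the line through the
  -- edge, but `p` is off this line.
  have hp3 := K.inter_subset_convexHull h h' ⟨hp1, hp2⟩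
  have hsub : (({a, b, c} : Finset Plane) : Set Plane) ∩ (({a, b, c'} : Finset Plane) : Set Plane) ⊆
      {x | orient a b x = 0} := by
    rintro x ⟨hx, hx'⟩
    simp only [Finset.coe_insert, Finset.coe_singleton, Set.mem_insert_iff,
      Set.mem_singleton_iff] at hx hx'
    have : x = a ∨ x = b := by
      rcases hx with h1 | h1 | h1
      · exact Or.inl h1
      · exact Or.inr h1
      · rcases hx' with h2 | h2 | h2
        · exact Or.inl h2
        · exact Or.inr h2
        · exact absurd (h1.symm.trans h2) hcc
    rcases this with rfl | rfl
    · simp [orient]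
    · simp only [orient, Set.mem_ofPred_eq]
      ring
  have hconv : Convex ℝ {x | orient a b x = 0} := by
    intro x hx y hy u v _ _ huv
    simp only [Set.mem_ofPred_eq, orient, PiLp.add_apply, PiLp.smul_apply, smul_eq_mul] at hx hy ⊢
    have : v = 1 - u := by linarith
    subst this
    linear_combination u * hx + (1 - u) * hy
  have hp0 : orient a b p = 0 := convexHull_min hsub hconv hp3
  have hp4 : orient a b p = ε * orient a b c := by
    simp only [hp, orient, PiLp.add_apply, PiLp.smul_apply, smul_eq_mul]
    ring
  rw [hp4, mul_eq_zero] at hp0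
  rcases hp0 with h0 | h0
  · exact hε0.ne' h0
  · exact hD h0

/-- A side of an edge that is approached by points of the square contains a triangle. -/
theorem exists_third_vertex [DecidableEq Plane] (hK : IsTriangulation K) {a b : Plane}
    (hab : a ≠ b) (he : ({a, b} : Finset Plane) ∈ K.faces) {O : Set Plane} (hO : IsOpen O)
    (hOs : O ⊆ unitSquare) (hm : midpoint ℝ a b ∈ closure O) (hpos : ∀ x ∈ O, 0 < orient a b x) :
    ∃ c, a ≠ c ∧ b ≠ c ∧ ({a, b, c} : Finset Plane) ∈ K.faces ∧ 0 < orient a b c := by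
  obtain ⟨t, ht, ht3, hmt, x, hxO, hxt⟩ := exists_triangle_near hK hO hOs hm
  obtain ⟨c, hac, hbc, rfl⟩ := exists_eq_triple hab ht3 (edge_subset_of_midpoint hab he ht hmt)
  refine ⟨c, hac, hbc, ht, ?_⟩
  obtain ⟨γ, hγ, heq⟩ := orient_combo hab hac hbc hxt
  have := hpos x hxO
  rw [heq] at this
  exact pos_of_mul_pos_right this hγ

end Planar

end GraphReconstruction

namespace GraphReconstruction

/-! ### Triangulations of the square -/

section Square

open MeasureTheory Geometry

variable {K : SimplicialComplex ℝ Plane}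

theorem convex_unitSquare : Convex ℝ unitSquare := by
  intro x hx y hy a b ha hb hab i
  simp only [PiLp.add_apply, PiLp.smul_apply, smul_eq_mul]
  obtain ⟨h1, h2⟩ := hx i
  obtain ⟨h3, h4⟩ := hy i
  constructor
  · positivity
  · nlinarith

theorem isClosed_unitSquare : IsClosed unitSquare := by
  have : unitSquare = ⋂ i : Fin 2, {x : Plane | 0 ≤ x i} ∩ {x | x i ≤ 1} := by
    ext x
    simp [unitSquare]
  rw [this]
  exact isClosed_iInter fun i => (isClosed_le continuous_const (by fun_prop)).inter
    (isClosed_le (by fun_prop) continuous_const)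

theorem interior_unitSquare : interior unitSquare = {x | ∀ i, 0 < x i ∧ x i < 1} := by
  apply Set.Subset.antisymm
  · intro x hx i
    have hopen : IsOpenMap (EuclideanSpace.proj i : Plane →L[ℝ] ℝ) :=
      (EuclideanSpace.proj i : Plane →L[ℝ] ℝ).isOpenMap fun y =>
        ⟨EuclideanSpace.single i y, by simp⟩
    have h1 : (EuclideanSpace.proj i : Plane →L[ℝ] ℝ) '' interior unitSquare ⊆ Set.Icc 0 1 := by
      rintro _ ⟨y, hy, rfl⟩
      exact interior_subset hy i
    have h2 := interior_maximal h1 (hopen _ isOpen_interior)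
    rw [interior_Icc] at h2
    exact h2 ⟨x, hx, rfl⟩
  · refine interior_maximal (fun x hx i => ⟨(hx i).1.le, (hx i).2.le⟩) ?_
    have : {x : Plane | ∀ i, 0 < x i ∧ x i < 1} =
        ⋂ i : Fin 2, {x : Plane | 0 < x i} ∩ {x | x i < 1} := by
      ext x
      simp
    rw [this]
    exact isOpen_iInter_of_finite fun i => (isOpen_lt continuous_const (by fun_prop)).inter
      (isOpen_lt (by fun_prop) continuous_const)

theorem mem_frontier_iff {x : Plane} :
    x ∈ frontier unitSquare ↔ x ∈ unitSquare ∧ ∃ i, x i = 0 ∨ x i = 1 := by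
  rw [frontier, isClosed_unitSquare.closure_eq, interior_unitSquare, Set.mem_sdiff]
  refine and_congr_right fun hx => ?_
  simp only [Set.mem_ofPred_eq, not_forall, not_and_or, not_lt]
  exact exists_congr fun i => or_congr ⟨fun h => le_antisymm h (hx i).1, fun h => h.le⟩
    ⟨fun h => le_antisymm (hx i).2 h, fun h => h.ge⟩

theorem convex_interior_unitSquare : Convex ℝ (interior unitSquare) :=
  convex_unitSquare.interior

theorem nonempty_interior_unitSquare : (interior unitSquare).Nonempty := by
  rw [interior_unitSquare]
  exact ⟨!₂[1 / 2, 1 / 2], fun i => by fin_cases i <;> norm_num⟩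

theorem closure_interior_unitSquare : closure (interior unitSquare) = unitSquare := by
  rw [convex_unitSquare.closure_interior_eq_closure_of_nonempty_interior
    nonempty_interior_unitSquare, isClosed_unitSquare.closure_eq]

theorem face_subset_square (hK : IsTriangulation K) {s : Finset Plane} (hs : s ∈ K.faces) :
    convexHull ℝ (s : Set Plane) ⊆ unitSquare :=
  hK.2 ▸ SimplicialComplex.convexHull_subset_space hs

theorem vertex_mem_square (hK : IsTriangulation K) {s : Finset Plane} (hs : s ∈ K.faces)
    {v : Plane} (hv : v ∈ s) : v ∈ unitSquare :=
  face_subset_square hK hs (subset_convexHull ℝ _ hv)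

/-- The points lie on a common side of the square. -/
def OnCommonSide (s : Finset Plane) : Prop :=
  ∃ i, (∀ v ∈ s, v i = 0) ∨ ∀ v ∈ s, v i = 1

/-- A mean with positive weights of numbers in [0, 1] equals 0 or 1 only if all of them do. -/
theorem onCommonSide_of_pos_weights {s : Finset Plane} (hs : ∀ v ∈ s, v ∈ unitSquare)
    {w : Plane → ℝ} (hw : ∀ v ∈ s, 0 < w v) (hw1 : ∑ v ∈ s, w v = 1)
    (hx : ∑ v ∈ s, w v • v ∈ frontier unitSquare) : OnCommonSide s := by
  obtain ⟨-, i, hi⟩ := mem_frontier_iff.1 hx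
  have hsum : (∑ v ∈ s, w v • v) i = ∑ v ∈ s, w v * v i := by
    simp
  refine ⟨i, hi.imp (fun h0 => ?_) fun h1 => ?_⟩
  · rw [hsum, Finset.sum_eq_zero_iff_of_nonneg fun v hv =>
      mul_nonneg (hw v hv).le (hs v hv i).1] at h0
    exact fun v hv => (mul_eq_zero.1 (h0 v hv)).resolve_left (hw v hv).ne'
  · have : ∑ v ∈ s, w v * (1 - v i) = 0 := by
      simp only [mul_sub, mul_one, Finset.sum_sub_distrib]
      rw [hw1, ← hsum, h1, sub_self]
    rw [Finset.sum_eq_zero_iff_of_nonneg fun v hv =>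
      mul_nonneg (hw v hv).le (sub_nonneg.2 (hs v hv i).2)] at this
    intro v hv
    have := (mul_eq_zero.1 (this v hv)).resolve_left (hw v hv).ne'
    linarith

theorem convexHull_subset_side {s : Finset Plane} {i : Fin 2} {b : ℝ} (h : ∀ v ∈ s, v i = b)
    {x : Plane} (hx : x ∈ convexHull ℝ (s : Set Plane)) : x i = b := by
  have hconv : Convex ℝ {x : Plane | x i = b} := by
    intro x hx y hy u v _ _ huv
    simp only [Set.mem_ofPred_eq, PiLp.add_apply, PiLp.smul_apply, smul_eq_mul] at hx hy ⊢
    rw [hx, hy, ← add_mul, huv, one_mul]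
  exact convexHull_min (fun v hv => h v hv) hconv hx

theorem face_subset_frontier_iff (hK : IsTriangulation K) {s : Finset Plane} (hs : s ∈ K.faces) :
    convexHull ℝ (s : Set Plane) ⊆ frontier unitSquare ↔ OnCommonSide s := by
  constructor
  · intro h
    have hne := SimplicialComplex.nonempty_of_mem_faces hs
    have hc : (0 : ℝ) < s.card := Nat.cast_pos.2 hne.card_pos
    have h1 : ∑ _v ∈ s, (1 / s.card : ℝ) = 1 := by
      rw [Finset.sum_const, nsmul_eq_mul]
      field_simp
    exact onCommonSide_of_pos_weights (fun v hv => vertex_mem_square hK hs hv)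
      (w := fun _ => 1 / s.card) (fun _ _ => by positivity) h1
      (h (Finset.mem_convexHull'.2 ⟨_, fun _ _ => by positivity, h1, rfl⟩))
  · rintro ⟨i, hi⟩ x hx
    refine mem_frontier_iff.2 ⟨face_subset_square hK hs hx, i, ?_⟩
    exact hi.imp (fun h => convexHull_subset_side h hx) fun h => convexHull_subset_side h hx

theorem OnCommonSide.mono {s t : Finset Plane} (h : OnCommonSide s) (hts : t ⊆ s) :
    OnCommonSide t :=
  h.imp fun _ h => h.imp (fun h v hv => h v (hts hv)) fun h v hv => h v (hts hv)

theorem card_le_two_of_onCommonSide {s : Finset Plane} (hs : s ∈ K.faces)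
    (h : OnCommonSide s) : s.card ≤ 2 := by
  classical
  by_contra hc
  have h3 : s.card = 3 := by have := card_le_three hs; omega
  obtain ⟨a, b, c, hab, hac, hbc, rfl⟩ := Finset.card_eq_three.1 h3
  refine orient_ne_zero hab hac hbc hs ?_
  obtain ⟨i, hi⟩ := h
  have h' : a i = b i ∧ a i = c i := by
    rcases hi with hi | hi <;> simp [hi]
  unfold orient
  fin_cases i
  · simp only [Fin.zero_eta] at h'
    rw [← h'.1, ← h'.2]
    ring
  · simp only [Fin.mk_one] at h'
    rw [← h'.1, ← h'.2]
    ring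

/-- Each face is in a triangle. -/
theorem exists_triangle_of_face (hK : IsTriangulation K) {s : Finset Plane} (hs : s ∈ K.faces) :
    ∃ t ∈ K.faces, t.card = 3 ∧ s ⊆ t := by
  have hne := SimplicialComplex.nonempty_of_mem_faces hs
  have hc : (0 : ℝ) < s.card := Nat.cast_pos.2 hne.card_pos
  have h1 : ∑ _v ∈ s, (1 / s.card : ℝ) = 1 := by
    rw [Finset.sum_const, nsmul_eq_mul]
    field_simp
  have hmem : ∑ v ∈ s, (1 / s.card : ℝ) • v ∈ convexHull ℝ (s : Set Plane) :=
    Finset.mem_convexHull'.2 ⟨_, fun _ _ => by positivity, h1, rfl⟩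
  obtain ⟨t, ht, ht3, hx, -⟩ := exists_triangle_near hK isOpen_interior interior_subset
    (closure_interior_unitSquare ▸ face_subset_square hK hs hmem)
  exact ⟨t, ht, ht3, subset_of_pos_weights hs ht (fun _ _ => by positivity) h1 hx⟩

/-! #### Triangles at an edge -/

/-- The midpoint is approached along the edge vector turned by a right angle, where `orient` is
positive. -/
theorem midpoint_mem_closure_side {a b : Plane} (hab : a ≠ b)
    (hm : midpoint ℝ a b ∈ interior unitSquare) :
    midpoint ℝ a b ∈ closure (interior unitSquare ∩ {x | 0 < orient a b x}) := by
  have hlim : Filter.Tendsto (fun ε : ℝ => midpoint ℝ a b + ε • !₂[-(b 1 - a 1), b 0 - a 0])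
      (nhdsWithin 0 (Set.Ioi 0)) (nhds (midpoint ℝ a b)) := by
    have : Continuous fun ε : ℝ => midpoint ℝ a b + ε • (!₂[-(b 1 - a 1), b 0 - a 0] : Plane) := by
      fun_prop
    have h0 := (this.tendsto 0).mono_left (nhdsWithin_le_nhds (s := Set.Ioi 0))
    simpa using h0
  refine mem_closure_of_tendsto hlim ?_
  filter_upwards [hlim (isOpen_interior.mem_nhds hm), self_mem_nhdsWithin] with ε hε hε0
  refine ⟨hε, ?_⟩
  have h2 : orient a b (midpoint ℝ a b + ε • !₂[-(b 1 - a 1), b 0 - a 0]) =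
      ε * ((b 0 - a 0) ^ 2 + (b 1 - a 1) ^ 2) := by
    simp only [midpoint_eq_smul_add, orient, PiLp.add_apply, PiLp.smul_apply, smul_eq_mul,
      invOf_eq_inv]
    simp
    ring
  have h3 : 0 < (b 0 - a 0) ^ 2 + (b 1 - a 1) ^ 2 := by
    by_contra hle
    have h4 := sq_nonneg (b 0 - a 0)
    have h5 := sq_nonneg (b 1 - a 1)
    have h6 : (b 0 - a 0) ^ 2 = 0 := by linarith
    have h7 : (b 1 - a 1) ^ 2 = 0 := by linarith
    exact hab (plane_ext (by linarith [pow_eq_zero_iff two_ne_zero |>.1 h6])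
      (by linarith [pow_eq_zero_iff two_ne_zero |>.1 h7]))
  rw [Set.mem_ofPred_eq, h2]
  exact mul_pos hε0 h3

theorem midpoint_mem_convexHull_pair [DecidableEq Plane] (a b : Plane) :
    midpoint ℝ a b ∈ convexHull ℝ ((({a, b} : Finset Plane)) : Set Plane) := by
  rw [Finset.coe_pair, convexHull_pair]
  exact midpoint_mem_segment a b

/-- Both sides of the edge are approached from within the square, so `exists_third_vertex` gives a
triangle on each side and `third_vertex_unique` allows no more. -/
theorem triangles_at_interior_edge (hK : IsTriangulation K) {e : Finset Plane} (he : e ∈ K.faces)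
    (he2 : e.card = 2) (hf : ¬ OnCommonSide e) :
    ∃ t t' : Finset Plane, t ≠ t' ∧ {t ∈ K.faces | t.card = 3 ∧ e ⊆ t} = {t, t'} := by
  classical
  obtain ⟨a, b, hab, rfl⟩ := Finset.card_eq_two.1 he2
  have hm : midpoint ℝ a b ∈ interior unitSquare := by
    by_contra hm
    refine hf (onCommonSide_of_pos_weights (fun v hv => vertex_mem_square hK he hv)
      (w := fun _ => 1 / 2) (fun _ _ => by norm_num) (by rw [Finset.sum_pair hab]; norm_num) ?_)
    rw [← midpoint_eq_sum hab, frontier, isClosed_unitSquare.closure_eq]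
    exact ⟨face_subset_square hK he (midpoint_mem_convexHull_pair a b), hm⟩
  have hO : ∀ a b : Plane, IsOpen (interior unitSquare ∩ {x | 0 < orient a b x}) := fun a b =>
    isOpen_interior.inter (isOpen_lt continuous_const (continuous_orient a b))
  obtain ⟨c, hac, hbc, hc, hcpos⟩ := exists_third_vertex hK hab he (hO a b)
    (Set.inter_subset_left.trans interior_subset) (midpoint_mem_closure_side hab hm)
    fun x hx => hx.2
  have he' : ({b, a} : Finset Plane) ∈ K.faces := by rwa [Finset.pair_comm]
  obtain ⟨d, hbd, had, hd, hdpos⟩ := exists_third_vertex hK hab.symm he' (hO b a)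
    (Set.inter_subset_left.trans interior_subset) (midpoint_mem_closure_side hab.symm
      (by rwa [midpoint_comm])) fun x hx => hx.2
  rw [orient_swap] at hdpos
  rw [Finset.insert_comm] at hd
  have hcd : c ≠ d := by rintro rfl; linarith
  refine ⟨{a, b, c}, {a, b, d}, ?_, ?_⟩
  · intro h
    have : c ∈ ({a, b, d} : Finset Plane) := h ▸ (by simp)
    simp [hac.symm, hbc.symm, hcd] at this
  · ext t
    simp only [Set.mem_ofPred_eq, Set.mem_insert_iff, Set.mem_singleton_iff]
    constructor
    · rintro ⟨ht, ht3, hsub⟩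
      obtain ⟨x, hax, hbx, rfl⟩ := exists_eq_triple hab ht3 hsub
      have hx0 := orient_ne_zero hab hax hbx ht
      rcases lt_or_gt_of_ne hx0 with h | h
      · rw [third_vertex_unique hab hax hbx had hbd ht hd (by nlinarith)]
        exact Or.inr rfl
      · rw [third_vertex_unique hab hax hbx hac hbc ht hc (by nlinarith)]
        exact Or.inl rfl
    · rintro (rfl | rfl)
      · exact ⟨hc, Finset.card_eq_three.2 ⟨a, b, c, hab, hac, hbc, rfl⟩, by
          intro x; simp only [Finset.mem_insert, Finset.mem_singleton]; tauto⟩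
      · exact ⟨hd, Finset.card_eq_three.2 ⟨a, b, d, hab, had, hbd, rfl⟩, by
          intro x; simp only [Finset.mem_insert, Finset.mem_singleton]; tauto⟩

/-- The square is on one side of the line through the edge, as the product inequality `hprod`
expresses, so only one triangle fits. -/
theorem triangles_at_frontier_edge (hK : IsTriangulation K) {e : Finset Plane} (he : e ∈ K.faces)
    (he2 : e.card = 2) (hf : OnCommonSide e) :
    ∃ t, {t ∈ K.faces | t.card = 3 ∧ e ⊆ t} = {t} := by
  classical
  obtain ⟨a, b, hab, rfl⟩ := Finset.card_eq_two.1 he2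
  obtain ⟨t, ht, ht3, hsub⟩ := exists_triangle_of_face hK he
  obtain ⟨c, hac, hbc, rfl⟩ := exists_eq_triple hab ht3 hsub
  have hprod : ∀ x y : Plane, x ∈ unitSquare → y ∈ unitSquare →
      0 ≤ orient a b x * orient a b y := by
    intro x y hx hy
    obtain ⟨i, hi⟩ := hf
    have key : ∀ β : ℝ, a i = β → b i = β → 0 ≤ (x i - β) * (y i - β) →
        0 ≤ orient a b x * orient a b y := by
      rintro β h1 h2 h3
      fin_cases i
      · simp only [Fin.zero_eta] at h1 h2 h3
        have : orient a b x * orient a b y = (b 1 - a 1) ^ 2 * ((x 0 - β) * (y 0 - β)) := by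
          simp only [orient, h1, h2]
          ring
        rw [this]
        positivity
      · simp only [Fin.mk_one] at h1 h2 h3
        have : orient a b x * orient a b y = (b 0 - a 0) ^ 2 * ((x 1 - β) * (y 1 - β)) := by
          simp only [orient, h1, h2]
          ring
        rw [this]
        positivity
    rcases hi with hi | hi
    · exact key 0 (hi a (by simp)) (hi b (by simp)) (by
        rw [sub_zero, sub_zero]; exact mul_nonneg (hx i).1 (hy i).1)
    · exact key 1 (hi a (by simp)) (hi b (by simp))
        (mul_nonneg_of_nonpos_of_nonpos (by linarith [(hx i).2]) (by linarith [(hy i).2]))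
  refine ⟨{a, b, c}, ?_⟩
  ext t
  simp only [Set.mem_ofPred_eq, Set.mem_singleton_iff]
  constructor
  · rintro ⟨ht', ht3', hsub'⟩
    obtain ⟨x, hax, hbx, rfl⟩ := exists_eq_triple hab ht3' hsub'
    have h1 := orient_ne_zero hab hax hbx ht'
    have h2 := orient_ne_zero hab hac hbc ht
    rw [third_vertex_unique hab hax hbx hac hbc ht' ht (lt_of_le_of_ne
      (hprod x c (vertex_mem_square hK ht' (by simp)) (vertex_mem_square hK ht (by simp)))
      (mul_ne_zero h1 h2).symm)]
  · rintro rfl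
    exact ⟨ht, ht3, hsub⟩

/-! #### Connectedness -/

/-- Two points are joined by a broken line through a point `w` off the finitely many lines that join
them to points of `F`; these lines have measure zero. -/
theorem isPreconnected_convex_diff_finite {U F : Set Plane} (hU : Convex ℝ U) (hUo : IsOpen U)
    (hF : F.Finite) : IsPreconnected (U \ F) := by
  classical
  refine isPreconnected_of_forall_pair fun x hx y hy => ?_
  have hnull : volume (⋃ v ∈ F, ((affineSpan ℝ (({x, v} : Finset Plane) : Set Plane) : Set Plane) ∪
      (affineSpan ℝ (({y, v} : Finset Plane) : Set Plane) : Set Plane))) = 0 :=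
    (measure_biUnion_null_iff hF.countable).2 fun v _ => measure_union_null
      (volume_affineSpan_eq_zero Finset.card_le_two) (volume_affineSpan_eq_zero Finset.card_le_two)
  obtain ⟨w, hwU, hw⟩ : ∃ w ∈ U, w ∉ ⋃ v ∈ F,
      ((affineSpan ℝ (({x, v} : Finset Plane) : Set Plane) : Set Plane) ∪
      (affineSpan ℝ (({y, v} : Finset Plane) : Set Plane) : Set Plane)) := by
    by_contra! hsub
    exact (hUo.measure_pos volume ⟨x, hx.1⟩).ne' (measure_mono_null hsub hnull)
  have hseg : ∀ z ∈ U \ F, (∀ v ∈ F, w ∉ affineSpan ℝ (({z, v} : Finset Plane) : Set Plane)) →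
      segment ℝ z w ⊆ U \ F := by
    intro z hz hzw p hp
    refine ⟨hU.segment_subset hz.1 hwU hp, fun hpF => hzw p hpF ?_⟩
    obtain ⟨α, β, hα, hβ, hαβ, rfl⟩ := hp
    have hβ0 : β ≠ 0 := by
      rintro rfl
      rw [add_zero] at hαβ
      subst hαβ
      exact hz.2 (by simpa using hpF)
    have : w = AffineMap.lineMap z (α • z + β • w) (1 / β) := by
      rw [AffineMap.lineMap_apply, vsub_eq_sub, vadd_eq_add]
      have : α = 1 - β := by linarith
      subst this
      match_scalars
      · field_simp
      · field_simp
        ring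
    have hmem := AffineMap.lineMap_mem_affineSpan_pair (1 / β) z (α • z + β • w)
    rw [← this] at hmem
    simpa using hmem
  refine ⟨segment ℝ x w ∪ segment ℝ y w, Set.union_subset (hseg x hx ?_) (hseg y hy ?_),
    Or.inl (left_mem_segment ℝ x w), Or.inr (left_mem_segment ℝ y w), ?_⟩
  · exact fun v hv h => hw (Set.mem_iUnion₂.2 ⟨v, hv, Or.inl h⟩)
  · exact fun v hv h => hw (Set.mem_iUnion₂.2 ⟨v, hv, Or.inr h⟩)
  · exact IsPreconnected.union w (right_mem_segment ℝ x w) (right_mem_segment ℝ y w)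
      (convex_segment x w).isPreconnected (convex_segment y w).isPreconnected

/-- The triangles are connected through interior edges. -/
theorem triangles_connected (hK : IsTriangulation K) {X : Set (Finset Plane)}
    (hX : X ⊆ ofCard K.faces 3) (hne : X.Nonempty)
    (hadj : ∀ e ∈ K.faces, e.card = 2 → ¬ OnCommonSide e → ∀ t ∈ ofCard K.faces 3,
      ∀ t' ∈ ofCard K.faces 3, e ⊆ t → e ⊆ t' → t ∈ X → t' ∈ X) : X = ofCard K.faces 3 := by
  classical
  refine hX.antisymm fun t₁ ht₁ => ?_
  by_contra ht₁X
  obtain ⟨t₀, ht₀⟩ := hne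
  have hfin3 : (ofCard K.faces 3).Finite := hK.1.subset (Set.sep_subset _ _)
  have hVfin : K.vertices.Finite := by
    refine Set.Finite.of_finite_image (hK.1.subset ?_)
      (Finset.singleton_injective.injOn (s := K.vertices))
    rintro _ ⟨v, hv, rfl⟩
    exact hv
  -- The open square without the vertices stays connected, so a triangle of `X` and one of the
  -- others share a point of it. This point is neither a vertex nor on the boundary, so the
  -- triangles share an interior edge.
  have hpre := isPreconnected_convex_diff_finite convex_interior_unitSquare isOpen_interior hVfin
  have hmeet : ∀ t ∈ ofCard K.faces 3,
      ((interior unitSquare \ K.vertices) ∩ convexHull ℝ (t : Set Plane)).Nonempty := by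
    intro t ht
    obtain ⟨a, b, c, hab, hac, hbc, rfl⟩ := Finset.card_eq_three.1 ht.2
    have h1 : ∑ _v ∈ ({a, b, c} : Finset Plane), (1 / 3 : ℝ) = 1 := by
      rw [sum_triple hab hac hbc]; norm_num
    have hmem : ∑ v ∈ ({a, b, c} : Finset Plane), (1 / 3 : ℝ) • v ∈
        convexHull ℝ (({a, b, c} : Finset Plane) : Set Plane) :=
      Finset.mem_convexHull'.2 ⟨_, fun _ _ => by norm_num, h1, rfl⟩
    refine ⟨_, ⟨?_, fun hv => ?_⟩, hmem⟩
    · by_contra hint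
      have := card_le_two_of_onCommonSide ht.1 (onCommonSide_of_pos_weights
        (fun v hv => vertex_mem_square hK ht.1 hv) (fun _ _ => by norm_num) h1 (by
          rw [frontier, isClosed_unitSquare.closure_eq]
          exact ⟨face_subset_square hK ht.1 hmem, hint⟩))
      rw [ht.2] at this
      omega
    · have := subset_of_pos_weights ht.1 hv (fun _ _ => by norm_num) h1 (by
        rw [Finset.coe_singleton, convexHull_singleton]; rfl)
      have := Finset.card_le_card this
      rw [ht.2, Finset.card_singleton] at this
      omega
  obtain ⟨x, ⟨hxi, hxv⟩, hx0, hx1⟩ := isPreconnected_closed_iff.1 hpre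
    (⋃ t ∈ X, convexHull ℝ (t : Set Plane))
    (⋃ t ∈ ofCard K.faces 3 \ X, convexHull ℝ (t : Set Plane))
    ((hfin3.subset hX).isClosed_biUnion fun t _ => isClosed_face t)
    (hfin3.sdiff.isClosed_biUnion fun t _ => isClosed_face t)
    (by
      rintro y ⟨hy, -⟩
      obtain ⟨s, hs, hys⟩ := SimplicialComplex.mem_space_iff.1
        (show y ∈ K.space from hK.2 ▸ interior_subset hy)
      obtain ⟨t, ht, ht3, hst⟩ := exists_triangle_of_face hK hs
      have hyt := convexHull_mono (𝕜 := ℝ) (Finset.coe_subset.2 hst) hys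
      by_cases htX : t ∈ X
      · exact Or.inl (Set.mem_iUnion₂.2 ⟨t, htX, hyt⟩)
      · exact Or.inr (Set.mem_iUnion₂.2 ⟨t, ⟨⟨ht, ht3⟩, htX⟩, hyt⟩))
    ((hmeet t₀ (hX ht₀)).mono fun y hy =>
      ⟨hy.1, Set.mem_iUnion₂.2 ⟨t₀, ht₀, hy.2⟩⟩)
    ((hmeet t₁ ht₁).mono fun y hy =>
      ⟨hy.1, Set.mem_iUnion₂.2 ⟨t₁, ⟨ht₁, ht₁X⟩, hy.2⟩⟩)
  obtain ⟨t, ht, hxt⟩ := Set.mem_iUnion₂.1 hx0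
  obtain ⟨t', ht', hxt'⟩ := Set.mem_iUnion₂.1 hx1
  have htt : t ≠ t' := by
    rintro rfl
    exact ht'.2 ht
  have hxe := K.inter_subset_convexHull (hX ht).1 ht'.1.1 ⟨hxt, hxt'⟩
  rw [← Finset.coe_inter] at hxe
  have hene : (t ∩ t').Nonempty := by
    rw [← Finset.coe_nonempty]
    exact convexHull_nonempty_iff.1 ⟨x, hxe⟩
  have heK := K.down_closed (hX ht).1 Finset.inter_subset_left hene
  have hcard : (t ∩ t').card < 3 := by
    rw [← (hX ht).2]
    refine Finset.card_lt_card ⟨Finset.inter_subset_left, fun h => htt ?_⟩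
    exact Finset.eq_of_subset_of_card_le (h.trans Finset.inter_subset_right)
      (by rw [(hX ht).2, ht'.1.2])
  have hpos := hene.card_pos
  have hcard2 : (t ∩ t').card = 2 := by
    by_contra h2
    obtain ⟨v, hv⟩ := Finset.card_eq_one.1 (show (t ∩ t').card = 1 by omega)
    rw [hv] at hxe heK
    rw [Finset.coe_singleton, convexHull_singleton] at hxe
    exact hxv (hxe ▸ heK)
  have hside : ¬ OnCommonSide (t ∩ t') := fun h => by
    have := (face_subset_frontier_iff hK heK).2 h hxe
    exact this.2 hxi
  exact ht'.2 (hadj _ heK hcard2 hside t (hX ht) t' ht'.1 Finset.inter_subset_left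
    Finset.inter_subset_right ht)

/-- The vertices of a complex with connected space are joined by edge paths. -/
theorem linked_of_isPreconnected [DecidableEq Plane] {S : Set (Finset Plane)} (hS : S.Finite)
    (hSK : S ⊆ K.faces) (hSd : ∀ s ∈ S, ∀ t ⊆ s, t.Nonempty → t ∈ S)
    (hconn : IsPreconnected (⋃ s ∈ S, convexHull ℝ (s : Set Plane))) {u v : Plane}
    (hu : {u} ∈ S) (hv : {v} ∈ S) : Linked S u v := by
  by_contra hno
  -- Faces with a vertex linked to `u` and faces with a vertex not linked to it have no vertex in
  -- common, so their unions would be disjoint closed sets covering the space.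
  set A : Set (Finset Plane) := {s ∈ S | ∃ x ∈ s, Linked S u x}
  set B : Set (Finset Plane) := {s ∈ S | ∃ x ∈ s, ¬ Linked S u x}
  have hAB : ∀ s ∈ A, ∀ t ∈ B, Disjoint s t := by
    have hstep : ∀ s ∈ S, ∀ x ∈ s, ∀ y ∈ s, Linked S u x → Linked S u y := by
      intro s hs x hx y hy hl
      by_cases hxy : x = y
      · exact hxy ▸ hl
      · exact hl.trans (Linked.single hxy (hSd s hs _ (by
          intro z hz
          simp only [Finset.mem_insert, Finset.mem_singleton] at hz
          rcases hz with rfl | rfl <;> assumption) (by simp)))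
    rintro s ⟨hs, x, hx, hlx⟩ t ⟨ht, y, hy, hly⟩
    rw [Finset.disjoint_left]
    intro z hzs hzt
    exact hly (hstep t ht z hzt y hy (hstep s hs x hx z hzs hlx))
  obtain ⟨p, -, hpA, hpB⟩ := isPreconnected_closed_iff.1 hconn
    (⋃ s ∈ A, convexHull ℝ (s : Set Plane)) (⋃ s ∈ B, convexHull ℝ (s : Set Plane))
    ((hS.subset (Set.sep_subset _ _)).isClosed_biUnion fun t _ => isClosed_face t)
    ((hS.subset (Set.sep_subset _ _)).isClosed_biUnion fun t _ => isClosed_face t)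
    (by
      intro y hy
      obtain ⟨s, hs, hys⟩ := Set.mem_iUnion₂.1 hy
      obtain ⟨x, hx⟩ := SimplicialComplex.nonempty_of_mem_faces (hSK hs)
      by_cases hl : Linked S u x
      · exact Or.inl (Set.mem_iUnion₂.2 ⟨s, ⟨hs, x, hx, hl⟩, hys⟩)
      · exact Or.inr (Set.mem_iUnion₂.2 ⟨s, ⟨hs, x, hx, hl⟩, hys⟩))
    ⟨u, Set.mem_iUnion₂.2 ⟨{u}, hu, by simp⟩,
      Set.mem_iUnion₂.2 ⟨{u}, ⟨hu, u, by simp, .refl⟩, by simp⟩⟩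
    ⟨v, Set.mem_iUnion₂.2 ⟨{v}, hv, by simp⟩,
      Set.mem_iUnion₂.2 ⟨{v}, ⟨hv, v, by simp, hno⟩, by simp⟩⟩
  obtain ⟨s, hs, hps⟩ := Set.mem_iUnion₂.1 hpA
  obtain ⟨t, ht, hpt⟩ := Set.mem_iUnion₂.1 hpB
  have := K.inter_subset_convexHull (hSK hs.1) (hSK ht.1) ⟨hps, hpt⟩
  rw [← Finset.coe_inter, Finset.disjoint_iff_inter_eq_empty.1 (hAB s hs t ht),
    Finset.coe_empty, convexHull_empty] at this
  exact this

end Square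

end GraphReconstruction

namespace GraphReconstruction

/-! ### Cycles bound -/

section Reduction

variable {V : Type*} [DecidableEq V]

theorem boundary_triple {p b d : V} (hpb : p ≠ b) (hpd : p ≠ d) (hbd : b ≠ d) :
    boundary {({p, b, d} : Finset V)} = {{b, d}} ∆ ({{p, b}} ∆ {{p, d}}) := by
  have h3 : ({p, b, d} : Finset V).card = 3 := Finset.card_eq_three.2 ⟨p, b, d, hpb, hpd, hbd, rfl⟩
  have n1 : ({p, b} : Finset V) ≠ {p, d} := fun h => by
    have : b ∈ ({p, d} : Finset V) := h ▸ (by simp)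
    simp [hpb.symm, hbd] at this
  have n2 : ({b, d} : Finset V) ≠ {p, b} := fun h => by
    have : p ∈ ({b, d} : Finset V) := h ▸ (by simp)
    simp [hpb, hpd] at this
  have n3 : ({b, d} : Finset V) ≠ {p, d} := fun h => by
    have : p ∈ ({b, d} : Finset V) := h ▸ (by simp)
    simp [hpb, hpd] at this
  have hmem : ∀ s : Finset V, s ∈ boundary {({p, b, d} : Finset V)} ↔
      s = {b, d} ∨ s = {p, b} ∨ s = {p, d} := by
    intro s
    rw [mem_boundary_singleton, h3]
    constructor
    · rintro ⟨-, hs, hc⟩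
      have h1 : (({p, b, d} : Finset V) \ s).card = 1 := by
        rw [Finset.card_sdiff_of_subset hs, h3]
        omega
      obtain ⟨x, hx⟩ := Finset.card_eq_one.1 h1
      have hs' : s = ({p, b, d} : Finset V) \ {x} := by
        rw [← hx, Finset.sdiff_sdiff_eq_self hs]
      have hxm : x ∈ ({p, b, d} : Finset V) := by
        have : x ∈ ({p, b, d} : Finset V) \ s := by rw [hx]; simp
        exact (Finset.mem_sdiff.1 this).1
      simp only [Finset.mem_insert, Finset.mem_singleton] at hxm
      rcases hxm with rfl | rfl | rfl
      · left
        rw [hs']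
        ext y
        simp only [Finset.mem_sdiff, Finset.mem_insert, Finset.mem_singleton]
        grind
      · right; right
        rw [hs']
        ext y
        simp only [Finset.mem_sdiff, Finset.mem_insert, Finset.mem_singleton]
        grind
      · right; left
        rw [hs']
        ext y
        simp only [Finset.mem_sdiff, Finset.mem_insert, Finset.mem_singleton]
        grind
    · rintro (rfl | rfl | rfl)
      · exact ⟨by simp, by intro y; simp; tauto, by rw [Finset.card_pair hbd]⟩
      · exact ⟨by simp, by intro y; simp; tauto, by rw [Finset.card_pair hpb]⟩
      · exact ⟨by simp, by intro y; simp; tauto, by rw [Finset.card_pair hpd]⟩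
  ext s
  rw [hmem]
  simp only [Set.mem_symmDiff, Set.mem_singleton_iff]
  constructor
  · rintro (rfl | rfl | rfl)
    · simp [n2, n3]
    · simp [n1, n2.symm]
    · simp [n1.symm, n3.symm]
  · tauto

/-- The triangles over a path in the link of `p`. -/
theorem Linked.exists_fan {Λ : Set (Finset V)} {p a b : V} (hΛ : ∀ e ∈ Λ, p ∉ e)
    (h : Linked Λ a b) : ∃ Y ⊆ {t | ∃ e ∈ Λ, t = insert p e}, Y.Finite ∧
      (∀ t ∈ Y, p ∈ t ∧ t.card = 3) ∧ ∃ C ⊆ Λ, boundary Y = C ∆ ({{p, a}} ∆ {{p, b}}) := by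
  induction h with
  | refl =>
    exact ⟨∅, Set.empty_subset _, Set.finite_empty, by simp, ∅, Set.empty_subset _, by
      simp [symmDiff_self]⟩
  | @tail b d _ hbd ih =>
    obtain ⟨Y, hY, hYf, hY3, C, hC, hb⟩ := ih
    have hpb : p ≠ b := fun h => hΛ _ hbd.2 (by simp [h])
    have hpd : p ≠ d := fun h => hΛ _ hbd.2 (by simp [h])
    refine ⟨Y ∆ {{p, b, d}}, symmDiff_subset hY ?_, hYf.symmDiff (Set.finite_singleton _), ?_,
      C ∆ {{b, d}}, symmDiff_subset hC (by simpa using hbd.2), ?_⟩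
    · rintro t rfl
      exact ⟨{b, d}, hbd.2, rfl⟩
    · rintro t (ht | ht)
      · exact hY3 t ht.1
      · rw [Set.mem_singleton_iff.1 ht.1]
        exact ⟨by simp, Finset.card_eq_three.2 ⟨p, b, d, hpb, hpd, hbd.1, rfl⟩⟩
    · rw [boundary_symmDiff hYf (Set.finite_singleton _), hb, boundary_triple hpb hpd hbd.1]
      rw [symmDiff_symmDiff_symmDiff_comm]
      congr 1
      rw [symmDiff_assoc, symmDiff_symmDiff_cancel_left]

/-- A cycle can be pushed off a vertex `p` whose edges end in one component of a part `Λ` of the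
link of `p`. -/
theorem exists_reduction {Λ z : Set (Finset V)} {p : V} (hΛ : ∀ e ∈ Λ, p ∉ e)
    (hz : z.Finite) (hz2 : ∀ e ∈ z, e.card = 2) (hb : boundary z = ∅)
    (hl : ∀ a b, {p, a} ∈ z → {p, b} ∈ z → Linked Λ a b) :
    ∃ Y ⊆ {t | ∃ e ∈ Λ, t = insert p e}, Y.Finite ∧ (∀ t ∈ Y, t.card = 3) ∧
      ∀ e ∈ z ∆ boundary Y, p ∉ e ∧ (e ∈ z ∨ e ∈ Λ) := by
  induction hn : {e ∈ z | p ∈ e}.ncard using Nat.strong_induction_on generalizing z with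
  | _ n ih =>
    have hpf : {e ∈ z | p ∈ e}.Finite := hz.subset (Set.sep_subset _ _)
    by_cases hex : ∃ e ∈ z, p ∈ e
    · obtain ⟨e, he, hpe⟩ := hex
      have heq : {τ ∈ z | ({p} : Finset V) ⊆ τ ∧ τ.card = ({p} : Finset V).card + 1} =
          {e ∈ z | p ∈ e} := by
        ext τ
        simp only [Set.mem_ofPred_eq, Finset.singleton_subset_iff, Finset.card_singleton]
        exact ⟨fun h => ⟨h.1, h.2.1⟩, fun h => ⟨h.1, h.2, hz2 τ h.1⟩⟩
      have heven : ¬ Odd {e ∈ z | p ∈ e}.ncard := by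
        intro hodd
        have : {p} ∈ boundary z := ⟨by simp, by rw [heq]; exact hodd⟩
        rw [hb] at this
        exact this
      -- A cycle has an even number of edges at `p`, so there is a second one.
      obtain ⟨e', he', hne⟩ : ∃ e' ∈ {e ∈ z | p ∈ e}, e' ≠ e := by
        by_contra! hall
        refine heven ?_
        have : {e ∈ z | p ∈ e} = {e} := by
          ext x
          exact ⟨fun hx => hall x hx, fun hx => by rw [Set.mem_singleton_iff.1 hx]; exact ⟨he, hpe⟩⟩
        rw [this, Set.ncard_singleton]
        exact odd_one
      have hother : ∀ e ∈ z, p ∈ e → ∃ a, e = {p, a} := by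
        intro e he hpe
        obtain ⟨x, y, hxy, rfl⟩ := Finset.card_eq_two.1 (hz2 e he)
        simp only [Finset.mem_insert, Finset.mem_singleton] at hpe
        rcases hpe with rfl | rfl
        · exact ⟨y, rfl⟩
        · exact ⟨x, Finset.pair_comm _ _⟩
      obtain ⟨a, rfl⟩ := hother e he hpe
      obtain ⟨b, rfl⟩ := hother e' he'.1 he'.2
      -- The fan over a path in the link has only `{p, a}` and `{p, b}` as boundary edges at `p`.
      -- Adding its boundary removes these two from the cycle and creates no other edge at `p`.
      obtain ⟨Y, hY, hYf, hY3, C, hC, hYb⟩ := (hl a b he he'.1).exists_fan hΛ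
      have hbYf := boundary_finite hYf
      have hmem : ∀ e ∈ z ∆ boundary Y, e ∈ z ∨ e ∈ Λ := by
        intro e hez
        rw [hYb] at hez
        by_cases h1 : e = {p, a} ∨ e = {p, b}
        · rcases h1 with rfl | rfl
          · exact Or.inl he
          · exact Or.inl he'.1
        · simp only [Set.mem_symmDiff, Set.mem_singleton_iff] at hez
          by_cases h2 : e ∈ C
          · exact Or.inr (hC h2)
          · left; tauto
      have hmemp : ∀ e, p ∈ e → (e ∈ z ∆ boundary Y ↔ e ∈ z ∧ e ≠ {p, a} ∧ e ≠ {p, b}) := by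
        intro e hpe
        have h2 : e ∉ C := fun h => hΛ e (hC h) hpe
        have h3 : e = {p, a} → e ∈ z := by rintro rfl; exact he
        have h4 : e = {p, b} → e ∈ z := by rintro rfl; exact he'.1
        have h5 : ¬ (e = {p, a} ∧ e = {p, b}) := fun h => hne (h.2.symm.trans h.1)
        rw [hYb]
        simp only [Set.mem_symmDiff, Set.mem_singleton_iff]
        tauto
      have hz2' : ∀ e ∈ z ∆ boundary Y, e.card = 2 := by
        rintro e (h | h)
        · exact hz2 e h.1
        · exact IsFilteredComplex.card_of_mem_boundary (fun t ht => (hY3 t ht).2) h.1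
      obtain ⟨Y', hY', hYf', hY3', hfin⟩ := ih _ (by
          rw [← hn]
          refine Set.ncard_lt_ncard ⟨?_, fun h => ?_⟩ hpf
          · exact fun e he => ⟨((hmemp e he.2).1 he.1).1, he.2⟩
          · have := h (show ({p, a} : Finset V) ∈ {e ∈ z | p ∈ e} from ⟨he, hpe⟩)
            exact ((hmemp _ this.2).1 this.1).2.1 rfl)
        (hz.symmDiff hbYf) hz2' (by
          rw [boundary_symmDiff hz hbYf, hb, boundary_boundary hYf, symmDiff_self]; rfl)
        (fun c d hc hd => hl c d ((hmemp _ (by simp)).1 hc).1 ((hmemp _ (by simp)).1 hd).1) rfl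
      refine ⟨Y ∆ Y', symmDiff_subset hY hY', hYf.symmDiff hYf', ?_, ?_⟩
      · rintro t (h | h)
        · exact (hY3 t h.1).2
        · exact hY3' t h.1
      · rw [boundary_symmDiff hYf hYf', ← symmDiff_assoc]
        intro e he
        refine ⟨(hfin e he).1, ?_⟩
        rcases (hfin e he).2 with h | h
        · exact hmem e h
        · exact Or.inr h
    · push Not at hex
      refine ⟨∅, Set.empty_subset _, Set.finite_empty, by simp, ?_⟩
      intro e he
      rw [boundary_empty] at he
      have he' : e ∈ z := by simpa [Set.mem_symmDiff] using he
      exact ⟨hex e he', Or.inl he'⟩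

end Reduction

/-! ### Filling cycles by descent in the lexicographic order. -/

section Descent

open Geometry

/-- The lexicographic order of the plane. -/
def LexLT (x y : Plane) : Prop := x 0 < y 0 ∨ (x 0 = y 0 ∧ x 1 < y 1)

theorem LexLT.irrefl {x : Plane} : ¬ LexLT x x := by
  rintro (h | h)
  · exact lt_irrefl _ h
  · exact lt_irrefl _ h.2

theorem LexLT.trans {x y z : Plane} (h : LexLT x y) (h' : LexLT y z) : LexLT x z := by
  rcases h with h | h <;> rcases h' with h' | h'
  · exact Or.inl (h.trans h')
  · exact Or.inl (h'.1 ▸ h)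
  · exact Or.inl (h.1.symm ▸ h')
  · exact Or.inr ⟨h.1.trans h'.1, h.2.trans h'.2⟩

theorem lexLT_or {x y : Plane} (h : x ≠ y) : LexLT x y ∨ LexLT y x := by
  rcases lt_trichotomy (x 0) (y 0) with h0 | h0 | h0
  · exact Or.inl (Or.inl h0)
  · rcases lt_trichotomy (x 1) (y 1) with h1 | h1 | h1
    · exact Or.inl (Or.inr ⟨h0, h1⟩)
    · exact absurd (plane_ext h0 h1) h
    · exact Or.inr (Or.inr ⟨h0.symm, h1⟩)
  · exact Or.inr (Or.inl h0)

theorem convex_lexLT (p : Plane) : Convex ℝ {x | LexLT x p} := by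
  rw [convex_iff_forall_pos]
  intro x hx y hy u v hu hv huv
  have hv' : v = 1 - u := by linarith
  subst hv'
  simp only [LexLT, Set.mem_ofPred_eq, PiLp.add_apply, PiLp.smul_apply, smul_eq_mul] at hx hy ⊢
  rcases hx with hx | ⟨hx, hx1⟩ <;> rcases hy with hy | ⟨hy, hy1⟩
  · left; nlinarith
  · left; nlinarith
  · left; nlinarith
  · right
    exact ⟨by rw [hx, hy]; ring, by nlinarith⟩

/-- By convexity, a face with a point below `p` has a vertex below `p`; this supplies the common
vertex in `lowerLink_linked`. -/
theorem convex_not_lexLT (p : Plane) : Convex ℝ {x | ¬ LexLT x p} := by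
  rw [convex_iff_forall_pos]
  intro x hx y hy u v hu hv huv
  have hv' : v = 1 - u := by linarith
  subst hv'
  simp only [LexLT, Set.mem_ofPred_eq, PiLp.add_apply, PiLp.smul_apply, smul_eq_mul, not_or,
    not_lt, not_and] at hx hy ⊢
  obtain ⟨hx0, hx1⟩ := hx
  obtain ⟨hy0, hy1⟩ := hy
  refine ⟨by nlinarith, fun h => ?_⟩
  have e1 : x 0 = p 0 := by nlinarith
  have e2 : y 0 = p 0 := by nlinarith
  have := hx1 e1
  have := hy1 e2
  nlinarith

variable {K : SimplicialComplex ℝ Plane}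

/-- The finitely many faces without `p` form a closed set that misses `p`. -/
theorem exists_ball_of_vertex (hK : IsTriangulation K) {p : Plane} (hp : p ∈ K.vertices) :
    ∃ δ > 0, ∀ s ∈ K.faces, ∀ x ∈ convexHull ℝ (s : Set Plane), dist x p < δ → p ∈ s := by
  have hcl : IsClosed (⋃ s ∈ {s ∈ K.faces | p ∉ s}, convexHull ℝ (s : Set Plane)) :=
    (hK.1.subset (Set.sep_subset _ _)).isClosed_biUnion fun t _ => isClosed_face t
  have hpc : p ∈ (⋃ s ∈ {s ∈ K.faces | p ∉ s}, convexHull ℝ (s : Set Plane))ᶜ := by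
    intro h
    obtain ⟨s, hs, hps⟩ := Set.mem_iUnion₂.1 h
    exact hs.2 ((SimplicialComplex.vertex_mem_convexHull_iff hp hs.1).1 hps)
  obtain ⟨δ, hδ, hball⟩ := Metric.isOpen_iff.1 hcl.isOpen_compl p hpc
  refine ⟨δ, hδ, fun s hs x hx hd => ?_⟩
  by_contra hps
  exact hball hd (Set.mem_iUnion₂.2 ⟨s, ⟨hs, hps⟩, hx⟩)

/-- The edges opposite to `p` in the triangles whose last vertex is `p`. -/
def lowerLink [DecidableEq Plane] (K : SimplicialComplex ℝ Plane) (p : Plane) :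
    Set (Finset Plane) :=
  {e | p ∉ e ∧ insert p e ∈ K.faces ∧ ∀ c ∈ e, LexLT c p}

/-- Points on the two edges close to `p` are joined by a segment that stays near `p`, in the square,
and below `p`. It is covered by triangles at `p`, and triangles that meet on it share a vertex below
`p`. Connectedness of the segment carries the link from `a` to `b`. -/
theorem lowerLink_linked [DecidableEq Plane] (hK : IsTriangulation K) {p a b : Plane}
    (ha : {p, a} ∈ K.faces) (hb : {p, b} ∈ K.faces) (hap : LexLT a p) (hbp : LexLT b p) :
    Linked (lowerLink K p) a b := by
  by_contra hno
  have hpv : p ∈ K.vertices := K.down_closed ha (by simp) (by simp)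
  obtain ⟨δ, hδ, hball⟩ := exists_ball_of_vertex hK hpv
  have hpa : p ≠ a := fun h => LexLT.irrefl (h ▸ hap)
  have hpb : p ≠ b := fun h => LexLT.irrefl (h ▸ hbp)
  obtain ⟨ε, hε0, hε1, hεa, hεb⟩ : ∃ ε : ℝ, 0 < ε ∧ ε < 1 ∧
      dist (AffineMap.lineMap p a ε) p < δ ∧ dist (AffineMap.lineMap p b ε) p < δ := by
    have h1 : 0 < 1 + dist p a + dist p b := by positivity
    refine ⟨min (1 / 2) (δ / (1 + dist p a + dist p b) / 2), by positivity,
      (min_le_left _ _).trans_lt (by norm_num), ?_, ?_⟩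
    all_goals
      rw [dist_lineMap_left, Real.norm_of_nonneg (by positivity)]
      have h2 : min (1 / 2) (δ / (1 + dist p a + dist p b) / 2) ≤
        δ / (1 + dist p a + dist p b) / 2 := min_le_right _ _
      have h3 : δ / (1 + dist p a + dist p b) * (1 + dist p a + dist p b) = δ := by field_simp
      have h4 : 0 < δ / (1 + dist p a + dist p b) := by positivity
      have h5 : 0 ≤ dist p a := dist_nonneg
      have h6 : 0 ≤ dist p b := dist_nonneg
      nlinarith
  set a' : Plane := AffineMap.lineMap p a ε with ha'
  set b' : Plane := AffineMap.lineMap p b ε with hb'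
  have hlow : ∀ c : Plane, LexLT c p → LexLT (AffineMap.lineMap p c ε) p := by
    intro c hc
    simp only [LexLT, AffineMap.lineMap_apply_module, PiLp.add_apply, PiLp.smul_apply,
      smul_eq_mul] at hc ⊢
    rcases hc with hc | ⟨h1, h2⟩
    · left; nlinarith
    · right; exact ⟨by rw [h1]; ring, by nlinarith⟩
  have hsum : ∀ c : Plane, p ≠ c → AffineMap.lineMap p c ε =
      ∑ v ∈ ({p, c} : Finset Plane), (if v = p then 1 - ε else ε) • v := by
    intro c hc
    rw [Finset.sum_pair hc, AffineMap.lineMap_apply_module]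
    simp [hc.symm]
  have hw0 : ∀ v : Plane, 0 < if v = p then 1 - ε else ε := by
    intro v
    split_ifs <;> linarith
  have hw1 : ∀ c : Plane, p ≠ c →
      ∑ v ∈ ({p, c} : Finset Plane), (if v = p then 1 - ε else ε) = 1 := by
    intro c hc
    rw [Finset.sum_pair hc]
    simp [hc.symm]
  have hedge : ∀ c : Plane, p ≠ c → AffineMap.lineMap p c ε ∈
      convexHull ℝ ((({p, c} : Finset Plane)) : Set Plane) := by
    intro c hc
    exact Finset.mem_convexHull'.2 ⟨_, fun v _ => (hw0 v).le, hw1 c hc, (hsum c hc).symm⟩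
  have hIs : segment ℝ a' b' ⊆ unitSquare := convex_unitSquare.segment_subset
    (face_subset_square hK ha (hedge a hpa)) (face_subset_square hK hb (hedge b hpb))
  have hIlow : segment ℝ a' b' ⊆ {x | LexLT x p} :=
    (convex_lexLT p).segment_subset (hlow a hap) (hlow b hbp)
  have hIball : segment ℝ a' b' ⊆ Metric.ball p δ :=
    (convex_ball p δ).segment_subset hεa hεb
  set Z : Set Plane := {c | Linked (lowerLink K p) a c} with hZ
  have hZlow : ∀ c ∈ Z, LexLT c p := by
    intro c hc
    rcases Relation.ReflTransGen.cases_tail hc with h | ⟨d, -, hd⟩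
    · exact h ▸ hap
    · exact hd.2.2.2 c (by simp)
  have hstep : ∀ t ∈ ofCard K.faces 3, p ∈ t → ∀ z ∈ t, z ∈ Z → ∀ c ∈ t, LexLT c p → c ∈ Z := by
    intro t ht hpt z hzt hz c hct hc
    by_cases hzc : z = c
    · exact hzc ▸ hz
    · have hpz : p ≠ z := fun h => LexLT.irrefl (h ▸ hZlow z hz)
      have hpc : p ≠ c := fun h => LexLT.irrefl (h ▸ hc)
      have hteq : insert p ({z, c} : Finset Plane) = t := Finset.eq_of_subset_of_card_le (by
        intro x hx
        simp only [Finset.mem_insert, Finset.mem_singleton] at hx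
        rcases hx with rfl | rfl | rfl <;> assumption)
        (by rw [ht.2, Finset.card_eq_three.2 ⟨p, z, c, hpz, hpc, hzc, rfl⟩])
      refine Linked.trans hz (Linked.single hzc ⟨by simp [hpz, hpc], hteq ▸ ht.1, ?_⟩)
      intro x hx
      simp only [Finset.mem_insert, Finset.mem_singleton] at hx
      rcases hx with rfl | rfl
      · exact hZlow x hz
      · exact hc
  have hcov : ∀ x ∈ segment ℝ a' b', ∃ t ∈ ofCard K.faces 3, p ∈ t ∧
      x ∈ convexHull ℝ (t : Set Plane) := by
    intro x hx
    obtain ⟨s, hs, hxs⟩ := SimplicialComplex.mem_space_iff.1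
      (show x ∈ K.space from hK.2 ▸ hIs hx)
    obtain ⟨t, ht, ht3, hst⟩ := exists_triangle_of_face hK hs
    exact ⟨t, ⟨ht, ht3⟩, hst (hball s hs x hxs (hIball hx)),
      convexHull_mono (Finset.coe_subset.2 hst) hxs⟩
  set A : Set (Finset Plane) := {t ∈ ofCard K.faces 3 | p ∈ t ∧ ∃ z ∈ t, z ∈ Z}
  set B : Set (Finset Plane) := {t ∈ ofCard K.faces 3 | p ∈ t ∧ ∀ z ∈ t, z ∉ Z}
  have hfin3 : (ofCard K.faces 3).Finite := hK.1.subset (Set.sep_subset _ _)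
  have hend : ∀ c : Plane, p ≠ c → {p, c} ∈ K.faces → ∀ t ∈ ofCard K.faces 3,
      AffineMap.lineMap p c ε ∈ convexHull ℝ (t : Set Plane) → c ∈ t := by
    intro c hc hcK t ht hct
    rw [hsum c hc] at hct
    exact subset_of_pos_weights hcK ht.1 (fun v _ => hw0 v) (hw1 c hc) hct (by simp)
  have hI : ∀ x ∈ segment ℝ a' b', x ∈ (⋃ t ∈ A, convexHull ℝ (t : Set Plane)) ∨
      x ∈ ⋃ t ∈ B, convexHull ℝ (t : Set Plane) := by
    intro x hx
    obtain ⟨t, ht, hpt, hxt⟩ := hcov x hx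
    by_cases h : ∃ z ∈ t, z ∈ Z
    · exact Or.inl (Set.mem_iUnion₂.2 ⟨t, ⟨ht, hpt, h⟩, hxt⟩)
    · push Not at h
      exact Or.inr (Set.mem_iUnion₂.2 ⟨t, ⟨ht, hpt, h⟩, hxt⟩)
  obtain ⟨x, hxI, hxA, hxB⟩ := isPreconnected_closed_iff.1
    (convex_segment a' b').isPreconnected
    (⋃ t ∈ A, convexHull ℝ (t : Set Plane)) (⋃ t ∈ B, convexHull ℝ (t : Set Plane))
    ((hfin3.subset (Set.sep_subset _ _)).isClosed_biUnion fun t _ => isClosed_face t)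
    ((hfin3.subset (Set.sep_subset _ _)).isClosed_biUnion fun t _ => isClosed_face t)
    hI
    (by
      refine ⟨a', left_mem_segment ℝ a' b', ?_⟩
      rcases hI a' (left_mem_segment ℝ a' b') with h | h
      · exact h
      · obtain ⟨t, ht, hat⟩ := Set.mem_iUnion₂.1 h
        exact absurd Linked.refl (ht.2.2 a (hend a hpa ha t ht.1 hat)))
    (by
      refine ⟨b', right_mem_segment ℝ a' b', ?_⟩
      rcases hI b' (right_mem_segment ℝ a' b') with h | h
      · obtain ⟨t, ht, hbt⟩ := Set.mem_iUnion₂.1 h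
        obtain ⟨z, hzt, hz⟩ := ht.2.2
        exact absurd (hstep t ht.1 ht.2.1 z hzt hz b (hend b hpb hb t ht.1 hbt) hbp) hno
      · exact h)
  obtain ⟨t, ht, hxt⟩ := Set.mem_iUnion₂.1 hxA
  obtain ⟨t', ht', hxt'⟩ := Set.mem_iUnion₂.1 hxB
  have hx := K.inter_subset_convexHull ht.1.1 ht'.1.1 ⟨hxt, hxt'⟩
  obtain ⟨c, hc, hcp⟩ : ∃ c ∈ (t : Set Plane) ∩ t', LexLT c p := by
    by_contra! hall
    exact convexHull_min hall (convex_not_lexLT p) hx (hIlow hxI)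
  obtain ⟨z, hzt, hz⟩ := ht.2.2
  exact ht'.2.2 c hc.2 (hstep t ht.1 ht.2.1 z hzt hz c hc.1 hcp)

/-- Every cycle in a triangulation of the square is a boundary. -/
theorem exists_filling (hK : IsTriangulation K) {z : Set (Finset Plane)}
    (hz : z ⊆ ofCard K.faces 2) (hb : boundary z = ∅) :
    ∃ X ⊆ ofCard K.faces 3, boundary X = z := by
  classical
  have hVfin : K.vertices.Finite := by
    refine Set.Finite.of_finite_image (hK.1.subset ?_)
      (Finset.singleton_injective.injOn (s := K.vertices))
    rintro _ ⟨v, hv, rfl⟩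
    exact hv
  have hbf : ∀ v, {u ∈ K.vertices | LexLT u v}.Finite := fun v =>
    hVfin.subset (Set.sep_subset _ _)
  have hlt : ∀ u ∈ K.vertices, ∀ v, LexLT u v →
      {w ∈ K.vertices | LexLT w u}.ncard < {w ∈ K.vertices | LexLT w v}.ncard := by
    intro u hu v huv
    refine Set.ncard_lt_ncard ⟨fun w hw => ⟨hw.1, hw.2.trans huv⟩, fun h => ?_⟩ (hbf v)
    exact LexLT.irrefl (h (show u ∈ {w ∈ K.vertices | LexLT w v} from ⟨hu, huv⟩)).2
  have hvert : ∀ e ∈ K.faces, ∀ v ∈ e, v ∈ K.vertices := fun e he v hv =>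
    K.down_closed he (Finset.singleton_subset_iff.2 hv) (by simp)
  -- Vertices are ranked by the number of vertices below them, and the induction is on a strict
  -- bound for the ranks on `z`. A vertex of the highest admitted rank is the last one of `z`, and
  -- the cycle is pushed off it through its lower link.
  suffices H : ∀ n : ℕ, ∀ z ⊆ ofCard K.faces 2, boundary z = ∅ →
      (∀ e ∈ z, ∀ v ∈ e, {w ∈ K.vertices | LexLT w v}.ncard < n) →
      ∃ X ⊆ ofCard K.faces 3, boundary X = z by
    refine H (K.vertices.ncard + 1) z hz hb fun e he v hv => Nat.lt_succ_of_le ?_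
    exact Set.ncard_le_ncard (Set.sep_subset _ _) hVfin
  intro n
  induction n with
  | zero =>
    intro z hz _ hn
    have : z = ∅ := by
      refine Set.eq_empty_iff_forall_notMem.2 fun e he => ?_
      obtain ⟨v, hv⟩ := SimplicialComplex.nonempty_of_mem_faces (hz he).1
      simpa using hn e he v hv
    exact ⟨∅, Set.empty_subset _, by rw [this, boundary_empty]⟩
  | succ n ih =>
    intro z hz hb hn
    have hzf : z.Finite := hK.1.subset fun e he => (hz he).1
    by_cases hex : ∃ e ∈ z, ∃ p ∈ e, {w ∈ K.vertices | LexLT w p}.ncard = n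
    · obtain ⟨e₀, he₀, p, hp, hpn⟩ := hex
      have hpV := hvert e₀ (hz he₀).1 p hp
      have hlow : ∀ e ∈ z, ∀ c ∈ e, c ≠ p → LexLT c p := by
        intro e he c hc hcp
        rcases lexLT_or hcp with h | h
        · exact h
        · have h1 := hlt p hpV c h
          have h2 := hn e he c hc
          omega
      obtain ⟨Y, hY, hYf, hY3, hfin⟩ := exists_reduction (Λ := lowerLink K p) (p := p)
        (fun e he => he.1) hzf (fun e he => (hz he).2) hb (by
          intro a b ha hb'
          have hpa : a ≠ p := by
            rintro rfl
            have := (hz ha).2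
            simp at this
          have hpb : b ≠ p := by
            rintro rfl
            have := (hz hb').2
            simp at this
          exact lowerLink_linked hK (hz ha).1 (hz hb').1 (hlow _ ha a (by simp) hpa)
            (hlow _ hb' b (by simp) hpb))
      have hYK : Y ⊆ ofCard K.faces 3 := by
        intro t ht
        obtain ⟨e, he, rfl⟩ := hY ht
        exact ⟨he.2.1, hY3 _ ht⟩
      have hbf' := boundary_finite hYf
      obtain ⟨X, hX, hXb⟩ := ih (z ∆ boundary Y) (by
          rintro e (h | h)
          · exact hz h.1
          · refine ⟨?_, IsFilteredComplex.card_of_mem_boundary (fun t ht => (hYK ht).2) h.1⟩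
            obtain ⟨t, ht, het, -⟩ := exists_mem_of_mem_boundary h.1
            exact K.down_closed (hYK ht).1 het h.1.1)
        (by rw [boundary_symmDiff hzf hbf', hb, boundary_boundary hYf, symmDiff_self]; rfl)
        (by
          intro e he v hv
          have hvp : LexLT v p := by
            rcases (hfin e he).2 with h | h
            · exact hlow e h v hv (by rintro rfl; exact (hfin e he).1 hv)
            · exact h.2.2 v hv
          have hvV : v ∈ K.vertices := by
            rcases (hfin e he).2 with h | h
            · exact hvert e (hz h).1 v hv
            · exact hvert _ h.2.1 v (Finset.mem_insert_of_mem hv)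
          rw [← hpn]
          exact hlt v hvV p hvp)
      refine ⟨X ∆ Y, symmDiff_subset hX hYK, ?_⟩
      rw [boundary_symmDiff (hK.1.subset fun t ht => (hX ht).1) hYf, hXb, symmDiff_assoc,
        symmDiff_self, symmDiff_bot]
    · push Not at hex
      refine ih z hz hb fun e he v hv => ?_
      have h1 := hn e he v hv
      have h2 := hex e he v hv
      omega

end Descent

end GraphReconstruction

namespace GraphReconstruction

/-! ### The boundary of the square -/

section Frontier

open Geometry

variable {K : SimplicialComplex ℝ Plane}

/-- The simplices of `K` on the boundary of the square. -/
def frontierFaces (K : SimplicialComplex ℝ Plane) : Set (Finset Plane) :=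
  {σ ∈ K.faces | OnCommonSide σ}

theorem frontierFaces_down {s t : Finset Plane} (hs : s ∈ frontierFaces K) (hts : t ⊆ s)
    (ht : t.Nonempty) : t ∈ frontierFaces K :=
  ⟨K.down_closed hs.1 hts ht, hs.2.mono hts⟩

/-- For a boundary point, the vertices with positive weight span a face, and by
`onCommonSide_of_pos_weights` they are on one side of the square. -/
theorem iUnion_frontierFaces (hK : IsTriangulation K) :
    ⋃ s ∈ frontierFaces K, convexHull ℝ (s : Set Plane) = frontier unitSquare := by
  classical
  apply Set.Subset.antisymm
  · exact Set.iUnion₂_subset fun s hs => (face_subset_frontier_iff hK hs.1).2 hs.2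
  · intro x hx
    have hxK : x ∈ K.space := hK.2 ▸ isClosed_unitSquare.frontier_subset hx
    obtain ⟨s, hs, hxs⟩ := SimplicialComplex.mem_space_iff.1 hxK
    obtain ⟨w, h0, h1, rfl⟩ := Finset.mem_convexHull'.1 hxs
    have e1 : ∑ v ∈ s.filter (0 < w ·), w v = 1 := by
      rw [← h1]
      refine Finset.sum_subset (Finset.filter_subset _ _) fun v hv hv' => ?_
      by_contra hne
      exact hv' (Finset.mem_filter.2 ⟨hv, lt_of_le_of_ne (h0 v hv) (Ne.symm hne)⟩)
    have e2 : ∑ v ∈ s.filter (0 < w ·), w v • v = ∑ v ∈ s, w v • v := by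
      refine Finset.sum_subset (Finset.filter_subset _ _) fun v hv hv' => ?_
      have : w v = 0 := by
        by_contra hne
        exact hv' (Finset.mem_filter.2 ⟨hv, lt_of_le_of_ne (h0 v hv) (Ne.symm hne)⟩)
      rw [this, zero_smul]
    have hne : (s.filter (0 < w ·)).Nonempty := by
      rw [Finset.nonempty_iff_ne_empty]
      intro h
      rw [h] at e1
      simp at e1
    have hmem := K.down_closed hs (Finset.filter_subset (0 < w ·) s) hne
    rw [← e2] at hx ⊢
    refine Set.mem_biUnion (x := s.filter (0 < w ·)) ⟨hmem, onCommonSide_of_pos_weights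
      (fun v hv => vertex_mem_square hK hmem hv) (fun v hv => (Finset.mem_filter.1 hv).2) e1 hx⟩ ?_
    exact Finset.mem_convexHull'.2 ⟨w, fun v hv => (Finset.mem_filter.1 hv).2.le, e1, rfl⟩

/-- The four sides are convex and are chained together at three corners. -/
theorem isPreconnected_frontier : IsPreconnected (frontier unitSquare) := by
  have hside : ∀ (i : Fin 2) (b : ℝ), IsPreconnected {x | x ∈ unitSquare ∧ x i = b} := by
    intro i b
    have hconv : Convex ℝ {x : Plane | x i = b} := by
      intro x hx y hy u v _ _ huv
      simp only [Set.mem_ofPred_eq, PiLp.add_apply, PiLp.smul_apply, smul_eq_mul] at hx hy ⊢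
      rw [hx, hy, ← add_mul, huv, one_mul]
    exact (convex_unitSquare.inter hconv).isPreconnected
  have hcorner : ∀ a b : ℝ, (a = 0 ∨ a = 1) → (b = 0 ∨ b = 1) →
      (!₂[a, b] : Plane) ∈ unitSquare := by
    rintro a b (rfl | rfl) (rfl | rfl) i <;> fin_cases i <;> simp
  have h1 := IsPreconnected.union (!₂[0, 0] : Plane)
    (by exact ⟨hcorner 0 0 (by simp) (by simp), by simp⟩)
    (by exact ⟨hcorner 0 0 (by simp) (by simp), by simp⟩) (hside 0 0) (hside 1 0)
  have h2 := IsPreconnected.union (!₂[1, 0] : Plane)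
    (Or.inr (by exact ⟨hcorner 1 0 (by simp) (by simp), by simp⟩))
    (by exact ⟨hcorner 1 0 (by simp) (by simp), by simp⟩) h1 (hside 0 1)
  have h3 := IsPreconnected.union (!₂[1, 1] : Plane)
    (Or.inr (by exact ⟨hcorner 1 1 (by simp) (by simp), by simp⟩))
    (by exact ⟨hcorner 1 1 (by simp) (by simp), by simp⟩) h2 (hside 1 1)
  convert h3 using 1
  ext x
  simp only [mem_frontier_iff, Fin.exists_fin_two, Set.mem_union, Set.mem_ofPred_eq]
  tauto

theorem frontierFaces_linked [DecidableEq Plane] (hK : IsTriangulation K) {u v : Plane}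
    (hu : {u} ∈ frontierFaces K) (hv : {v} ∈ frontierFaces K) : Linked (frontierFaces K) u v :=
  linked_of_isPreconnected (hK.1.subset (Set.sep_subset _ _)) (Set.sep_subset _ _)
    (fun _ hs _ hts ht => frontierFaces_down hs hts ht)
    (iUnion_frontierFaces hK ▸ isPreconnected_frontier) hu hv

theorem faces_linked [DecidableEq Plane] (hK : IsTriangulation K) {u v : Plane}
    (hu : {u} ∈ K.faces) (hv : {v} ∈ K.faces) : Linked K.faces u v :=
  linked_of_isPreconnected hK.1 subset_rfl (fun _ hs _ hts ht => K.down_closed hs hts ht)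
    (by
      have : ⋃ s ∈ K.faces, convexHull ℝ (s : Set Plane) = unitSquare := hK.2
      rw [this]
      exact convex_unitSquare.isPreconnected) hu hv

/-- Otherwise every boundary face would be `{v}`, and two opposite corners would coincide. -/
theorem exists_frontier_vertex_ne (hK : IsTriangulation K) (v : Plane) :
    ∃ u, u ≠ v ∧ {u} ∈ frontierFaces K := by
  by_contra! hno
  have hcorner : ∀ c : ℝ, c = 0 ∨ c = 1 → (!₂[c, c] : Plane) = v := by
    intro c hc
    have hx : (!₂[c, c] : Plane) ∈ frontier unitSquare := by
      rw [mem_frontier_iff]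
      refine ⟨?_, 0, by simpa using hc⟩
      rcases hc with rfl | rfl <;> intro i <;> fin_cases i <;> simp
    rw [← iUnion_frontierFaces hK] at hx
    obtain ⟨s, hs, hxs⟩ := Set.mem_iUnion₂.1 hx
    have : (s : Set Plane) ⊆ {v} := by
      intro u hu
      by_contra hne
      exact hno u hne (frontierFaces_down hs (by simpa using hu) (by simp))
    simpa using convexHull_mono this hxs
  have := (hcorner 0 (by simp)).trans (hcorner 1 (by simp)).symm
  simpa using congrArg (fun x : Plane => x 0) this

/-- The nearer of the two endpoints is a vertex of `K` lying in the other edge, hence an endpoint of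
it. -/
theorem eq_of_same_ray [DecidableEq Plane] {v w w' : Plane} (h : {v, w} ∈ K.faces)
    (h' : {v, w'} ∈ K.faces) {c : ℝ} (hc : 0 < c) (he : w' - v = c • (w - v)) : w = w' := by
  have key : ∀ {w w' : Plane} {c : ℝ}, {v, w} ∈ K.faces → {v, w'} ∈ K.faces → 0 < c → c ≤ 1 →
      w' - v = c • (w - v) → w = w' := by
    intro w w' c h h' hc hc1 he
    have hw' : w' ∈ K.vertices := K.down_closed h' (by simp) (by simp)
    have hmem : w' ∈ convexHull ℝ ((({v, w} : Finset Plane)) : Set Plane) := by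
      rw [Finset.coe_pair, convexHull_pair]
      refine ⟨1 - c, c, by linarith, hc.le, by ring, ?_⟩
      rw [sub_eq_iff_eq_add.1 he]
      module
    have := (SimplicialComplex.vertex_mem_convexHull_iff hw' h).1 hmem
    simp only [Finset.mem_insert, Finset.mem_singleton] at this
    rcases this with rfl | rfl
    · rw [sub_self, eq_comm, smul_eq_zero] at he
      exact sub_eq_zero.1 (he.resolve_left hc.ne')
    · rfl
  rcases le_total c 1 with h1 | h1
  · exact key h h' hc h1 he
  · refine (key (c := c⁻¹) h' h (inv_pos.2 hc) (inv_le_one_of_one_le₀ h1) ?_).symm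
    rw [he, smul_smul, inv_mul_cancel₀ hc.ne', one_smul]

theorem eq_of_same_side [DecidableEq Plane] {v w w' : Plane} (h : {v, w} ∈ K.faces)
    (h' : {v, w'} ∈ K.faces) {i j : Fin 2} (hij : i ≠ j) (hi : w i = v i) (hi' : w' i = v i)
    (hj : 0 < (w j - v j) * (w' j - v j)) : w = w' := by
  have hne : w j - v j ≠ 0 := fun h0 => by simp [h0] at hj
  refine eq_of_same_ray h h' (c := (w' j - v j) / (w j - v j)) ?_ ?_
  · have : (w' j - v j) / (w j - v j) = (w j - v j) * (w' j - v j) / (w j - v j) ^ 2 := by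
      field_simp
    rw [this]
    positivity
  · ext k
    have hk : k = i ∨ k = j := by fin_cases i <;> fin_cases j <;> fin_cases k <;> simp_all
    simp only [PiLp.sub_apply, PiLp.smul_apply, smul_eq_mul]
    rcases hk with rfl | rfl
    · rw [hi, hi']; ring
    · field_simp

/-- At most two edges of the boundary of the square meet at a vertex. -/
theorem frontier_degree_le [DecidableEq Plane] (hK : IsTriangulation K) {v w₁ w₂ w₃ : Plane}
    (h₁ : {v, w₁} ∈ frontierFaces K) (h₂ : {v, w₂} ∈ frontierFaces K)
    (h₃ : {v, w₃} ∈ frontierFaces K) (hv₁ : v ≠ w₁) (hv₂ : v ≠ w₂) (hv₃ : v ≠ w₃) :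
    w₁ = w₂ ∨ w₁ = w₃ ∨ w₂ = w₃ := by
  -- A yes-or-no question `κ` determines a neighbour, so three neighbours cannot be distinct. At a
  -- corner it asks which of the two sides contains the neighbour, elsewhere in which direction
  -- along the side it lies.
  obtain ⟨κ, hκ⟩ : ∃ κ : Plane → Prop, ∀ w w', {v, w} ∈ frontierFaces K →
      {v, w'} ∈ frontierFaces K → v ≠ w → v ≠ w' → (κ w ↔ κ w') → w = w' := by
    have hside : ∀ w, {v, w} ∈ frontierFaces K → ∃ i, w i = v i ∧ (v i = 0 ∨ v i = 1) := by
      rintro w ⟨-, i, h | h⟩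
      · have h1 := h v (by simp)
        have h2 := h w (by simp)
        exact ⟨i, by rw [h1, h2], Or.inl h1⟩
      · have h1 := h v (by simp)
        have h2 := h w (by simp)
        exact ⟨i, by rw [h1, h2], Or.inr h1⟩
    have hsq : ∀ w, {v, w} ∈ frontierFaces K → ∀ i, 0 ≤ w i ∧ w i ≤ 1 := fun w hw =>
      vertex_mem_square hK hw.1 (by simp)
    have hne : ∀ w, v ≠ w → ∀ i j : Fin 2, i ≠ j → w i = v i → w j ≠ v j := by
      intro w hvw i j hij h1 h2
      refine hvw (PiLp.ext fun k => ?_)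
      have hk : k = i ∨ k = j := by fin_cases i <;> fin_cases j <;> fin_cases k <;> simp_all
      rcases hk with rfl | rfl
      · exact h1.symm
      · exact h2.symm
    by_cases hc : ∀ i, v i = 0 ∨ v i = 1
    · have hpos : ∀ w w', {v, w} ∈ frontierFaces K → {v, w'} ∈ frontierFaces K → v ≠ w → v ≠ w' →
          ∀ i j : Fin 2, i ≠ j → w i = v i → w' i = v i → w = w' := by
        intro w w' hw hw' hvw hvw' i j hij h1 h2
        refine eq_of_same_side hw.1 hw'.1 hij h1 h2 ?_
        have n1 := hne w hvw i j hij h1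
        have n2 := hne w' hvw' i j hij h2
        have b1 := hsq w hw j
        have b2 := hsq w' hw' j
        rcases hc j with h0 | h0 <;> rw [h0] at n1 n2 ⊢
        · have := lt_of_le_of_ne b1.1 n1.symm
          have := lt_of_le_of_ne b2.1 n2.symm
          simp only [sub_zero]
          positivity
        · have := lt_of_le_of_ne b1.2 n1
          have := lt_of_le_of_ne b2.2 n2
          exact mul_pos_of_neg_of_neg (by linarith) (by linarith)
      refine ⟨fun w => w 0 = v 0, fun w w' hw hw' hvw hvw' hiff => ?_⟩
      by_cases h0 : w 0 = v 0
      · exact hpos w w' hw hw' hvw hvw' 0 1 (by simp) h0 (hiff.1 h0)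
      · have h0' : w' 0 ≠ v 0 := fun h => h0 (hiff.2 h)
        have h1 : ∀ w, {v, w} ∈ frontierFaces K → w 0 ≠ v 0 → w 1 = v 1 := by
          intro w hw hw0
          obtain ⟨i, hi, -⟩ := hside w hw
          fin_cases i
          · exact absurd hi hw0
          · exact hi
        exact hpos w w' hw hw' hvw hvw' 1 0 (by simp) (h1 w hw h0) (h1 w' hw' h0')
    · push Not at hc
      obtain ⟨j, hj0, hj1⟩ := hc
      obtain ⟨i, hij, hall⟩ : ∃ i : Fin 2, i ≠ j ∧ ∀ k, k = i ∨ k = j := by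
        fin_cases j
        · exact ⟨1, by simp, by intro k; fin_cases k <;> simp⟩
        · exact ⟨0, by simp, by intro k; fin_cases k <;> simp⟩
      have hi : ∀ w, {v, w} ∈ frontierFaces K → w i = v i := by
        intro w hw
        obtain ⟨k, hk, hk'⟩ := hside w hw
        rcases hall k with rfl | rfl
        · exact hk
        · exact absurd hk' (by tauto)
      refine ⟨fun w => v j < w j, fun w w' hw hw' hvw hvw' hiff => ?_⟩
      refine eq_of_same_side hw.1 hw'.1 hij (hi w hw) (hi w' hw') ?_
      have n1 := hne w hvw i j hij (hi w hw)
      have n2 := hne w' hvw' i j hij (hi w' hw')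
      by_cases hlt : v j < w j
      · exact mul_pos (sub_pos.2 hlt) (sub_pos.2 (hiff.1 hlt))
      · have hlt' : ¬ v j < w' j := fun h => hlt (hiff.2 h)
        exact mul_pos_of_neg_of_neg (sub_neg.2 (lt_of_le_of_ne (not_lt.1 hlt) n1))
          (sub_neg.2 (lt_of_le_of_ne (not_lt.1 hlt') n2))
  have a := hκ w₁ w₂ h₁ h₂ hv₁ hv₂
  have b := hκ w₁ w₃ h₁ h₃ hv₁ hv₃
  have c := hκ w₂ w₃ h₂ h₃ hv₂ hv₃
  tauto

/-- The boundary edges of the square are the boundary of the set of all triangles. -/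
theorem boundary_all_triangles (hK : IsTriangulation K) :
    boundary (ofCard K.faces 3) = ofCard (frontierFaces K) 2 := by
  ext e
  have hset : e.card = 2 → {τ ∈ ofCard K.faces 3 | e ⊆ τ ∧ τ.card = e.card + 1} =
      {t ∈ K.faces | t.card = 3 ∧ e ⊆ t} := by
    intro he2
    ext τ
    simp only [ofCard, Set.mem_ofPred_eq, he2]
    tauto
  constructor
  · rintro ⟨hne, hodd⟩
    obtain ⟨t, ht, het, hc⟩ := exists_mem_of_mem_boundary (s := e) ⟨hne, hodd⟩
    have heK : e ∈ K.faces := K.down_closed ht.1 het hne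
    have he2 : e.card = 2 := by have := ht.2; omega
    refine ⟨⟨heK, ?_⟩, he2⟩
    by_contra hf
    obtain ⟨t, t', hne, htt⟩ := triangles_at_interior_edge hK heK he2 hf
    rw [hset he2, htt, Set.ncard_pair hne] at hodd
    exact absurd hodd (by decide)
  · rintro ⟨⟨heK, hf⟩, he2⟩
    obtain ⟨t, htt⟩ := triangles_at_frontier_edge hK heK he2 hf
    exact ⟨SimplicialComplex.nonempty_of_mem_faces heK, by
      rw [hset he2, htt, Set.ncard_singleton]; exact odd_one⟩

theorem exists_frontier_edge [DecidableEq Plane] (hK : IsTriangulation K) {v : Plane}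
    (hv : {v} ∈ frontierFaces K) : ∃ w, v ≠ w ∧ {v, w} ∈ frontierFaces K := by
  obtain ⟨u, hu, huF⟩ := exists_frontier_vertex_ne hK v
  rcases Relation.ReflTransGen.cases_head (frontierFaces_linked hK hv huF) with h | ⟨w, hw, -⟩
  · exact absurd h.symm hu
  · exact ⟨w, hw.1, hw.2⟩

/-- The degree is even because the boundary edges are the boundary of the set of all triangles,
positive because the boundary is linked and has another vertex, and at most two by
`frontier_degree_le`. -/
theorem frontier_degree [DecidableEq Plane] (hK : IsTriangulation K) {v : Plane}
    (hv : {v} ∈ frontierFaces K) : {e ∈ ofCard (frontierFaces K) 2 | {v} ⊆ e}.ncard = 2 := by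
  have hfin : {e ∈ ofCard (frontierFaces K) 2 | {v} ⊆ e}.Finite :=
    hK.1.subset fun e he => he.1.1.1
  have heven : ¬ Odd {e ∈ ofCard (frontierFaces K) 2 | {v} ⊆ e}.ncard := by
    intro hodd
    have hb := boundary_boundary (c := ofCard K.faces 3) (hK.1.subset (Set.sep_subset _ _))
    rw [boundary_all_triangles hK] at hb
    have : {v} ∈ boundary (ofCard (frontierFaces K) 2) := by
      refine ⟨by simp, ?_⟩
      convert hodd using 3
      ext e
      simp only [ofCard, Set.mem_ofPred_eq, Finset.card_singleton]
      tauto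
    rw [hb] at this
    exact this
  have hpos : 0 < {e ∈ ofCard (frontierFaces K) 2 | {v} ⊆ e}.ncard := by
    obtain ⟨w, hvw, hw⟩ := exists_frontier_edge hK hv
    exact (Set.ncard_pos hfin).2 ⟨{v, w}, ⟨hw, Finset.card_pair hvw⟩, by simp⟩
  have hle : ¬ 2 < {e ∈ ofCard (frontierFaces K) 2 | {v} ⊆ e}.ncard := by
    intro hlt
    obtain ⟨a, b, c, ha, hb, hc, hab, hac, hbc⟩ := (Set.two_lt_ncard_iff hfin).1 hlt
    have hform : ∀ e ∈ {e ∈ ofCard (frontierFaces K) 2 | {v} ⊆ e}, ∃ w, v ≠ w ∧ e = {v, w} := by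
      rintro e ⟨⟨-, he2⟩, hve⟩
      obtain ⟨x, y, hxy, rfl⟩ := Finset.card_eq_two.1 he2
      rw [Finset.singleton_subset_iff, Finset.mem_insert, Finset.mem_singleton] at hve
      rcases hve with rfl | rfl
      · exact ⟨y, hxy, rfl⟩
      · exact ⟨x, hxy.symm, Finset.pair_comm _ _⟩
    obtain ⟨w₁, n₁, rfl⟩ := hform a ha
    obtain ⟨w₂, n₂, rfl⟩ := hform b hb
    obtain ⟨w₃, n₃, rfl⟩ := hform c hc
    rcases frontier_degree_le hK ha.1.1 hb.1.1 hc.1.1 n₁ n₂ n₃ with rfl | rfl | rfl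
    · exact hab rfl
    · exact hac rfl
    · exact hbc rfl
  rw [Nat.odd_iff] at heven
  omega

end Frontier

end GraphReconstruction

namespace GraphReconstruction

/-! ### The augmented complex -/

section Lift

theorem mem_lift {σ : Finset Plane} {x : Option Plane} : x ∈ lift σ ↔ ∃ v ∈ σ, some v = x := by
  simp [lift]

theorem some_mem_lift {σ : Finset Plane} {v : Plane} : some v ∈ lift σ ↔ v ∈ σ := by
  simp [lift]

theorem none_notMem_lift (σ : Finset Plane) : none ∉ lift σ := by
  simp [lift]

theorem lift_injective : Function.Injective lift := Finset.map_injective _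

theorem lift_subset_lift {σ τ : Finset Plane} : lift σ ⊆ lift τ ↔ σ ⊆ τ := Finset.map_subset_map

theorem card_lift (σ : Finset Plane) : (lift σ).card = σ.card := Finset.card_map _

theorem lift_nonempty {σ : Finset Plane} : (lift σ).Nonempty ↔ σ.Nonempty := Finset.map_nonempty

theorem lift_singleton (v : Plane) : lift {v} = {some v} := Finset.map_singleton _ _

theorem lift_pair [DecidableEq Plane] (u v : Plane) : lift {u, v} = {some u, some v} := by
  simp [lift]

theorem lift_eraseNone {s : Finset (Option Plane)} (h : none ∉ s) : lift (Finset.eraseNone s) = s := by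
  classical
  rw [lift, Finset.map_some_eraseNone, Finset.erase_eq_of_notMem h]

theorem insertNone_eraseNone {s : Finset (Option Plane)} (h : none ∈ s) :
    Finset.insertNone (Finset.eraseNone s) = s := by
  classical
  rw [Finset.insertNone_eraseNone, Finset.insert_eq_of_mem h]

theorem lift_or_insertNone (s : Finset (Option Plane)) :
    (∃ σ, s = lift σ) ∨ ∃ σ : Finset Plane, s = Finset.insertNone σ := by
  by_cases h : none ∈ s
  · exact Or.inr ⟨_, (insertNone_eraseNone h).symm⟩
  · exact Or.inl ⟨_, (lift_eraseNone h).symm⟩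

theorem lift_ne_insertNone (σ τ : Finset Plane) : lift σ ≠ Finset.insertNone τ := fun h =>
  none_notMem_lift σ (h ▸ Finset.none_mem_insertNone)

theorem lift_subset_insertNone {σ τ : Finset Plane} : lift σ ⊆ Finset.insertNone τ ↔ σ ⊆ τ := by
  constructor
  · intro h v hv
    exact Finset.some_mem_insertNone.1 (h (some_mem_lift.2 hv))
  · intro h x hx
    obtain ⟨v, hv, rfl⟩ := mem_lift.1 hx
    exact Finset.some_mem_insertNone.2 (h hv)

theorem insertNone_subset_insertNone {σ τ : Finset Plane} :
    Finset.insertNone σ ⊆ Finset.insertNone τ ↔ σ ⊆ τ := Finset.insertNone.le_iff_le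

theorem insertNone_not_subset_lift (σ τ : Finset Plane) : ¬ Finset.insertNone σ ⊆ lift τ := fun h =>
  none_notMem_lift τ (h Finset.none_mem_insertNone)

theorem insertNone_injective : Function.Injective (Finset.insertNone (α := Plane)) :=
  Finset.insertNone.injective

theorem boundary_lift (X : Set (Finset Plane)) : boundary (lift '' X) = lift '' boundary X := by
  have hset : ∀ σ : Finset Plane, {τ ∈ lift '' X | lift σ ⊆ τ ∧ τ.card = (lift σ).card + 1} =
      lift '' {τ ∈ X | σ ⊆ τ ∧ τ.card = σ.card + 1} := by
    intro σ
    ext τ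
    constructor
    · rintro ⟨⟨τ, hτ, rfl⟩, h1, h2⟩
      rw [card_lift, card_lift] at h2
      exact ⟨τ, ⟨hτ, lift_subset_lift.1 h1, h2⟩, rfl⟩
    · rintro ⟨τ, ⟨hτ, h1, h2⟩, rfl⟩
      exact ⟨⟨τ, hτ, rfl⟩, lift_subset_lift.2 h1, by rw [card_lift, card_lift, h2]⟩
  ext s
  constructor
  · intro hs
    obtain ⟨t, ⟨τ, hτ, rfl⟩, hst, -⟩ := exists_mem_of_mem_boundary hs
    rcases lift_or_insertNone s with ⟨σ, rfl⟩ | ⟨σ, rfl⟩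
    · refine ⟨σ, ⟨lift_nonempty.1 hs.1, ?_⟩, rfl⟩
      have := hs.2
      rwa [hset, Set.ncard_image_of_injective _ lift_injective] at this
    · exact absurd hst (insertNone_not_subset_lift _ _)
  · rintro ⟨σ, hσ, rfl⟩
    refine ⟨lift_nonempty.2 hσ.1, ?_⟩
    rw [hset, Set.ncard_image_of_injective _ lift_injective]
    exact hσ.2

theorem Linked.lift [DecidableEq Plane] {S : Set (Finset Plane)} {u v : Plane}
    (h : Linked S u v) : Linked (GraphReconstruction.lift '' S) (some u) (some v) := by
  induction h with
  | refl => exact .refl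
  | @tail b c _ hbc ih =>
    exact ih.trans (Linked.single (fun h => hbc.1 (Option.some_injective _ h))
      ⟨_, hbc.2, lift_pair _ _⟩)

theorem boundary_lift_eq_empty {X : Set (Finset Plane)} :
    boundary (lift '' X) = ∅ ↔ boundary X = ∅ := by
  rw [boundary_lift, Set.image_eq_empty]

end Lift

/-! ### Sphere properties of the augmented complex. -/

section Augmented

open Geometry

variable {K Ω : SimplicialComplex ℝ Plane}

theorem lift_mem_augmented {σ : Finset Plane} : lift σ ∈ augmented K ↔ σ ∈ K.faces := by
  constructor
  · rintro ((⟨τ, hτ, h⟩ | h) | ⟨τ, -, h⟩)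
    · exact lift_injective h ▸ hτ
    · have h' : lift σ = {none} := h
      exact absurd (h'.symm ▸ Finset.mem_singleton_self none) (none_notMem_lift σ)
    · exact absurd h.symm (lift_ne_insertNone _ _)
  · exact fun h => Or.inl (Or.inl ⟨σ, h, rfl⟩)

theorem insertNone_mem_augmented (hK : IsTriangulation K) {σ : Finset Plane} :
    Finset.insertNone σ ∈ augmented K ↔ σ = ∅ ∨ σ ∈ frontierFaces K := by
  constructor
  · rintro ((⟨τ, -, h⟩ | h) | ⟨τ, hτ, h⟩)
    · exact absurd h (lift_ne_insertNone _ _)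
    · left
      exact insertNone_injective h
    · right
      rw [← insertNone_injective h]
      exact ⟨hτ.1, (face_subset_frontier_iff hK hτ.1).1 hτ.2⟩
  · rintro (rfl | h)
    · exact Or.inl (Or.inr rfl)
    · exact Or.inr ⟨σ, ⟨h.1, (face_subset_frontier_iff hK h.1).2 h.2⟩, rfl⟩

theorem lift_mem_ofCard {σ : Finset Plane} {k : ℕ} :
    lift σ ∈ ofCard (augmented K) k ↔ σ ∈ ofCard K.faces k := by
  rw [ofCard, Set.mem_ofPred_eq, lift_mem_augmented, card_lift]
  rfl

theorem insertNone_mem_ofCard (hK : IsTriangulation K) {σ : Finset Plane} {k : ℕ} :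
    Finset.insertNone σ ∈ ofCard (augmented K) (k + 2) ↔ σ ∈ ofCard (frontierFaces K) (k + 1) := by
  rw [ofCard, Set.mem_ofPred_eq, insertNone_mem_augmented hK, Finset.card_insertNone,
    Nat.add_right_cancel_iff]
  constructor
  · rintro ⟨rfl | h, h2⟩
    · simp at h2
    · exact ⟨h, h2⟩
  · exact fun h => ⟨Or.inr h.1, h.2⟩

theorem augmented_finite (hK : IsTriangulation K) : (augmented K).Finite :=
  ((hK.1.image _).union (Set.finite_singleton _)).union
    ((hK.1.subset (Set.sep_subset _ _)).image _)

theorem augmented_nonempty {s : Finset (Option Plane)}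
    (hs : s ∈ augmented K) : s.Nonempty := by
  rcases lift_or_insertNone s with ⟨σ, rfl⟩ | ⟨σ, rfl⟩
  · exact lift_nonempty.2 (SimplicialComplex.nonempty_of_mem_faces (lift_mem_augmented.1 hs))
  · exact ⟨none, Finset.none_mem_insertNone⟩

theorem augmented_down (hK : IsTriangulation K) {s t : Finset (Option Plane)}
    (hs : s ∈ augmented K) (hts : t ⊆ s) (ht : t.Nonempty) : t ∈ augmented K := by
  rcases lift_or_insertNone s with ⟨σ, rfl⟩ | ⟨σ, rfl⟩ <;>
    rcases lift_or_insertNone t with ⟨τ, rfl⟩ | ⟨τ, rfl⟩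
  · exact lift_mem_augmented.2 (K.down_closed (lift_mem_augmented.1 hs) (lift_subset_lift.1 hts)
      (lift_nonempty.1 ht))
  · exact absurd hts (insertNone_not_subset_lift _ _)
  · rw [lift_subset_insertNone] at hts
    rw [lift_nonempty] at ht
    rcases (insertNone_mem_augmented hK).1 hs with rfl | h
    · exact absurd (Finset.subset_empty.1 hts) ht.ne_empty
    · exact lift_mem_augmented.2 (frontierFaces_down h hts ht).1
  · rw [insertNone_subset_insertNone] at hts
    rw [insertNone_mem_augmented hK] at hs ⊢
    rcases τ.eq_empty_or_nonempty with h | h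
    · exact Or.inl h
    · rcases hs with rfl | hs
      · exact absurd (Finset.subset_empty.1 hts) h.ne_empty
      · exact Or.inr (frontierFaces_down hs hts h)

theorem augmented_card_le (hK : IsTriangulation K) {s : Finset (Option Plane)}
    (hs : s ∈ augmented K) : s.card ≤ 3 := by
  rcases lift_or_insertNone s with ⟨σ, rfl⟩ | ⟨σ, rfl⟩
  · rw [card_lift]
    exact card_le_three (lift_mem_augmented.1 hs)
  · rw [Finset.card_insertNone]
    rcases (insertNone_mem_augmented hK).1 hs with rfl | h
    · simp
    · have := card_le_two_of_onCommonSide h.1 h.2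
      omega

/-- An interior edge has two triangles in the square, a boundary edge one there and one at infinity.
For an edge at infinity the triangles correspond to the two boundary edges at its finite endpoint.
-/
theorem augmented_two [DecidableEq Plane] (hK : IsTriangulation K) {e : Finset (Option Plane)}
    (he : e ∈ augmented K) (he2 : e.card = 2) :
    {t ∈ ofCard (augmented K) 3 | e ⊆ t}.ncard = 2 := by
  rcases lift_or_insertNone e with ⟨σ, rfl⟩ | ⟨σ, rfl⟩
  · rw [lift_mem_augmented] at he
    rw [card_lift] at he2
    by_cases hf : OnCommonSide σ
    · obtain ⟨t, ht⟩ := triangles_at_frontier_edge hK he he2 hf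
      have heq : {t ∈ ofCard (augmented K) 3 | lift σ ⊆ t} = {lift t, Finset.insertNone σ} := by
        ext s
        rcases lift_or_insertNone s with ⟨τ, rfl⟩ | ⟨τ, rfl⟩
        · have : τ ∈ {t ∈ K.faces | t.card = 3 ∧ σ ⊆ t} ↔ τ = t := by rw [ht]; simp
          simp only [Set.mem_ofPred_eq, lift_mem_ofCard, lift_subset_lift, Set.mem_insert_iff,
            lift_injective.eq_iff, Set.mem_singleton_iff, lift_ne_insertNone, or_false] at this ⊢
          rw [← this]
          simp [ofCard, and_assoc]
        · simp only [Set.mem_ofPred_eq, insertNone_mem_ofCard hK, lift_subset_insertNone,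
            Set.mem_insert_iff, (lift_ne_insertNone _ _).symm, Set.mem_singleton_iff, false_or,
            insertNone_injective.eq_iff]
          constructor
          · rintro ⟨⟨-, h2⟩, h3⟩
            exact (Finset.eq_of_subset_of_card_le h3 (by rw [h2, he2])).symm
          · rintro rfl
            exact ⟨⟨⟨he, hf⟩, he2⟩, subset_rfl⟩
      rw [heq, Set.ncard_pair (lift_ne_insertNone _ _)]
    · obtain ⟨t, t', hne, ht⟩ := triangles_at_interior_edge hK he he2 hf
      have heq : {t ∈ ofCard (augmented K) 3 | lift σ ⊆ t} = {lift t, lift t'} := by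
        ext s
        rcases lift_or_insertNone s with ⟨τ, rfl⟩ | ⟨τ, rfl⟩
        · have : τ ∈ {t ∈ K.faces | t.card = 3 ∧ σ ⊆ t} ↔ τ = t ∨ τ = t' := by rw [ht]; simp
          simp only [Set.mem_ofPred_eq, lift_mem_ofCard, lift_subset_lift, Set.mem_insert_iff,
            lift_injective.eq_iff, Set.mem_singleton_iff] at this ⊢
          rw [← this]
          simp [ofCard, and_assoc]
        · simp only [Set.mem_ofPred_eq, insertNone_mem_ofCard hK, lift_subset_insertNone,
            Set.mem_insert_iff, (lift_ne_insertNone _ _).symm, Set.mem_singleton_iff, or_self,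
            iff_false]
          rintro ⟨h1, h2⟩
          exact hf (h1.1.2.mono h2)
      rw [heq, Set.ncard_pair (lift_injective.ne hne)]
  · have h1 := (insertNone_mem_ofCard (k := 0) hK).1 ⟨he, he2⟩
    obtain ⟨v, rfl⟩ := Finset.card_eq_one.1 h1.2
    rw [← frontier_degree hK h1.1, ← Set.ncard_image_of_injective _ insertNone_injective]
    congr 1
    ext s
    rcases lift_or_insertNone s with ⟨τ, rfl⟩ | ⟨τ, rfl⟩
    · simp only [Set.mem_ofPred_eq, insertNone_not_subset_lift, and_false, Set.mem_image, false_iff]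
      rintro ⟨x, -, hx⟩
      exact lift_ne_insertNone _ _ hx.symm
    · rw [insertNone_injective.mem_set_image]
      simp only [Set.mem_ofPred_eq, insertNone_mem_ofCard hK, insertNone_subset_insertNone]

/-- The link of the vertex at infinity is the connected boundary of the square, so the cycle can be
pushed off this vertex and then filled inside the square. -/
theorem augmented_bounds [DecidableEq Plane] (hK : IsTriangulation K)
    {z : Set (Finset (Option Plane))} (hz : z ⊆ ofCard (augmented K) 2) (hb : boundary z = ∅) :
    ∃ X ⊆ ofCard (augmented K) 3, boundary X = z := by
  have hzf : z.Finite := (augmented_finite hK).subset fun e he => (hz he).1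
  have hfr : ∀ a, {none, a} ∈ z → ∃ v, a = some v ∧ {v} ∈ frontierFaces K := by
    rintro (_ | v) h
    · have := (hz h).2
      simp at this
    · refine ⟨v, rfl, ?_⟩
      have heq : ({none, some v} : Finset (Option Plane)) = Finset.insertNone {v} := by
        ext x; cases x <;> simp
      rw [heq] at h
      exact ((insertNone_mem_ofCard (k := 0) hK).1 (hz h)).1
  obtain ⟨Y, hY, hYf, hY3, hred⟩ := exists_reduction (p := none) (Λ := lift '' frontierFaces K)
    (by rintro _ ⟨σ, -, rfl⟩; exact none_notMem_lift σ) hzf (fun e he => (hz he).2) hb (by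
      intro a b ha hb
      obtain ⟨u, rfl, hu⟩ := hfr a ha
      obtain ⟨v, rfl, hv⟩ := hfr b hb
      exact (frontierFaces_linked hK hu hv).lift)
  have hYL : Y ⊆ ofCard (augmented K) 3 := by
    intro t ht
    obtain ⟨_, ⟨σ, hσ, rfl⟩, rfl⟩ := hY ht
    refine ⟨?_, hY3 _ ht⟩
    have : insert none (lift σ) = Finset.insertNone σ := by
      ext x; cases x <;> simp [lift]
    rw [this]
    exact (insertNone_mem_augmented hK).2 (Or.inr hσ)
  set z' : Set (Finset Plane) := {σ | lift σ ∈ z ∆ boundary Y}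
  have hz' : lift '' z' = z ∆ boundary Y := by
    apply Set.Subset.antisymm
    · rintro _ ⟨σ, hσ, rfl⟩
      exact hσ
    · intro s hs
      exact ⟨Finset.eraseNone s, by
        change lift _ ∈ z ∆ boundary Y
        rwa [lift_eraseNone (hred s hs).1], lift_eraseNone (hred s hs).1⟩
  have hbY : ∀ e ∈ boundary Y, e ∈ ofCard (augmented K) 2 := by
    intro e he
    obtain ⟨t, ht, het, hc⟩ := exists_mem_of_mem_boundary he
    exact ⟨augmented_down hK (hYL ht).1 het he.1, by have := hY3 t ht; omega⟩
  obtain ⟨X, hX, hXb⟩ := exists_filling hK (z := z') (fun σ hσ => by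
      have h1 : lift σ ∈ z ∆ boundary Y := hσ
      exact lift_mem_ofCard.1 (symmDiff_subset hz hbY h1)) (by
    rw [← boundary_lift_eq_empty, hz', boundary_symmDiff hzf (boundary_finite hYf), hb,
      boundary_boundary hYf]
    simp)
  have hXf : X.Finite := hK.1.subset fun t ht => (hX ht).1
  refine ⟨(lift '' X) ∆ Y, symmDiff_subset ?_ hYL, ?_⟩
  · rintro _ ⟨t, ht, rfl⟩
    exact lift_mem_ofCard.2 (hX ht)
  · rw [boundary_symmDiff (hXf.image _) hYf, boundary_lift, hXb, hz', symmDiff_assoc,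
      symmDiff_self]
    simp

/-- A cycle of triangles contains both triangles at an edge or none, so it is closed under
adjacency. Triangles of the square are connected through interior edges, and every triangle at
infinity is adjacent to one of them. -/
theorem augmented_dual [DecidableEq Plane] (hK : IsTriangulation K)
    {X : Set (Finset (Option Plane))} (hX : X ⊆ ofCard (augmented K) 3) (hne : X.Nonempty)
    (hb : boundary X = ∅) : X = ofCard (augmented K) 3 := by
  have hadj : ∀ e ∈ ofCard (augmented K) 2, ∀ t ∈ ofCard (augmented K) 3,
      ∀ t' ∈ ofCard (augmented K) 3, e ⊆ t → e ⊆ t' → t ∈ X → t' ∈ X := by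
    intro e he t ht t' ht' het het' htX
    by_contra ht'X
    have hne : t ≠ t' := fun h => ht'X (h ▸ htX)
    have hfin : {t ∈ ofCard (augmented K) 3 | e ⊆ t}.Finite :=
      (augmented_finite hK).subset fun s hs => hs.1.1
    have hpair : ({t, t'} : Set (Finset (Option Plane))) = {t ∈ ofCard (augmented K) 3 | e ⊆ t} := by
      refine Set.eq_of_subset_of_ncard_le ?_ ?_ hfin
      · rintro s (rfl | rfl)
        · exact ⟨ht, het⟩
        · exact ⟨ht', het'⟩
      · rw [augmented_two hK he.1 he.2, Set.ncard_pair hne]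
    have heX : e ∈ boundary X := by
      refine ⟨augmented_nonempty he.1, ?_⟩
      have : {τ ∈ X | e ⊆ τ ∧ τ.card = e.card + 1} = {t} := by
        ext s
        simp only [Set.mem_ofPred_eq, Set.mem_singleton_iff]
        constructor
        · rintro ⟨hs, hes, -⟩
          have : s ∈ ({t, t'} : Set (Finset (Option Plane))) := by
            rw [hpair]
            exact ⟨hX hs, hes⟩
          rcases this with h | h
          · exact h
          · have h' : s = t' := h
            exact absurd (h' ▸ hs) ht'X
        · rintro rfl
          exact ⟨htX, het, by rw [ht.2, he.2]⟩
      rw [this, Set.ncard_singleton]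
      exact odd_one
    rw [hb] at heX
    exact heX
  set X' : Set (Finset Plane) := {τ | lift τ ∈ X}
  have hnew : ∀ σ ∈ ofCard (frontierFaces K) 2, ∃ τ ∈ ofCard K.faces 3, σ ⊆ τ ∧
      (Finset.insertNone σ ∈ X ↔ lift τ ∈ X) := by
    intro σ hσ
    obtain ⟨τ, hτ, hτ3, hστ⟩ := exists_triangle_of_face hK hσ.1.1
    have h1 : lift σ ∈ ofCard (augmented K) 2 := lift_mem_ofCard.2 ⟨hσ.1.1, hσ.2⟩
    have h2 := (insertNone_mem_ofCard (k := 1) hK).2 hσ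
    have h3 : lift τ ∈ ofCard (augmented K) 3 := lift_mem_ofCard.2 ⟨hτ, hτ3⟩
    exact ⟨τ, ⟨hτ, hτ3⟩, hστ,
      hadj _ h1 _ h2 _ h3 (lift_subset_insertNone.2 subset_rfl) (lift_subset_lift.2 hστ),
      hadj _ h1 _ h3 _ h2 (lift_subset_lift.2 hστ) (lift_subset_insertNone.2 subset_rfl)⟩
  have hX' : X' = ofCard K.faces 3 := by
    refine triangles_connected hK (fun τ hτ => lift_mem_ofCard.1 (hX hτ)) ?_ ?_
    · obtain ⟨s, hs⟩ := hne
      rcases lift_or_insertNone s with ⟨τ, rfl⟩ | ⟨σ, rfl⟩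
      · exact ⟨τ, hs⟩
      · obtain ⟨τ, -, -, h⟩ := hnew σ ((insertNone_mem_ofCard (k := 1) hK).1 (hX hs))
        exact ⟨τ, h.1 hs⟩
    · intro e he he2 _ t ht t' ht' het het' htX
      exact hadj (lift e) (lift_mem_ofCard.2 ⟨he, he2⟩) _ (lift_mem_ofCard.2 ht) _
        (lift_mem_ofCard.2 ht') (lift_subset_lift.2 het) (lift_subset_lift.2 het') htX
  refine hX.antisymm fun s hs => ?_
  rcases lift_or_insertNone s with ⟨τ, rfl⟩ | ⟨σ, rfl⟩
  · have : τ ∈ X' := hX' ▸ lift_mem_ofCard.1 hs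
    exact this
  · obtain ⟨τ, hτ, -, h⟩ := hnew σ ((insertNone_mem_ofCard (k := 1) hK).1 hs)
    have : τ ∈ X' := hX' ▸ hτ
    exact h.2 this

theorem augmented_linked [DecidableEq Plane] (hK : IsTriangulation K) {u v : Option Plane}
    (hu : {u} ∈ augmented K) (hv : {v} ∈ augmented K) : Linked (augmented K) u v := by
  obtain ⟨c, -, hc⟩ := exists_frontier_vertex_ne hK 0
  have key : ∀ u, {u} ∈ augmented K → Linked (augmented K) u (some c) := by
    rintro (_ | u) hu
    · refine Linked.single (by simp) ?_
      have heq : ({none, some c} : Finset (Option Plane)) = Finset.insertNone {c} := by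
        ext x; cases x <;> simp
      rw [heq, insertNone_mem_augmented hK]
      exact Or.inr hc
    · rw [← lift_singleton, lift_mem_augmented] at hu
      refine Linked.mono ?_ (faces_linked hK hu hc.1).lift
      rintro _ ⟨σ, hσ, rfl⟩
      exact lift_mem_augmented.2 hσ
  exact (key u hu).trans (key v hv).symm

end Augmented

/-! ### Consequences of the noise model. -/

section Approximation

open Geometry

variable {K Ω : SimplicialComplex ℝ Plane} {G : Set Plane} {ρ : Plane → ℝ} {β ν ω : ℝ}

/-- The track of each point under the homotopy joins it to `A`. -/
theorem DeformationRetractsTo.isPreconnected {Y : Type*} [TopologicalSpace Y] {X A : Set Y}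
    (h : DeformationRetractsTo X A) (hA : IsConnected A) : IsPreconnected X := by
  obtain ⟨hAX, F, h0, h1, -⟩ := h
  obtain ⟨a, ha⟩ := hA.nonempty
  refine isPreconnected_of_forall a fun x hx => ?_
  have hpath : IsPreconnected (Set.range fun t : unitInterval => (F (t, ⟨x, hx⟩) : Y)) :=
    isPreconnected_range (by fun_prop)
  refine ⟨A ∪ Set.range fun t : unitInterval => (F (t, ⟨x, hx⟩) : Y), ?_, Or.inl ha,
    Or.inr ⟨0, by simp [h0]⟩, ?_⟩
  · rintro y (hy | ⟨t, rfl⟩)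
    · exact hAX hy
    · exact (F (t, ⟨x, hx⟩)).2
  · exact IsPreconnected.union (F (1, ⟨x, hx⟩) : Y) (h1 _) ⟨1, rfl⟩ hA.isPreconnected hpath

namespace IsApproximation

theorem finite (hρ : IsApproximation K Ω G ρ β ν ω) (hK : IsTriangulation K) :
    Ω.faces.Finite := hK.1.subset hρ.subcomplex

theorem linked [DecidableEq Plane] (hρ : IsApproximation K Ω G ρ β ν ω) (hK : IsTriangulation K)
    (hG : IsConnected G) {u v : Plane} (hu : {u} ∈ Ω.faces) (hv : {v} ∈ Ω.faces) :
    Linked Ω.faces u v :=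
  linked_of_isPreconnected (hρ.finite hK) hρ.subcomplex
    (fun _ hs _ hts ht => Ω.down_closed hs hts ht) (hρ.retracts.isPreconnected hG) hu hv

theorem exists_vertex (hρ : IsApproximation K Ω G ρ β ν ω) (hG : IsConnected G) :
    ∃ v, {v} ∈ Ω.faces := by
  obtain ⟨x, hx⟩ := hG.nonempty
  obtain ⟨s, hs, -⟩ := SimplicialComplex.mem_space_iff.1 (hρ.graph_subset hx)
  obtain ⟨v, hv⟩ := SimplicialComplex.nonempty_of_mem_faces hs
  exact ⟨v, Ω.down_closed hs (by simpa using hv) (by simp)⟩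

theorem noise_nonneg (hρ : IsApproximation K Ω G ρ β ν ω) (hG : IsConnected G) : 0 ≤ ν := by
  obtain ⟨v, hv⟩ := hρ.exists_vertex hG
  have := hρ.density_inside v hv
  linarith

theorem value_lt (hρ : IsApproximation K Ω G ρ β ν ω) (hG : IsConnected G) {u v : Plane}
    (hu : {u} ∈ Ω.faces) (hv : {v} ∈ K.faces) (hvΩ : {v} ∉ Ω.faces) : -ρ u < -ρ v := by
  have h1 := hρ.density_inside u hu
  have h2 := hρ.density_outside v hv hvΩ
  have h3 := hρ.noise_nonneg hG
  have h4 := hρ.gap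
  linarith

variable {r' : Finset (Option Plane) → ℕ}

theorem augmentedValue_lt (hρ : IsApproximation K Ω G ρ β ν ω) (hG : IsConnected G) {u : Plane}
    {x : Option Plane} (hu : {u} ∈ Ω.faces) (hx : {x} ∈ augmented K)
    (hxΩ : {x} ∉ lift '' Ω.faces) :
    augmentedValue ρ (some u) < augmentedValue ρ x := by
  cases x with
  | none => exact EReal.coe_lt_top _
  | some v =>
    rw [← lift_singleton, lift_mem_augmented] at hx
    exact EReal.coe_lt_coe_iff.2 (hρ.value_lt hG hu hx fun h => hxΩ ⟨_, h, lift_singleton v⟩)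

/-- A vertex outside `Ω` has a larger value than all those of `Ω`, so by the lower-star property it
comes after every simplex of `Ω`. A simplex no later than one of `Ω` thus has all its vertices in
`Ω`, and `full` applies. -/
theorem initial (hρ : IsApproximation K Ω G ρ β ν ω) (hK : IsTriangulation K) (hG : IsConnected G)
    (hr' : IsLowerStarFiltration (augmented K) (augmentedValue ρ) r')
    {σ τ : Finset (Option Plane)} (hσ : σ ∈ augmented K) (hτ : τ ∈ lift '' Ω.faces)
    (hle : r' σ ≤ r' τ) : σ ∈ lift '' Ω.faces := by
  obtain ⟨τ, hτ, rfl⟩ := hτ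
  have hτK : lift τ ∈ augmented K := lift_mem_augmented.2 (hρ.subcomplex hτ)
  have hvert : ∀ x ∈ σ, {x} ∈ lift '' Ω.faces := by
    intro x hx
    have hxK : {x} ∈ augmented K := augmented_down hK hσ (by simpa using hx) (by simp)
    by_contra hxΩ
    have hlt : r' (lift τ) < r' {x} := by
      refine hr'.lower_star _ hτK x hxK fun y hy => ?_
      obtain ⟨u, hu, rfl⟩ := mem_lift.1 hy
      have huΩ : {u} ∈ Ω.faces := Ω.down_closed hτ (by simpa using hu) (by simp)
      have huK : {some u} ∈ augmented K := by
        rw [← lift_singleton, lift_mem_augmented]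
        exact hρ.subcomplex huΩ
      have hval := hρ.augmentedValue_lt hG huΩ hxK hxΩ
      rcases lt_trichotomy (r' {some u}) (r' {x}) with h | h | h
      · exact h
      · have := Finset.singleton_injective (hr'.injOn huK hxK h)
        exact absurd (this ▸ hval) (lt_irrefl _)
      · exact absurd (hr'.vertex_sorted _ _ hxK huK h) (not_le.2 hval)
    have hxσ : r' {x} ≤ r' σ := by
      rcases eq_or_ne {x} σ with h | h
      · rw [h]
      · exact (hr'.face_lt _ hxK _ hσ (Finset.ssubset_iff_subset_ne.2
          ⟨by simpa using hx, h⟩)).le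
    omega
  rcases lift_or_insertNone σ with ⟨σ, rfl⟩ | ⟨σ, rfl⟩
  · refine ⟨σ, hρ.full σ (lift_mem_augmented.1 hσ) fun v hv => ?_, rfl⟩
    obtain ⟨s, hs, hsv⟩ := hvert (some v) (some_mem_lift.2 hv)
    rw [← lift_singleton] at hsv
    have : {v} ∈ Ω.faces := lift_injective hsv ▸ hs
    exact this
  · obtain ⟨s, -, hsv⟩ := hvert none Finset.none_mem_insertNone
    exact absurd (hsv ▸ Finset.mem_singleton_self none) (none_notMem_lift s)

theorem isFilteredSphere [DecidableEq Plane] (hρ : IsApproximation K Ω G ρ β ν ω)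
    (hK : IsTriangulation K) (hG : IsConnected G)
    (hr' : IsLowerStarFiltration (augmented K) (augmentedValue ρ) r') :
    IsFilteredSphere (augmented K) (lift '' Ω.faces) r' where
  finite := augmented_finite hK
  nonempty _ := augmented_nonempty
  down_closed _ hs _ hts ht := augmented_down hK hs hts ht
  injOn := hr'.injOn
  face_lt := hr'.face_lt
  card_le _ := augmented_card_le hK
  two _ := augmented_two hK
  bounds _ := augmented_bounds hK
  dual _ := augmented_dual hK
  linked _ _ := augmented_linked hK
  sub := by
    rintro _ ⟨σ, hσ, rfl⟩
    exact lift_mem_augmented.2 (hρ.subcomplex hσ)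
  sub_down := by
    rintro _ ⟨σ, hσ, rfl⟩ t hts ht
    rcases lift_or_insertNone t with ⟨τ, rfl⟩ | ⟨τ, rfl⟩
    · exact ⟨τ, Ω.down_closed hσ (lift_subset_lift.1 hts) (lift_nonempty.1 ht), rfl⟩
    · exact absurd hts (insertNone_not_subset_lift _ _)
  initial _ hσ _ hτ hle := hρ.initial hK hG hr' hσ hτ hle
  sub_linked := by
    rintro u v ⟨s, hs, hsu⟩ ⟨t, ht, htv⟩
    obtain ⟨u, rfl⟩ : ∃ u', u = some u' := by
      cases u with
      | none => exact absurd (hsu ▸ Finset.mem_singleton_self none) (none_notMem_lift s)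
      | some u => exact ⟨u, rfl⟩
    obtain ⟨v, rfl⟩ : ∃ v', v = some v' := by
      cases v with
      | none => exact absurd (htv ▸ Finset.mem_singleton_self none) (none_notMem_lift t)
      | some u => exact ⟨u, rfl⟩
    rw [← lift_singleton] at hsu htv
    exact (hρ.linked hK hG (lift_injective hsu ▸ hs) (lift_injective htv ▸ ht)).lift
  sub_nonempty := by
    obtain ⟨v, hv⟩ := hρ.exists_vertex hG
    exact ⟨some v, _, hv, lift_singleton v⟩
  outside := by
    obtain ⟨c, -, hc⟩ := exists_frontier_vertex_ne hK 0
    obtain ⟨w, hcw, hw⟩ := exists_frontier_edge hK hc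
    refine ⟨Finset.insertNone {c, w}, (insertNone_mem_ofCard (k := 1) hK).2
      ⟨hw, Finset.card_pair hcw⟩, ?_⟩
    rintro ⟨s, -, hs⟩
    exact lift_ne_insertNone _ _ hs

end IsApproximation

end Approximation

end GraphReconstruction

namespace GraphReconstruction

/-! ### The augmented complex as the surface of a pyramid. -/

section Realization

open Geometry

theorem affineIndependent_coe_iff {V E : Type*} [AddCommGroup E] [Module ℝ E] {s : Finset V}
    {p : V → E} : AffineIndependent ℝ (fun v : s => p v) ↔
      ∀ w : V → ℝ, ∑ v ∈ s, w v = 0 → ∑ v ∈ s, w v • p v = 0 → ∀ v ∈ s, w v = 0 := by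
  classical
  rw [affineIndependent_iff_of_fintype]
  constructor
  · intro h w h0 h1 v hv
    refine h (fun v => w v) (by rw [← h0]; exact Finset.sum_coe_sort s w) ?_ ⟨v, hv⟩
    rw [Finset.univ.weightedVSub_eq_linear_combination (by rw [← h0]; exact Finset.sum_coe_sort s w),
      ← h1]
    exact Finset.sum_coe_sort s fun v => w v • p v
  · intro h w h0 h1 i
    rw [Finset.univ.weightedVSub_eq_linear_combination h0] at h1
    have := h (fun v => if hv : v ∈ s then w ⟨v, hv⟩ else 0) (by
      rw [← Finset.sum_coe_sort, ← h0]
      exact Finset.sum_congr rfl fun v _ => by simp) (by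
      rw [← Finset.sum_coe_sort, ← h1]
      exact Finset.sum_congr rfl fun v _ => by simp) i i.2
    simpa using this

theorem image_pos_lift (σ : Finset Plane) :
    pos '' (lift σ : Set (Option Plane)) = (fun x => ((x, 0) : Plane × ℝ)) '' (σ : Set Plane) := by
  rw [lift, Finset.coe_map, Set.image_image]
  rfl

theorem mem_convexHull_lift {σ : Finset Plane} {x : Plane × ℝ} :
    x ∈ convexHull ℝ (pos '' (lift σ : Set (Option Plane))) ↔
      x.2 = 0 ∧ x.1 ∈ convexHull ℝ (σ : Set Plane) := by
  have himg : convexHull ℝ (pos '' (lift σ : Set (Option Plane))) =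
      (LinearMap.inl ℝ Plane ℝ) '' convexHull ℝ (σ : Set Plane) := by
    rw [image_pos_lift, LinearMap.image_convexHull]
    rfl
  rw [himg]
  constructor
  · rintro ⟨y, hy, rfl⟩
    exact ⟨rfl, hy⟩
  · rintro ⟨h0, h1⟩
    exact ⟨x.1, h1, Prod.ext rfl h0.symm⟩

theorem image_pos_insertNone (σ : Finset Plane) :
    pos '' (Finset.insertNone σ : Set (Option Plane)) =
      insert (pos none) (pos '' (lift σ : Set (Option Plane))) := by
  rw [← Set.image_insert_eq]
  congr 1
  ext x
  cases x <;> simp [lift]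

/-- Points of the cone over a simplex. -/
theorem mem_convexHull_insertNone {σ : Finset Plane} (hσ : σ.Nonempty) {x : Plane × ℝ} :
    x ∈ convexHull ℝ (pos '' (Finset.insertNone σ : Set (Option Plane))) ↔
      ∃ y ∈ convexHull ℝ (σ : Set Plane), ∃ c : ℝ, 0 ≤ c ∧ c ≤ 1 ∧
        x = c • pos none + (1 - c) • (y, 0) := by
  rw [image_pos_insertNone, convexHull_insert (by
    obtain ⟨v, hv⟩ := hσ
    exact ⟨_, some v, some_mem_lift.2 hv, rfl⟩), convexJoin_singleton_left]
  simp only [Set.mem_iUnion, exists_prop]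
  constructor
  · rintro ⟨z, hz, a, b, ha, hb, hab, rfl⟩
    obtain ⟨h0, h1⟩ := mem_convexHull_lift.1 hz
    exact ⟨z.1, h1, a, ha, by linarith, by
      rw [show 1 - a = b by linarith, show ((z.1, 0) : Plane × ℝ) = z from Prod.ext rfl h0.symm]⟩
  · rintro ⟨y, hy, c, h0, h1, rfl⟩
    exact ⟨(y, 0), mem_convexHull_lift.2 ⟨rfl, hy⟩, c, 1 - c, h0, by linarith, by ring, rfl⟩

theorem pos_none_snd : (pos none).2 = 1 := rfl

variable {K : SimplicialComplex ℝ Plane}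

theorem face_inter {σ τ : Finset Plane} (hσ : σ = ∅ ∨ σ ∈ K.faces)
    (hτ : τ = ∅ ∨ τ ∈ K.faces) {y : Plane} (h : y ∈ convexHull ℝ (σ : Set Plane))
    (h' : y ∈ convexHull ℝ (τ : Set Plane)) : y ∈ convexHull ℝ (σ ∩ τ : Set Plane) := by
  rcases hσ with rfl | hσ
  · simp at h
  · rcases hτ with rfl | hτ
    · simp at h'
    · exact K.inter_subset_convexHull hσ hτ ⟨h, h'⟩

/-- A point of a cone other than the apex determines its height and its foot in the base. So
intersections of cones reduce to intersections of faces of `K`, and at height zero a cone is its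
base. -/
theorem isGeometricRealization_augmented (hK : IsTriangulation K) :
    IsGeometricRealization (augmented K) pos := by
  classical
  have hcases : ∀ σ : Finset Plane, Finset.insertNone σ ∈ augmented K → σ = ∅ ∨ σ ∈ K.faces :=
    fun σ h => ((insertNone_mem_augmented hK).1 h).imp_right fun h => h.1
  have hcone : ∀ (σ : Finset Plane) (x : Plane × ℝ),
      x ∈ convexHull ℝ (pos '' (Finset.insertNone σ : Set (Option Plane))) →
      x = pos none ∨ ∃ y ∈ convexHull ℝ (σ : Set Plane), ∃ c : ℝ, 0 ≤ c ∧ c < 1 ∧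
        x = c • pos none + (1 - c) • (y, 0) := by
    intro σ x hx
    rcases σ.eq_empty_or_nonempty with rfl | hne
    · left
      rw [image_pos_insertNone] at hx
      simpa [lift] using hx
    · obtain ⟨y, hy, c, h0, h1, rfl⟩ := (mem_convexHull_insertNone hne).1 hx
      rcases h1.lt_or_eq with h1 | rfl
      · exact Or.inr ⟨y, hy, c, h0, h1, rfl⟩
      · left
        simp
  have hmixed : ∀ σ τ : Finset Plane, lift σ ∈ augmented K → Finset.insertNone τ ∈ augmented K →
      ∀ x, x ∈ convexHull ℝ (pos '' (lift σ : Set (Option Plane))) →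
      x ∈ convexHull ℝ (pos '' (Finset.insertNone τ : Set (Option Plane))) →
      x ∈ convexHull ℝ (pos '' ((lift σ : Set (Option Plane)) ∩ Finset.insertNone τ)) := by
    intro σ τ hσ hτ x hx hx'
    obtain ⟨h0, h1⟩ := mem_convexHull_lift.1 hx
    have hsub : (lift (σ ∩ τ) : Set (Option Plane)) ⊆
        (lift σ : Set (Option Plane)) ∩ Finset.insertNone τ := by
      intro y hy
      obtain ⟨v, hv, rfl⟩ := mem_lift.1 hy
      rw [Finset.mem_inter] at hv
      exact ⟨some_mem_lift.2 hv.1, Finset.some_mem_insertNone.2 hv.2⟩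
    refine convexHull_mono (Set.image_mono hsub) (mem_convexHull_lift.2 ⟨h0, ?_⟩)
    rcases hcone τ x hx' with rfl | ⟨y, hy, c, hc0, hc1, rfl⟩
    · rw [pos_none_snd] at h0
      norm_num at h0
    · have hc : c = 0 := by simpa [pos_none_snd] using h0
      subst hc
      simp only [zero_smul, sub_zero, one_smul, zero_add] at h1 ⊢
      rw [Finset.coe_inter]
      exact face_inter (Or.inr (lift_mem_augmented.1 hσ)) (hcases τ hτ) h1 hy
  refine ⟨fun s hs => ?_, fun s hs t ht x hx => ?_⟩
  · rw [affineIndependent_coe_iff]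
    intro w h0 h1
    have hind : ∀ σ : Finset Plane, σ = ∅ ∨ σ ∈ K.faces → ∑ v ∈ σ, w (some v) = 0 →
        ∑ v ∈ σ, w (some v) • v = 0 → ∀ v ∈ σ, w (some v) = 0 := by
      rintro σ (rfl | hσ) e0 e1
      · simp
      · exact (affineIndependent_coe_iff (p := id)).1 (K.indep hσ) (fun v => w (some v)) e0 e1
    rcases lift_or_insertNone s with ⟨σ, rfl⟩ | ⟨σ, rfl⟩
    · rw [lift, Finset.sum_map] at h0 h1
      have h2 := congrArg Prod.fst h1
      rw [Prod.fst_sum] at h2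
      intro x hx
      obtain ⟨v, hv, rfl⟩ := mem_lift.1 hx
      exact hind σ (Or.inr (lift_mem_augmented.1 hs)) h0 h2 v hv
    · have hsum : ∀ {M : Type} [AddCommMonoid M] (f : Option Plane → M),
          ∑ x ∈ Finset.insertNone σ, f x = f none + ∑ v ∈ σ, f (some v) := by
        intro M _ f
        rw [Finset.sum_insertNone]
      rw [hsum] at h0 h1
      have h2 := congrArg Prod.snd h1
      have h3 := congrArg Prod.fst h1
      simp only [Prod.snd_add, Prod.fst_add, Prod.snd_sum, Prod.fst_sum, Prod.smul_snd,
        Prod.smul_fst, pos, smul_eq_mul, mul_one, mul_zero, Finset.sum_const_zero, add_zero,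
        Prod.snd_zero, Prod.fst_zero] at h2 h3
      rw [h2, zero_add] at h0
      rw [h2, zero_smul, zero_add] at h3
      rintro (_ | v) hx
      · exact h2
      · exact hind σ (hcases σ hs) h0 h3 v (Finset.some_mem_insertNone.1 hx)
  · obtain ⟨hxs, hxt⟩ := hx
    rcases lift_or_insertNone s with ⟨σ, rfl⟩ | ⟨σ, rfl⟩ <;>
      rcases lift_or_insertNone t with ⟨τ, rfl⟩ | ⟨τ, rfl⟩
    · have hsub : (lift (σ ∩ τ) : Set (Option Plane)) ⊆ (lift σ : Set (Option Plane)) ∩ lift τ := by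
        intro y hy
        obtain ⟨v, hv, rfl⟩ := mem_lift.1 hy
        rw [Finset.mem_inter] at hv
        exact ⟨some_mem_lift.2 hv.1, some_mem_lift.2 hv.2⟩
      obtain ⟨h0, h1⟩ := mem_convexHull_lift.1 hxs
      obtain ⟨-, h2⟩ := mem_convexHull_lift.1 hxt
      refine convexHull_mono (Set.image_mono hsub) (mem_convexHull_lift.2 ⟨h0, ?_⟩)
      rw [Finset.coe_inter]
      exact face_inter (Or.inr (lift_mem_augmented.1 hs)) (Or.inr (lift_mem_augmented.1 ht)) h1 h2
    · exact hmixed σ τ hs ht x hxs hxt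
    · rw [Set.inter_comm]
      exact hmixed τ σ ht hs x hxt hxs
    · have hsub : (Finset.insertNone (σ ∩ τ) : Set (Option Plane)) ⊆
          (Finset.insertNone σ : Set (Option Plane)) ∩ Finset.insertNone τ := by
        intro y hy
        cases y with
        | none => simp
        | some v =>
          have := Finset.some_mem_insertNone.1 (Finset.mem_coe.1 hy)
          rw [Finset.mem_inter] at this
          exact ⟨Finset.some_mem_insertNone.2 this.1, Finset.some_mem_insertNone.2 this.2⟩
      refine convexHull_mono (Set.image_mono hsub) ?_
      have hapex : pos none ∈
          convexHull ℝ (pos '' (Finset.insertNone (σ ∩ τ) : Set (Option Plane))) :=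
        subset_convexHull ℝ _ ⟨none, Finset.none_mem_insertNone, rfl⟩
      rcases hcone σ x hxs with rfl | ⟨y, hy, c, hc0, hc1, rfl⟩
      · exact hapex
      · rcases hcone τ _ hxt with h | ⟨y', hy', c', hc0', hc1', h⟩
        · rw [h]
          exact hapex
        · have hcc : c = c' := by simpa [pos_none_snd] using congrArg Prod.snd h
          subst hcc
          have hyy : y = y' := by
            have h3 := congrArg Prod.fst (add_left_cancel h)
            simp only [Prod.smul_fst] at h3
            exact smul_right_injective Plane (show (1 - c) ≠ 0 by linarith) h3
          subst hyy
          have hmem := face_inter (hcases σ hs) (hcases τ ht) hy hy'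
          rw [← Finset.coe_inter] at hmem
          have hne : (σ ∩ τ).Nonempty := by
            rw [Finset.nonempty_iff_ne_empty]
            intro h0
            rw [h0] at hmem
            simp at hmem
          exact (mem_convexHull_insertNone hne).2 ⟨y, hmem, c, hc0, hc1.le, rfl⟩

end Realization

end GraphReconstruction

namespace GraphReconstruction

/-! ### Persistence pairs of the augmented complex -/

section VertexPairs

variable {V : Type*} [DecidableEq V] {L Ω : Set (Finset V)} {r : Finset V → ℕ}

/-- A component that is born in `Ω` also dies in `Ω`. -/
theorem IsFilteredSphere.mem_of_vertex_pair (h : IsFilteredSphere L Ω r) {v : V} {e : Finset V}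
    (hp : IsPersistencePair L r {v} e) (hv : {v} ∈ Ω) : e ∈ Ω := by
  obtain ⟨d, hd, -, hvd, hmax⟩ := h.exists_killing_chain hp
  have hdL : d ⊆ L := fun x hx => (hd hx).1
  have hd2 : ∀ e ∈ d, e.card = 2 := fun x hx => (hd hx).2.1
  have hdf : d.Finite := h.finite.subset hdL
  -- By parity the killing chain has a second boundary vertex `u`. It comes no later than `v`, hence
  -- is in `Ω`, and a path in `Ω` from `u` to `v` already kills the component.
  obtain ⟨s, hs, hne⟩ : ∃ s ∈ boundary d, s ≠ {v} := by
    by_contra! hno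
    refine even_ncard_boundary hdf hd2 ?_
    rw [show boundary d = {{v}} from Set.eq_singleton_iff_unique_mem.2 ⟨hvd, hno⟩,
      Set.ncard_singleton]
    exact odd_one
  have hs1 : s.card = 1 := IsFilteredComplex.card_of_mem_boundary hd2 hs
  obtain ⟨u, rfl⟩ := Finset.card_eq_one.1 hs1
  have hu : {u} ∈ Ω := h.initial _ (h.mem_of_mem_boundary hdL hs) _ hv (hmax _ hs)
  obtain ⟨c, hc, hcf, hc2, hcb⟩ := (h.sub_linked u v hu hv).exists_chain
  have hvc : {v} ∈ boundary c := by
    rw [hcb]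
    exact Or.inr ⟨rfl, fun h' => hne (Set.mem_singleton_iff.1 h').symm⟩
  have hcL : c ⊆ L := hc.trans h.sub
  obtain ⟨t, ht, -⟩ := exists_mem_of_mem_boundary hvc
  obtain ⟨m, hm, hmx⟩ := h.exists_max hcL ⟨t, ht⟩
  obtain ⟨τ, hτ, hle⟩ := h.pair_of_chain (σ := {v}) (τ := m) (c := c)
    (fun x hx => ⟨hcL hx, by rw [hc2 x hx]; rfl, hmx x hx⟩) hvc (by
      rw [hcb]
      rintro s (hs' | hs')
      · rw [Set.mem_singleton_iff.1 hs'.1]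
        exact hmax _ hs
      · rw [Set.mem_singleton_iff.1 hs'.1])
  rw [h.pair_right_unique hτ hp] at hle
  exact h.initial _ hp.2.1 _ (hc hm) hle

end VertexPairs

/-! ### Pairs of K inside the augmented complex, and the pairs of low persistence. -/

section Comparison

open Geometry

variable {K Ω : SimplicialComplex ℝ Plane} {G : Set Plane} {ρ : Plane → ℝ} {β ν ω δ : ℝ}
  {r : Finset Plane → ℕ} {r' : Finset (Option Plane) → ℕ}

/-- The simplices of `K` come before the others. -/
theorem mem_lift_of_le
    (hr' : IsLowerStarFiltration (augmented K) (augmentedValue ρ) r')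
    {x : Finset (Option Plane)} (hx : x ∈ augmented K) {τ : Finset Plane} (hτ : τ ∈ K.faces)
    (hle : r' x ≤ r' (lift τ)) : x ∈ lift '' K.faces := by
  rcases lift_or_insertNone x with ⟨σ, rfl⟩ | ⟨σ, rfl⟩
  · exact ⟨σ, lift_mem_augmented.1 hx, rfl⟩
  · have hnone : {none} ∈ augmented K := Or.inl (Or.inr rfl)
    have hlt : r' (lift τ) < r' {none} := by
      refine hr'.lower_star _ (lift_mem_augmented.2 hτ) none hnone fun y hy => ?_
      obtain ⟨u, hu, rfl⟩ := mem_lift.1 hy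
      have huK : {some u} ∈ augmented K := by
        rw [← lift_singleton, lift_mem_augmented]
        exact K.down_closed hτ (by simpa using hu) (by simp)
      rcases lt_trichotomy (r' {some u}) (r' {none}) with h | h | h
      · exact h
      · have := Finset.singleton_injective (hr'.injOn huK hnone h)
        simp at this
      · exact absurd (hr'.vertex_sorted _ _ hnone huK h) (not_le.2 (EReal.coe_lt_top _))
    have hle' : r' {none} ≤ r' (Finset.insertNone σ) := by
      rcases eq_or_ne {none} (Finset.insertNone σ) with h | h
      · rw [h]
      · exact (hr'.face_lt _ hnone _ hx (Finset.ssubset_iff_subset_ne.2 ⟨by simp, h⟩)).le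
    omega

theorem rank_le_iff (hrr' : ∀ σ ∈ K.faces, ∀ τ ∈ K.faces, r' (lift σ) < r' (lift τ) ↔ r σ < r τ)
    {σ τ : Finset Plane} (hσ : σ ∈ K.faces) (hτ : τ ∈ K.faces) :
    r' (lift σ) ≤ r' (lift τ) ↔ r σ ≤ r τ := by
  rw [← not_lt, ← not_lt, hrr' τ hτ σ hσ]

/-- The simplices of `K` come first, so chains up to `lift τ` contain only lifted simplices and are
the same in both complexes. -/
theorem killedBy_lift
    (hr' : IsLowerStarFiltration (augmented K) (augmentedValue ρ) r')
    (hrr' : ∀ σ ∈ K.faces, ∀ τ ∈ K.faces, r' (lift σ) < r' (lift τ) ↔ r σ < r τ)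
    {σ τ : Finset Plane} (hσ : σ ∈ K.faces) (hτ : τ ∈ K.faces) :
    KilledBy (augmented K) r' (lift σ) (lift τ) ↔ KilledBy K.faces r σ τ := by
  have hbd : ∀ c ⊆ K.faces, boundary c ⊆ K.faces := by
    intro c hc s hs
    obtain ⟨t, ht, hst, -⟩ := exists_mem_of_mem_boundary hs
    exact K.down_closed (hc ht) hst hs.1
  constructor
  · rintro ⟨c, hc, hσc, hmax⟩
    have hcl : lift '' {x | lift x ∈ c} = c := by
      apply Set.Subset.antisymm
      · rintro _ ⟨x, hx, rfl⟩
        exact hx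
      · intro x hx
        obtain ⟨y, -, rfl⟩ := mem_lift_of_le hr' (hc hx).1 hτ (hc hx).2.2
        exact ⟨y, hx, rfl⟩
    have hcK : ∀ x ∈ {x | lift x ∈ c}, x ∈ K.faces := fun x hx => lift_mem_augmented.1 (hc hx).1
    rw [← hcl, boundary_lift] at hσc hmax
    refine ⟨{x | lift x ∈ c}, fun x hx => ⟨hcK x hx, ?_, ?_⟩, ?_, ?_⟩
    · have := (hc hx).2.1
      rwa [card_lift, card_lift] at this
    · exact (rank_le_iff hrr' (hcK x hx) hτ).1 (hc hx).2.2
    · exact (lift_injective.mem_set_image).1 hσc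
    · intro s hs
      exact (rank_le_iff hrr' (hbd _ hcK hs) hσ).1 (hmax _ ⟨s, hs, rfl⟩)
  · rintro ⟨c, hc, hσc, hmax⟩
    refine ⟨lift '' c, ?_, ?_, ?_⟩
    · rintro _ ⟨x, hx, rfl⟩
      obtain ⟨h1, h2, h3⟩ := hc hx
      exact ⟨lift_mem_augmented.2 h1, by rw [card_lift, card_lift, h2],
        (rank_le_iff hrr' h1 hτ).2 h3⟩
    · rw [boundary_lift]
      exact ⟨σ, hσc, rfl⟩
    · rw [boundary_lift]
      rintro _ ⟨s, hs, rfl⟩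
      exact (rank_le_iff hrr' (hbd c (fun x hx => (hc hx).1) hs) hσ).2 (hmax s hs)

theorem isPersistencePair_lift
    (hr' : IsLowerStarFiltration (augmented K) (augmentedValue ρ) r')
    (hrr' : ∀ σ ∈ K.faces, ∀ τ ∈ K.faces, r' (lift σ) < r' (lift τ) ↔ r σ < r τ)
    {σ τ : Finset Plane} : IsPersistencePair (augmented K) r' (lift σ) (lift τ) ↔
      IsPersistencePair K.faces r σ τ := by
  unfold IsPersistencePair
  rw [lift_mem_augmented, lift_mem_augmented, card_lift, card_lift]
  refine and_congr_right fun hσ => and_congr_right fun hτ => and_congr_right fun _ => ?_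
  rw [killedBy_lift hr' hrr' hσ hτ]
  refine and_congr_right fun _ => ⟨fun h τ' hτ' hc hk => ?_, fun h x hx hc hk => ?_⟩
  · exact (rank_le_iff hrr' hτ hτ').1 (h _ (lift_mem_augmented.2 hτ') (by rw [card_lift, hc])
      ((killedBy_lift hr' hrr' hσ hτ').2 hk))
  · by_contra hlt
    obtain ⟨τ', hτ', rfl⟩ := mem_lift_of_le hr' hx hτ (not_le.1 hlt).le
    rw [card_lift] at hc
    exact hlt ((rank_le_iff hrr' hτ hτ').2
      (h τ' hτ' hc ((killedBy_lift hr' hrr' hσ hτ').1 hk)))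

theorem simplexValue_lift (σ : Finset Plane) :
    simplexValue (augmentedValue ρ) (lift σ) = simplexValue (negDensity ρ) σ :=
  Finset.sup_map _ _ _

theorem isLowPair_lift
    (hr' : IsLowerStarFiltration (augmented K) (augmentedValue ρ) r')
    (hrr' : ∀ σ ∈ K.faces, ∀ τ ∈ K.faces, r' (lift σ) < r' (lift τ) ↔ r σ < r τ)
    {σ τ : Finset Plane} :
    IsLowPair (augmented K) (augmentedValue ρ) r' δ (lift σ) (lift τ) ↔
      IsLowPair K.faces (negDensity ρ) r δ σ τ := by
  unfold IsLowPair
  rw [isPersistencePair_lift hr' hrr', simplexValue_lift, simplexValue_lift]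

namespace IsApproximation

/-- The square is an initial subcomplex as well. -/
theorem isFilteredSphere_square [DecidableEq Plane] (hρ : IsApproximation K Ω G ρ β ν ω)
    (hK : IsTriangulation K) (hG : IsConnected G)
    (hr' : IsLowerStarFiltration (augmented K) (augmentedValue ρ) r') :
    IsFilteredSphere (augmented K) (lift '' K.faces) r' :=
  { hρ.isFilteredSphere hK hG hr' with
    sub := by
      rintro _ ⟨σ, hσ, rfl⟩
      exact lift_mem_augmented.2 hσ
    sub_down := by
      rintro _ ⟨σ, hσ, rfl⟩ t hts ht
      rcases lift_or_insertNone t with ⟨τ, rfl⟩ | ⟨τ, rfl⟩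
      · exact ⟨τ, K.down_closed hσ (lift_subset_lift.1 hts) (lift_nonempty.1 ht), rfl⟩
      · exact absurd hts (insertNone_not_subset_lift _ _)
    initial := by
      rintro σ hσ _ ⟨τ, hτ, rfl⟩ hle
      exact mem_lift_of_le hr' hσ hτ hle
    sub_linked := by
      rintro u v ⟨s, hs, hsu⟩ ⟨t, ht, htv⟩
      obtain ⟨u, rfl⟩ : ∃ u', u = some u' := by
        cases u with
        | none => exact absurd (hsu ▸ Finset.mem_singleton_self none) (none_notMem_lift s)
        | some u => exact ⟨u, rfl⟩
      obtain ⟨v, rfl⟩ : ∃ v', v = some v' := by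
        cases v with
        | none => exact absurd (htv ▸ Finset.mem_singleton_self none) (none_notMem_lift t)
        | some u => exact ⟨u, rfl⟩
      rw [← lift_singleton] at hsu htv
      exact (faces_linked hK (lift_injective hsu ▸ hs) (lift_injective htv ▸ ht)).lift
    sub_nonempty := by
      obtain ⟨v, hv⟩ := hρ.exists_vertex hG
      exact ⟨some v, _, hρ.subcomplex hv, lift_singleton v⟩
    outside := by
      obtain ⟨c, -, hc⟩ := exists_frontier_vertex_ne hK 0
      obtain ⟨w, hcw, hw⟩ := exists_frontier_edge hK hc
      refine ⟨Finset.insertNone {c, w}, (insertNone_mem_ofCard (k := 1) hK).2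
        ⟨hw, Finset.card_pair hcw⟩, ?_⟩
      rintro ⟨s, -, hs⟩
      exact lift_ne_insertNone _ _ hs }

/-- No class of the square dies at a simplex that contains the vertex at infinity. -/
theorem mem_lift_of_pair [DecidableEq Plane] (hρ : IsApproximation K Ω G ρ β ν ω)
    (hK : IsTriangulation K) (hG : IsConnected G)
    (hr' : IsLowerStarFiltration (augmented K) (augmentedValue ρ) r')
    {σ : Finset Plane} {τ : Finset (Option Plane)}
    (hp : IsPersistencePair (augmented K) r' (lift σ) τ) : τ ∈ lift '' K.faces := by
  have h := hρ.isFilteredSphere_square hK hG hr'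
  have hσ : σ ∈ K.faces := lift_mem_augmented.1 hp.1
  have h3 := h.card_le τ hp.2.1
  have hcard := hp.2.2.1
  have hpos := (SimplicialComplex.nonempty_of_mem_faces hσ).card_pos
  rw [card_lift] at hcard
  obtain h1 | h2 : σ.card = 1 ∨ σ.card = 2 := by omega
  · obtain ⟨v, rfl⟩ := Finset.card_eq_one.1 h1
    rw [lift_singleton] at hp
    exact h.mem_of_vertex_pair hp ⟨_, hσ, lift_singleton v⟩
  -- An edge that is the first member of a pair closes a cycle of earlier edges, all in `K`; the
  -- cycle is filled by triangles of `K`, so the class dies there.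
  · obtain ⟨c, hc, hσc, hb⟩ := h.exists_cycle_of_not_second hp.1
      fun x hx => h.not_first_of_second hx hp
    have hcl : lift '' {x | lift x ∈ c} = c := by
      apply Set.Subset.antisymm
      · rintro _ ⟨x, hx, rfl⟩
        exact hx
      · intro x hx
        obtain ⟨y, -, rfl⟩ := mem_lift_of_le hr' (hc hx).1 hσ (hc hx).2.2
        exact ⟨y, hx, rfl⟩
    obtain ⟨X, hX, hXb⟩ := exists_filling hK (z := {x | lift x ∈ c}) (fun x hx => by
      obtain ⟨e1, e2, -⟩ := hc hx
      rw [card_lift, card_lift, h2] at e2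
      exact ⟨lift_mem_augmented.1 e1, e2⟩) (by rw [← boundary_lift_eq_empty, hcl, hb])
    have hlX : lift '' X ⊆ augmented K := by
      rintro _ ⟨x, hx, rfl⟩
      exact lift_mem_augmented.2 (hX hx).1
    have hbX : boundary (lift '' X) = c := by rw [boundary_lift, hXb, hcl]
    have hσX : lift σ ∈ boundary (lift '' X) := hbX ▸ hσc
    obtain ⟨t, ht, -⟩ := exists_mem_of_mem_boundary hσX
    obtain ⟨m, hm, hmx⟩ := h.exists_max hlX ⟨t, ht⟩
    obtain ⟨τ', hτ', hle⟩ := h.pair_of_chain (σ := lift σ) (τ := m) (c := lift '' X)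
      (fun x hx => ⟨hlX hx, by
        obtain ⟨y, hy, rfl⟩ := hx
        rw [card_lift, card_lift, (hX hy).2, h2], hmx x hx⟩) hσX (by
      rw [hbX]
      exact fun s hs => (hc hs).2.2)
    rw [h.pair_right_unique hτ' hp] at hle
    obtain ⟨m, hm, rfl⟩ := hm
    exact mem_lift_of_le hr' hp.2.1 (hX hm).1 hle

/-! #### Values -/

theorem simplexValue_inside (hρ : IsApproximation K Ω G ρ β ν ω) {σ : Finset Plane}
    (hσ : σ ∈ Ω.faces) : ((-β - ν : ℝ) : EReal) ≤ simplexValue (negDensity ρ) σ ∧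
      simplexValue (negDensity ρ) σ ≤ ((-β : ℝ) : EReal) := by
  have hv : ∀ v ∈ σ, v ∈ Ω.vertices := fun v hv => Ω.down_closed hσ (by simpa using hv) (by simp)
  constructor
  · obtain ⟨v, hvσ⟩ := SimplicialComplex.nonempty_of_mem_faces hσ
    refine le_trans ?_ (Finset.le_sup hvσ)
    have := hρ.density_inside v (hv v hvσ)
    exact EReal.coe_le_coe_iff.2 (by linarith)
  · refine Finset.sup_le fun v hvσ => ?_
    have := hρ.density_inside v (hv v hvσ)
    exact EReal.coe_le_coe_iff.2 (by linarith)

theorem simplexValue_outside (hρ : IsApproximation K Ω G ρ β ν ω) (hG : IsConnected G)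
    {σ : Finset Plane} (hσ : σ ∈ K.faces) (hσΩ : σ ∉ Ω.faces) :
    ((-ν : ℝ) : EReal) ≤ simplexValue (negDensity ρ) σ ∧
      simplexValue (negDensity ρ) σ ≤ ((0 : ℝ) : EReal) := by
  have hv : ∀ v ∈ σ, v ∈ K.vertices := fun v hv => K.down_closed hσ (by simpa using hv) (by simp)
  have hν := hρ.noise_nonneg hG
  have hgap := hρ.gap
  constructor
  · obtain ⟨v, hvσ, hvΩ⟩ : ∃ v ∈ σ, v ∉ Ω.vertices := by
      by_contra! hno
      exact hσΩ (hρ.full σ hσ hno)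
    refine le_trans ?_ (Finset.le_sup hvσ)
    have := hρ.density_outside v (hv v hvσ) hvΩ
    exact EReal.coe_le_coe_iff.2 (by linarith)
  · refine Finset.sup_le fun v hvσ => EReal.coe_le_coe_iff.2 ?_
    by_cases hvΩ : v ∈ Ω.vertices
    · have := hρ.density_inside v hvΩ
      linarith
    · have := hρ.density_outside v (hv v hvσ) hvΩ
      linarith

theorem simplexValue_insertNone (σ : Finset Plane) :
    simplexValue (augmentedValue ρ) (Finset.insertNone σ) = ⊤ :=
  top_le_iff.1 (Finset.le_sup (f := augmentedValue ρ) Finset.none_mem_insertNone)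

/-- The pairs of low persistence are those that do not leave `Ω`. -/
theorem isLowPair_iff [DecidableEq Plane] (hρ : IsApproximation K Ω G ρ β ν ω)
    (hK : IsTriangulation K) (hG : IsConnected G) (hδ : ν ≤ δ ∧ δ < β - ν)
    (hr' : IsLowerStarFiltration (augmented K) (augmentedValue ρ) r')
    {σ τ : Finset (Option Plane)} :
    IsLowPair (augmented K) (augmentedValue ρ) r' δ σ τ ↔
      IsPersistencePair (augmented K) r' σ τ ∧ ¬ (σ ∈ lift '' Ω.faces ∧ τ ∉ lift '' Ω.faces) := by
  have h := hρ.isFilteredSphere hK hG hr'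
  refine and_congr_right fun hp => ?_
  have hmem : ∀ {s}, lift s ∈ lift '' Ω.faces ↔ s ∈ Ω.faces := lift_injective.mem_set_image
  rcases lift_or_insertNone σ with ⟨σ, rfl⟩ | ⟨σ, rfl⟩
  · obtain ⟨τ, hτ, rfl⟩ := hρ.mem_lift_of_pair hK hG hr' hp
    have hσ : σ ∈ K.faces := lift_mem_augmented.1 hp.1
    rw [simplexValue_lift, simplexValue_lift, hmem, hmem]
    -- Inside `Ω` values vary by at most `ν`, and so they do outside; passing from `Ω` to the
    -- outside costs at least `β - ν`. The fourth case contradicts initiality.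
    by_cases hσΩ : σ ∈ Ω.faces <;> by_cases hτΩ : τ ∈ Ω.faces
    · refine iff_of_true ?_ (by tauto)
      calc simplexValue (negDensity ρ) τ ≤ ((-β : ℝ) : EReal) := (hρ.simplexValue_inside hτΩ).2
        _ ≤ ((-β - ν : ℝ) : EReal) + (δ : EReal) := by
          rw [← EReal.coe_add]
          exact EReal.coe_le_coe_iff.2 (by linarith [hδ.1])
        _ ≤ _ := by gcongr; exact (hρ.simplexValue_inside hσΩ).1
    · refine iff_of_false (not_le.2 ?_) (by tauto)
      calc simplexValue (negDensity ρ) σ + (δ : EReal) ≤ ((-β : ℝ) : EReal) + (δ : EReal) := by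
            gcongr; exact (hρ.simplexValue_inside hσΩ).2
        _ < ((-ν : ℝ) : EReal) := by
          rw [← EReal.coe_add]
          exact EReal.coe_lt_coe_iff.2 (by linarith [hδ.2])
        _ ≤ _ := (hρ.simplexValue_outside hG hτ hτΩ).1
    · exact absurd (hmem.1 (h.initial _ hp.1 _ (hmem.2 hτΩ) (h.pair_lt hp).le)) hσΩ
    · refine iff_of_true ?_ (by tauto)
      calc simplexValue (negDensity ρ) τ ≤ ((0 : ℝ) : EReal) := (hρ.simplexValue_outside hG hτ hτΩ).2
        _ ≤ ((-ν : ℝ) : EReal) + (δ : EReal) := by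
          rw [← EReal.coe_add]
          exact EReal.coe_le_coe_iff.2 (by linarith [hδ.1])
        _ ≤ _ := by gcongr; exact (hρ.simplexValue_outside hG hσ hσΩ).1
  -- A pair that begins at infinity starts at the value `⊤`, so the inequality is void.
  · refine iff_of_true ?_ ?_
    · rw [simplexValue_insertNone, EReal.top_add_coe]
      exact le_top
    · rintro ⟨⟨s, -, hs⟩, -⟩
      exact lift_ne_insertNone _ _ hs

theorem criticalTriangles_eq [DecidableEq Plane] (hρ : IsApproximation K Ω G ρ β ν ω)
    (hK : IsTriangulation K) (hG : IsConnected G) (hδ : ν ≤ δ ∧ δ < β - ν)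
    (hr' : IsLowerStarFiltration (augmented K) (augmentedValue ρ) r') :
    criticalTriangles K ρ r' δ = essentialTriangles (augmented K) (lift '' Ω.faces) r' := by
  ext t
  refine and_congr_right fun ht => ?_
  simp only [HighPersistence, hρ.isLowPair_iff hK hG hδ hr']
  constructor
  · intro h e he
    by_contra hc
    exact (h e).2 ⟨he, hc⟩
  · refine fun h e => ⟨fun hp => ?_, fun hp => hp.2 (h e hp.1)⟩
    have h1 := hp.1.2.2.1
    have h2 := augmented_card_le hK hp.1.2.1
    have h3 := ht.2
    omega

/-- A negative edge is in a low pair, because components born in `Ω` die there; a matched edge is in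
one because its partner is a triangle of `K` and the pair does not leave `Ω`. -/
theorem highPersistence_iff [DecidableEq Plane] (hρ : IsApproximation K Ω G ρ β ν ω)
    (hK : IsTriangulation K) (hG : IsConnected G) (hδ : ν ≤ δ ∧ δ < β - ν)
    (hr' : IsLowerStarFiltration (augmented K) (augmentedValue ρ) r')
    (hrr' : ∀ σ ∈ K.faces, ∀ τ ∈ K.faces, r' (lift σ) < r' (lift τ) ↔ r σ < r τ)
    {e : Finset Plane} (he : e ∈ K.faces) (he2 : e.card = 2) :
    HighPersistence K.faces (negDensity ρ) r δ e ↔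
      lift e ∈ essentialEdges (augmented K) (lift '' Ω.faces) r' := by
  have h := hρ.isFilteredSphere hK hG hr'
  have heL : lift e ∈ ofCard (augmented K) 2 := lift_mem_ofCard.2 ⟨he, he2⟩
  simp only [HighPersistence, ← isLowPair_lift hr' hrr', hρ.isLowPair_iff hK hG hδ hr']
  constructor
  · intro hh
    rcases h.edge_cases heL with ⟨-, v, hv⟩ | h1 | ⟨-, t, ht, hc⟩
    · obtain ⟨s, hs, hsv⟩ := mem_lift_of_le hr' hv.1 he (h.pair_lt hv).le
      refine absurd ⟨?_, ?_⟩ (hh s).2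
      · rwa [hsv]
      · rintro ⟨h1, h2⟩
        rw [hsv] at h1
        exact h2 (h.mem_of_vertex_pair hv h1)
    · exact h1
    · obtain ⟨t, -, rfl⟩ := hρ.mem_lift_of_pair hK hG hr' ht
      exact absurd ⟨ht, hc⟩ (hh t).1
  · rintro ⟨-, t, ht, hc⟩ τ
    refine ⟨fun hp => ?_, fun hp => h.not_first_of_second hp.1 ht⟩
    rw [h.pair_right_unique hp.1 ht] at hp
    exact hp.2 hc

/-- No vertex-edge pair leaves `Ω`, so the bound `δ` excludes none of them and the forest consists
of all negative edges with both endpoints in the plane. -/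
theorem spanningForest_adj_iff [DecidableEq Plane] (hρ : IsApproximation K Ω G ρ β ν ω)
    (hK : IsTriangulation K) (hG : IsConnected G) (hδ : ν ≤ δ ∧ δ < β - ν)
    (hr' : IsLowerStarFiltration (augmented K) (augmentedValue ρ) r')
    (hrr' : ∀ σ ∈ K.faces, ∀ τ ∈ K.faces, r' (lift σ) < r' (lift τ) ↔ r σ < r τ) {a b : Plane} :
    (spanningForest K.faces (negDensity ρ) r δ).Adj a b ↔
      lift {a, b} ∈ negativeEdges (augmented K) r' := by
  have h := hρ.isFilteredSphere hK hG hr'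
  rw [spanningForest, SimpleGraph.fromEdgeSet_adj]
  constructor
  · rintro ⟨⟨e, hspan, v, hlow⟩, hab⟩
    have heq : e = {a, b} := by
      ext x
      rw [← hspan x]
      simp
    subst heq
    have hp := (isPersistencePair_lift hr' hrr').2 hlow.1
    refine ⟨⟨hp.2.1, by rw [card_lift, Finset.card_pair hab]⟩, some v, ?_⟩
    rwa [lift_singleton] at hp
  · rintro ⟨⟨hL, h2⟩, v, hv⟩
    rw [card_lift] at h2
    have hab : a ≠ b := by
      rintro rfl
      simp at h2
    obtain ⟨s, hs, hsv⟩ := mem_lift_of_le hr' hv.1 (lift_mem_augmented.1 hL) (h.pair_lt hv).le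
    have hs1 : s.card = 1 := by rw [← card_lift, hsv, Finset.card_singleton]
    obtain ⟨u, rfl⟩ := Finset.card_eq_one.1 hs1
    refine ⟨⟨{a, b}, fun x => by simp, u, ?_⟩, hab⟩
    rw [← isLowPair_lift hr' hrr', hsv, hρ.isLowPair_iff hK hG hδ hr']
    exact ⟨hv, fun hc => hc.2 (h.mem_of_vertex_pair hv hc.1)⟩

end IsApproximation

end Comparison

end GraphReconstruction

namespace GraphReconstruction

/-! ### The output graph -/

section Walks

variable {V : Type*}

theorem spans_iff [DecidableEq V] {a b : V} {e : Finset V} : Spans s(a, b) e ↔ e = {a, b} := by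
  constructor
  · intro h
    ext x
    rw [← h x]
    simp
  · rintro rfl x
    simp

/-- The chain of a trail. -/
theorem boundary_walk [DecidableEq V] {Γ : SimpleGraph V} {u v : V} (p : Γ.Walk u v)
    (hp : p.IsTrail) : boundary {e | ∃ x ∈ p.edges, Spans x e} = {{u}} ∆ {{v}} := by
  induction p with
  | nil => simp
  | @cons u w v h p ih =>
    rw [SimpleGraph.Walk.isTrail_cons] at hp
    have hset : {e | ∃ x ∈ (SimpleGraph.Walk.cons h p).edges, Spans x e} =
        {({u, w} : Finset V)} ∆ {e | ∃ x ∈ p.edges, Spans x e} := by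
      have hnot : ({u, w} : Finset V) ∉ {e | ∃ x ∈ p.edges, Spans x e} := by
        rintro ⟨x, hx, hs⟩
        induction x using Sym2.ind with
        | _ a b =>
          refine hp.2 ?_
          convert hx using 1
          refine Sym2.ext fun y => ?_
          rw [hs y]
          simp
      ext e
      simp only [SimpleGraph.Walk.edges_cons, List.mem_cons, exists_eq_or_imp, spans_iff,
        Set.mem_ofPred_eq, Set.mem_symmDiff, Set.mem_singleton_iff]
      constructor
      · rintro (rfl | h)
        · exact Or.inl ⟨rfl, hnot⟩
        · exact Or.inr ⟨h, fun he => hnot (he ▸ h)⟩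
      · rintro (h | h)
        · exact Or.inl h.1
        · exact Or.inr h.1
    have hfin : {e : Finset V | ∃ x ∈ p.edges, Spans x e}.Finite := by
      refine (p.edges.finite_toSet.image fun x => x.toFinset).subset ?_
      rintro e ⟨x, hx, hs⟩
      refine ⟨x, hx, ?_⟩
      ext y
      rw [Sym2.mem_toFinset, hs y]
    rw [hset, boundary_symmDiff (Set.finite_singleton _) hfin, ih hp.1, boundary_pair h.ne,
      symmDiff_assoc, symmDiff_symmDiff_cancel_left]

theorem linked_of_walk [DecidableEq Plane] {T : SimpleGraph Plane} {F : Set (Finset (Option Plane))}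
    {u v : Plane} (p : T.Walk u v) (hp : ∀ a b, s(a, b) ∈ p.edges → lift {a, b} ∈ F) :
    Linked F (some u) (some v) := by
  induction p with
  | nil => exact .refl
  | @cons u w v h p ih =>
    refine (Linked.single (fun he => h.ne (Option.some_injective _ he)) ?_).trans
      (ih fun a b hab => hp a b (by simp [hab]))
    rw [← lift_pair]
    exact hp u w (by simp)

end Walks

/-! ### Shape of the output graph. -/

section Output

open Geometry

variable {K Ω : SimplicialComplex ℝ Plane} {G : Set Plane} {ρ : Plane → ℝ} {β ν ω δ : ℝ}
  {r : Finset Plane → ℕ} {r' : Finset (Option Plane) → ℕ}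

theorem some_singleton_mem_sub {v : Plane} : {some v} ∈ lift '' Ω.faces ↔ {v} ∈ Ω.faces := by
  rw [← lift_singleton, lift_injective.mem_set_image]

namespace IsApproximation

variable [DecidableEq Plane] (hρ : IsApproximation K Ω G ρ β ν ω)
  (hK : IsTriangulation K) (hG : IsConnected G) (hδ : ν ≤ δ ∧ δ < β - ν)
  (hr' : IsLowerStarFiltration (augmented K) (augmentedValue ρ) r')
  (hrr' : ∀ σ ∈ K.faces, ∀ τ ∈ K.faces, r' (lift σ) < r' (lift τ) ↔ r σ < r τ)

include hρ hK hG hδ hr' hrr'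

theorem reachable_of_linked {u : Plane} {x : Option Plane}
    (h : Linked (lift '' Ω.faces ∩ negativeEdges (augmented K) r') (some u) x) :
    ∃ v, x = some v ∧ (spanningForest K.faces (negDensity ρ) r δ).Reachable u v := by
  induction h with
  | refl => exact ⟨u, rfl, .refl _⟩
  | @tail b c _ hbc ih =>
    obtain ⟨v, rfl, hv⟩ := ih
    cases c with
    | none =>
      obtain ⟨s, -, hs⟩ := hbc.2.1
      have : none ∈ ({some v, none} : Finset (Option Plane)) := by simp
      exact absurd (hs ▸ this) (none_notMem_lift s)
    | some c =>
      refine ⟨c, rfl, hv.trans (SimpleGraph.Adj.reachable ?_)⟩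
      rw [hρ.spanningForest_adj_iff hK hG hδ hr' hrr', lift_pair]
      exact hbc.2.2

theorem mem_of_reachable {u v : Plane}
    (h : (spanningForest K.faces (negDensity ρ) r δ).Reachable u v) (hu : {u} ∈ K.faces) :
    {v} ∈ K.faces := by
  obtain ⟨p⟩ := h
  induction p with
  | nil => exact hu
  | @cons u w v h p ih =>
    refine ih ?_
    rw [hρ.spanningForest_adj_iff hK hG hδ hr' hrr'] at h
    exact K.down_closed (lift_mem_augmented.1 h.1.1) (by simp) (by simp)

/-- All vertices of `Ω` have the same sink. -/
theorem exists_sink : ∃ s, {s} ∈ Ω.faces ∧ ∀ u, {u} ∈ Ω.faces →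
    IsSinkOf (spanningForest K.faces (negDensity ρ) r δ) r u s ∧
    ∀ s', IsSinkOf (spanningForest K.faces (negDensity ρ) r δ) r u s' → s' = s := by
  have h := hρ.isFilteredSphere hK hG hr'
  have hne : {σ ∈ Ω.faces | σ.card = 1}.Nonempty := by
    obtain ⟨v, hv⟩ := hρ.exists_vertex hG
    exact ⟨{v}, hv, by simp⟩
  -- The first vertex of `Ω` is the first of all vertices, because `Ω` is initial, and the forest
  -- connects `Ω`.
  obtain ⟨σ, ⟨hσ, hσ1⟩, hmin⟩ := ((hρ.finite hK).subset
    (Set.sep_subset Ω.faces fun σ => σ.card = 1)).exists_minimalFor r _ hne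
  obtain ⟨s, rfl⟩ := Finset.card_eq_one.1 hσ1
  have hmin' : ∀ w, {w} ∈ K.faces → r {s} ≤ r {w} := by
    intro w hw
    by_contra hlt
    have hle : r' (lift {w}) ≤ r' (lift {s}) :=
      (rank_le_iff hrr' hw (hρ.subcomplex hσ)).2 (by omega)
    obtain ⟨τ, hτ, hτw⟩ := h.initial _ (lift_mem_augmented.2 hw) _ ⟨_, hσ, rfl⟩ hle
    rw [lift_injective hτw] at hτ
    exact hlt (hmin ⟨hτ, by simp⟩ (by omega))
  refine ⟨s, hσ, fun u hu => ?_⟩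
  have hreach : (spanningForest K.faces (negDensity ρ) r δ).Reachable u s := by
    obtain ⟨v, hv, hreach⟩ := hρ.reachable_of_linked hK hG hδ hr' hrr'
      (h.negative_linked_sub (some_singleton_mem_sub.2 hu) (some_singleton_mem_sub.2 hσ))
    rwa [← Option.some_injective _ hv] at hreach
  refine ⟨⟨hreach, fun w hw => hmin' w (hρ.mem_of_reachable hK hG hδ hr' hrr' hw
    (hρ.subcomplex hu))⟩, fun s' hs' => ?_⟩
  have hs'K := hρ.mem_of_reachable hK hG hδ hr' hrr' hs'.1 (hρ.subcomplex hu)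
  have h1 := (rank_le_iff hrr' hs'K (hρ.subcomplex hσ)).2 (hs'.2 s hreach)
  have h2 := (rank_le_iff hrr' (hρ.subcomplex hσ) hs'K).2 (hmin' s' hs'K)
  exact Finset.singleton_injective (lift_injective (hr'.injOn (lift_mem_augmented.2 hs'K)
    (lift_mem_augmented.2 (hρ.subcomplex hσ)) (le_antisymm h1 h2)))

/-- The paths of the forest between vertices of `Ω` stay in `Ω`. -/
theorem mem_of_mem_path {u v a b : Plane} (hu : {u} ∈ Ω.faces) (hv : {v} ∈ Ω.faces)
    {p : (spanningForest K.faces (negDensity ρ) r δ).Walk u v} (hp : p.IsPath)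
    (hab : s(a, b) ∈ p.edges) :
    lift {a, b} ∈ lift '' Ω.faces ∩ negativeEdges (augmented K) r' := by
  have h := hρ.isFilteredSphere hK hG hr'
  set C : Set (Finset (Option Plane)) := lift '' {e | ∃ x ∈ p.edges, Spans x e}
  have hCN : C ⊆ negativeEdges (augmented K) r' := by
    rintro _ ⟨e, ⟨x, hx, hs⟩, rfl⟩
    induction x using Sym2.ind with
    | _ a b =>
      rw [spans_iff.1 hs, ← hρ.spanningForest_adj_iff hK hG hδ hr' hrr']
      exact p.adj_of_mem_edges hx
  have hCb : boundary C = {{some u}} ∆ {{some v}} := by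
    rw [boundary_lift, boundary_walk p hp.isTrail, Set.image_symmDiff lift_injective]
    simp [lift_singleton]
  obtain ⟨c, hc, hcf, -, hcb⟩ := (h.negative_linked_sub (some_singleton_mem_sub.2 hu)
    (some_singleton_mem_sub.2 hv)).exists_chain
  -- The path and a chain of negative edges inside `Ω` have the same boundary; their sum is a cycle
  -- of negative edges, hence empty.
  have hzero : C ∆ c = ∅ := by
    refine h.negative_acyclic (symmDiff_subset hCN fun e he => (hc he).2) ?_
    rw [boundary_symmDiff (h.finite.subset fun e he => (hCN he).1.1) hcf, hCb, hcb, symmDiff_self]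
    rfl
  have hCc : C = c := symmDiff_eq_bot.1 hzero
  exact hc (hCc ▸ ⟨{a, b}, ⟨_, hab, spans_iff.2 rfl⟩, rfl⟩)

/-- The edges of the output graph. -/
theorem mem_output_iff {s : Plane} (hs : {s} ∈ Ω.faces) (hsink : ∀ u, {u} ∈ Ω.faces →
      IsSinkOf (spanningForest K.faces (negDensity ρ) r δ) r u s ∧
      ∀ s', IsSinkOf (spanningForest K.faces (negDensity ρ) r δ) r u s' → s' = s)
    {x : Finset (Option Plane)} :
    x ∈ lift '' edgeSimplices (outputGraph K.faces (negDensity ρ) r δ) ↔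
      x ∈ essentialEdges (augmented K) (lift '' Ω.faces) r' ∨
      ∃ e ∈ essentialEdges (augmented K) (lift '' Ω.faces) r', ∃ u, some u ∈ e ∧
        ∃ p : (spanningForest K.faces (negDensity ρ) r δ).Walk u s, p.IsPath ∧
          ∃ a b, s(a, b) ∈ p.edges ∧ x = lift {a, b} := by
  have h := hρ.isFilteredSphere hK hG hr'
  have hess : ∀ e ∈ essentialEdges (augmented K) (lift '' Ω.faces) r', ∃ a b, a ≠ b ∧
      {a, b} ∈ Ω.faces ∧ e = lift {a, b} := by
    rintro e ⟨⟨-, he2⟩, t, -, ⟨e, heΩ, rfl⟩, -⟩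
    rw [card_lift] at he2
    obtain ⟨a, b, hab, rfl⟩ := Finset.card_eq_two.1 he2
    exact ⟨a, b, hab, heΩ, rfl⟩
  have hhigh := fun {e : Finset Plane} => hρ.highPersistence_iff (e := e) hK hG hδ hr' hrr'
  constructor
  · rintro ⟨e', ⟨y, hy, hspan⟩, rfl⟩
    induction y using Sym2.ind with
    | _ a b =>
      rw [spans_iff] at hspan
      subst hspan
      rw [SimpleGraph.mem_edgeSet, outputGraph, SimpleGraph.fromEdgeSet_adj] at hy
      obtain ⟨⟨e, heK, he2, hhe, hsp | ⟨u, hue, s', hs', p, hp, hmem⟩⟩, hab⟩ := hy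
      · left
        rw [← spans_iff.1 hsp]
        exact (hhigh heK he2).1 hhe
      · right
        have hee := (hhigh heK he2).1 hhe
        obtain ⟨e₁, he₁Ω, he₁⟩ : lift e ∈ lift '' Ω.faces := hee.2.choose_spec.2.1
        rw [lift_injective he₁] at he₁Ω
        have huΩ : {u} ∈ Ω.faces := Ω.down_closed he₁Ω (by simpa using hue) (by simp)
        obtain rfl := (hsink u huΩ).2 s' hs'
        exact ⟨lift e, hee, u, some_mem_lift.2 hue, p, hp, a, b, hmem, rfl⟩
  · rintro (hx | ⟨e, he, u, hue, p, hp, a, b, hmem, rfl⟩)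
    · obtain ⟨a, b, hab, heΩ, rfl⟩ := hess x hx
      refine ⟨{a, b}, ⟨s(a, b), ?_, spans_iff.2 rfl⟩, rfl⟩
      rw [SimpleGraph.mem_edgeSet, outputGraph, SimpleGraph.fromEdgeSet_adj]
      exact ⟨⟨{a, b}, hρ.subcomplex heΩ, Finset.card_pair hab,
        (hhigh (hρ.subcomplex heΩ) (Finset.card_pair hab)).2 hx, Or.inl (spans_iff.2 rfl)⟩, hab⟩
    · obtain ⟨c, d, hcd, heΩ, rfl⟩ := hess e he
      refine ⟨{a, b}, ⟨s(a, b), ?_, spans_iff.2 rfl⟩, rfl⟩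
      rw [SimpleGraph.mem_edgeSet, outputGraph, SimpleGraph.fromEdgeSet_adj]
      have hucd : u ∈ ({c, d} : Finset Plane) := some_mem_lift.1 hue
      exact ⟨⟨{c, d}, hρ.subcomplex heΩ, Finset.card_pair hcd,
        (hhigh (hρ.subcomplex heΩ) (Finset.card_pair hcd)).2 he,
        Or.inr ⟨u, hucd, s, (hsink u (Ω.down_closed heΩ (by simpa using hucd) (by simp))).1, p, hp,
          hmem⟩⟩, (p.adj_of_mem_edges hmem).ne⟩

/-- The output graph consists of the essential edges and edges of the forest in `Ω`, and each of its
vertices is joined to the sink by edges of the forest. -/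
theorem output_structure : ∃ s, {s} ∈ Ω.faces ∧
    (∀ x ∈ lift '' edgeSimplices (outputGraph K.faces (negDensity ρ) r δ), x ∈ lift '' Ω.faces ∧
      (x ∈ essentialEdges (augmented K) (lift '' Ω.faces) r' ∨
        x ∈ negativeEdges (augmented K) r')) ∧
    essentialEdges (augmented K) (lift '' Ω.faces) r' ⊆
      lift '' edgeSimplices (outputGraph K.faces (negDensity ρ) r δ) ∧
    ∀ x ∈ lift '' edgeSimplices (outputGraph K.faces (negDensity ρ) r δ), ∀ u ∈ x,
      Linked (lift '' edgeSimplices (outputGraph K.faces (negDensity ρ) r δ) ∩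
        negativeEdges (augmented K) r') u (some s) := by
  obtain ⟨s, hs, hsink⟩ := hρ.exists_sink hK hG hδ hr' hrr'
  have hiff := fun {x : Finset (Option Plane)} =>
    hρ.mem_output_iff hK hG hδ hr' hrr' hs hsink (x := x)
  set Γ := lift '' edgeSimplices (outputGraph K.faces (negDensity ρ) r δ) with hΓ
  have hvert : ∀ e ∈ essentialEdges (augmented K) (lift '' Ω.faces) r', ∀ x ∈ e,
      ∃ u, x = some u ∧ {u} ∈ Ω.faces := by
    rintro e ⟨-, t, -, ⟨e, heΩ, rfl⟩, -⟩ x hx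
    obtain ⟨u, hu, rfl⟩ := mem_lift.1 hx
    exact ⟨u, rfl, Ω.down_closed heΩ (by simpa using hu) (by simp)⟩
  have hpath : ∀ e ∈ essentialEdges (augmented K) (lift '' Ω.faces) r', ∀ u, some u ∈ e →
      ∀ p : (spanningForest K.faces (negDensity ρ) r δ).Walk u s, p.IsPath →
      ∀ a b, s(a, b) ∈ p.edges →
        lift {a, b} ∈ lift '' Ω.faces ∩ negativeEdges (augmented K) r' := by
    intro e he u hue p hp a b hab
    obtain ⟨u', hu', huΩ⟩ := hvert e he _ hue
    rw [← Option.some_injective _ hu'] at huΩ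
    exact hρ.mem_of_mem_path hK hG hδ hr' hrr' huΩ hs hp hab
  refine ⟨s, hs, fun x hx => ?_, fun x hx => hiff.2 (Or.inl hx), fun x hx u hu => ?_⟩
  · rcases hiff.1 hx with h1 | ⟨e, he, u, hue, p, hp, a, b, hab, rfl⟩
    · exact ⟨h1.2.choose_spec.2.1, Or.inl h1⟩
    · have := hpath e he u hue p hp a b hab
      exact ⟨this.1, Or.inr this.2⟩
  · rcases hiff.1 hx with h1 | ⟨e, he, u', hue, p, hp, a, b, hab, rfl⟩
    · obtain ⟨u, rfl, huΩ⟩ := hvert x h1 u hu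
      obtain ⟨p, hp⟩ := (hsink u huΩ).1.1.exists_isPath
      exact linked_of_walk p fun a b hab => ⟨hiff.2 (Or.inr ⟨x, h1, u, hu, p, hp, a, b, hab, rfl⟩),
        (hpath x h1 u hu p hp a b hab).2⟩
    -- A vertex on a path to the sink reaches the sink along the rest of this path, which is in the
    -- graph too.
    · obtain ⟨c, hc, rfl⟩ := mem_lift.1 hu
      have hcp : c ∈ p.support := by
        simp only [Finset.mem_insert, Finset.mem_singleton] at hc
        rcases hc with rfl | rfl
        · exact p.fst_mem_support_of_mem_edges hab
        · exact p.snd_mem_support_of_mem_edges hab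
      refine linked_of_walk (p.dropUntil c hcp) fun a' b' hab' => ?_
      have hab'' := p.edges_dropUntil_subset_edges hcp hab'
      exact ⟨hiff.2 (Or.inr ⟨e, he, u', hue, p, hp, a', b', hab'', rfl⟩),
        (hpath e he u' hue p hp a' b' hab'').2⟩

end IsApproximation

end Output

end GraphReconstruction

namespace GraphReconstruction

/-! ### Regions and retractions -/

section Assembly

theorem realize_singleton {V E : Type*} [AddCommGroup E] [Module ℝ E] (p : V → E) (v : V) :
    realize p {({v} : Finset V)} = {p v} := by
  simp [realize]

theorem realize_faces {V E : Type*} [AddCommGroup E] [Module ℝ E] (p : V → E)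
    {S : Set (Finset V)} (hS : ∀ s ∈ S, s.Nonempty) :
    realize p {s | s.Nonempty ∧ ∃ e ∈ S, s ⊆ e} = realize p S := by
  apply Set.Subset.antisymm
  · refine Set.iUnion₂_subset ?_
    rintro s ⟨-, e, he, hse⟩
    exact (convexHull_mono (Set.image_mono hse)).trans
      (Set.subset_biUnion_of_mem (u := fun s : Finset V => convexHull ℝ (p '' (s : Set V))) he)
  · exact Set.biUnion_subset_biUnion_left fun s hs => ⟨hS s hs, s, hs, subset_rfl⟩

/-- Removing one triangle from each region leaves all simplices but these triangles. -/
theorem iUnion_realize_regionMinus {V E : Type*} [AddCommGroup E] [Module ℝ E] (p : V → E)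
    {L T : Set (Finset V)} {R : Finset V → Set (Finset V)} (hne : ∀ s ∈ L, s.Nonempty)
    (hd : ∀ s ∈ L, ∀ t ⊆ s, t.Nonempty → t ∈ L) (hpure : ∀ s ∈ L, ∃ t ∈ ofCard L 3, s ⊆ t)
    (hT : T ⊆ ofCard L 3) (htR : ∀ t ∈ T, t ∈ R t) (hdisj : T.PairwiseDisjoint R)
    (hun : ⋃ t ∈ T, R t = ofCard L 3) :
    ⋃ t ∈ T, realize p (regionMinus (R t) t) = realize p (L \ T) := by
  have hset : ⋃ t ∈ T, regionMinus (R t) t = L \ T := by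
    ext s
    simp only [Set.mem_iUnion, exists_prop]
    constructor
    · rintro ⟨t, ht, hs, hst, τ, hτ, hsτ⟩
      have hτL : τ ∈ ofCard L 3 := hun ▸ Set.mem_biUnion ht hτ
      refine ⟨hd τ hτL.1 s hsτ hs, fun hsT => ?_⟩
      have : s = τ := Finset.eq_of_subset_of_card_le hsτ (by rw [hτL.2, (hT hsT).2])
      subst this
      exact Set.disjoint_left.1 (hdisj hsT ht hst) (htR s hsT) hτ
    · rintro ⟨hs, hsT⟩
      obtain ⟨τ, hτ, hsτ⟩ := hpure s hs
      obtain ⟨t, ht, hτt⟩ := Set.mem_iUnion₂.1 (hun ▸ hτ)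
      exact ⟨t, ht, hne s hs, fun h => hsT (h ▸ ht), τ, hτt, hsτ⟩
  rw [← hset]
  simp only [realize, Set.biUnion_iUnion]

open Geometry

variable {K Ω : SimplicialComplex ℝ Plane} {G : Set Plane} {ρ : Plane → ℝ} {β ν ω δ : ℝ}
  {r : Finset Plane → ℕ} {r' : Finset (Option Plane) → ℕ}

theorem augmented_pure (hK : IsTriangulation K) {s : Finset (Option Plane)}
    (hs : s ∈ augmented K) : ∃ t ∈ ofCard (augmented K) 3, s ⊆ t := by
  classical
  rcases lift_or_insertNone s with ⟨σ, rfl⟩ | ⟨σ, rfl⟩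
  · obtain ⟨t, ht, ht3, hst⟩ := exists_triangle_of_face hK (lift_mem_augmented.1 hs)
    exact ⟨lift t, lift_mem_ofCard.2 ⟨ht, ht3⟩, lift_subset_lift.2 hst⟩
  · obtain ⟨e, he, hσe⟩ : ∃ e ∈ ofCard (frontierFaces K) 2, σ ⊆ e := by
      have hedge : ∀ v, {v} ∈ frontierFaces K → ∃ e ∈ ofCard (frontierFaces K) 2, v ∈ e := by
        intro v hv
        obtain ⟨w, hvw, hw⟩ := exists_frontier_edge hK hv
        exact ⟨{v, w}, ⟨hw, Finset.card_pair hvw⟩, by simp⟩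
      rcases (insertNone_mem_augmented hK).1 hs with rfl | hσ
      · obtain ⟨c, -, hc⟩ := exists_frontier_vertex_ne hK 0
        obtain ⟨e, he, -⟩ := hedge c hc
        exact ⟨e, he, Finset.empty_subset _⟩
      · have h1 := card_le_two_of_onCommonSide hσ.1 hσ.2
        have h2 := (SimplicialComplex.nonempty_of_mem_faces hσ.1).card_pos
        obtain h3 | h3 : σ.card = 1 ∨ σ.card = 2 := by omega
        · obtain ⟨v, rfl⟩ := Finset.card_eq_one.1 h3
          obtain ⟨e, he, hve⟩ := hedge v hσ
          exact ⟨e, he, by simpa using hve⟩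
        · exact ⟨σ, ⟨hσ, h3⟩, subset_rfl⟩
    exact ⟨_, (insertNone_mem_ofCard (k := 1) hK).2 he, insertNone_subset_insertNone.2 hσe⟩

theorem mem_realize_lift {x : Plane × ℝ} :
    x ∈ realize pos (lift '' Ω.faces) ↔ x.2 = 0 ∧ x.1 ∈ Ω.space := by
  rw [realize, Set.biUnion_image]
  simp only [Set.mem_iUnion, mem_convexHull_lift, exists_prop, SimplicialComplex.mem_space_iff]
  constructor
  · rintro ⟨s, hs, h0, h1⟩
    exact ⟨h0, s, hs, h1⟩
  · rintro ⟨h0, s, hs, h1⟩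
    exact ⟨s, hs, h0, h1⟩

/-- A retract of a contractible complex is contractible. -/
theorem contractibleSpace_of_retracts (h : DeformationRetractsTo Ω.space G) {p : Plane × ℝ}
    (hp : DeformationRetractsTo (realize pos (lift '' Ω.faces)) {p}) : ContractibleSpace G := by
  obtain ⟨hGΩ, R, -, hR1, hRfix⟩ := h
  obtain ⟨hpX, F, hF0, hF1, -⟩ := hp
  let f : G → realize pos (lift '' Ω.faces) := fun g =>
    ⟨((g : Plane), 0), mem_realize_lift.2 ⟨rfl, hGΩ g.2⟩⟩
  have hf : Continuous f := by fun_prop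
  let k : realize pos (lift '' Ω.faces) → Ω.space := fun x =>
    ⟨(x : Plane × ℝ).1, (mem_realize_lift.1 x.2).2⟩
  have hk : Continuous k := by fun_prop
  let q : Ω.space → G := fun y => ⟨R (1, y), hR1 y⟩
  have hq : Continuous q := by fun_prop
  rw [contractible_iff_id_nullhomotopic]
  -- The contraction of `Ω` is restricted to `G` and followed by the retraction onto `G`.
  refine ⟨q (k ⟨p, hpX rfl⟩), ⟨⟨⟨fun x => q (k (F (x.1, f x.2))), by fun_prop⟩, ?_, ?_⟩⟩⟩
  · intro g
    change q (k (F (0, f g))) = g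
    rw [hF0]
    have := congrArg Subtype.val (hRfix 1 (k (f g)) g.2)
    exact Subtype.ext this
  · intro g
    change q (k (F (1, f g))) = q (k ⟨p, hpX rfl⟩)
    congr 2
    exact Subtype.ext (hF1 _)

end Assembly

end GraphReconstruction

/-! ### The reconstruction theorem. -/

theorem mainTheorem5
    (K Ω : Geometry.SimplicialComplex ℝ GraphReconstruction.Plane)
    (hK : GraphReconstruction.IsTriangulation K)
    (G : Set GraphReconstruction.Plane)
    (hG : GraphReconstruction.IsGeometricGraph G) (hGconn : IsConnected G)
    (ρ : GraphReconstruction.Plane → ℝ) (β ν ω δ : ℝ)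
    (hρ : GraphReconstruction.IsApproximation K Ω G ρ β ν ω)
    (hδ : ν ≤ δ ∧ δ < β - ν)
    -- the lower-star filtration used by the algorithm, and an extension to the augmented complex
    (r : Finset GraphReconstruction.Plane → ℕ)
    (hr : GraphReconstruction.IsLowerStarFiltration K.faces
      (GraphReconstruction.negDensity ρ) r)
    (r' : Finset (Option GraphReconstruction.Plane) → ℕ)
    (hr' : GraphReconstruction.IsLowerStarFiltration (GraphReconstruction.augmented K)
      (GraphReconstruction.augmentedValue ρ) r')
    (hrr' : ∀ σ ∈ K.faces, ∀ τ ∈ K.faces,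
      r' (GraphReconstruction.lift σ) < r' (GraphReconstruction.lift τ) ↔ r σ < r τ) :
    let Ghat : SimpleGraph GraphReconstruction.Plane :=
      GraphReconstruction.outputGraph K.faces (GraphReconstruction.negDensity ρ) r δ
    let T := GraphReconstruction.criticalTriangles K ρ r' δ
    -- the regions are indexed by the critical triangles
    ∃ R : Finset (Option GraphReconstruction.Plane) →
        Set (Finset (Option GraphReconstruction.Plane)),
      let BH : Set (Finset (Option GraphReconstruction.Plane)) :=
        (⋃ t ∈ T, GraphReconstruction.boundary (R t)) ∪
          GraphReconstruction.lift '' GraphReconstruction.hairEdges Ghat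
      -- partition of the triangles
      (∀ t ∈ T, t ∈ R t) ∧ T.PairwiseDisjoint R ∧
      (⋃ t ∈ T, R t) = GraphReconstruction.triangles K ∧
      -- first deformation retraction
      GraphReconstruction.DeformationRetractsTo
        (⋃ t ∈ T, GraphReconstruction.realize GraphReconstruction.pos
          (GraphReconstruction.regionMinus (R t) t))
        (GraphReconstruction.realize GraphReconstruction.pos
          (GraphReconstruction.lift '' Ω.faces)) ∧
      -- second deformation retraction, and the composite of the two
      (¬ ContractibleSpace G →
        GraphReconstruction.DeformationRetractsTo
          (GraphReconstruction.realize GraphReconstruction.pos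
            (GraphReconstruction.lift '' Ω.faces))
          (GraphReconstruction.realize GraphReconstruction.pos BH) ∧
        GraphReconstruction.DeformationRetractsTo
          (⋃ t ∈ T, GraphReconstruction.realize GraphReconstruction.pos
            (GraphReconstruction.regionMinus (R t) t))
          (GraphReconstruction.realize GraphReconstruction.pos BH)) ∧
      -- its target is the output graph
      BH = GraphReconstruction.lift '' GraphReconstruction.edgeSimplices Ghat := by
  classical
  have h := hρ.isFilteredSphere hK hGconn hr'
  obtain ⟨s₁, hs₁, hsub, hess, hlink⟩ := hρ.output_structure hK hGconn hδ hr' hrr'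
  intro Ghat T
  set Γ := GraphReconstruction.lift '' GraphReconstruction.edgeSimplices Ghat with hΓ
  have hT : T = GraphReconstruction.essentialTriangles (GraphReconstruction.augmented K)
      (GraphReconstruction.lift '' Ω.faces) r' := hρ.criticalTriangles_eq hK hGconn hδ hr'
  have hΓ2 : Γ ⊆ GraphReconstruction.ofCard (GraphReconstruction.augmented K) 2 := fun x hx =>
    (hsub x hx).2.elim (fun h1 => h1.1) fun h1 => h1.1
  have hne : ∀ s ∈ GraphReconstruction.augmented K, s.Nonempty := fun s hs => h.nonempty s hs
  obtain ⟨R, htR, hdisj, hun, hbd, hcyc⟩ := h.exists_regions hΓ2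
    (fun x hx => (hsub x hx).2.elim h.not_matched_of_essential h.not_matched_of_negative) hess
    fun e he u hu v hv => (hlink e (hess he) u hu).trans (hlink e (hess he) v hv).symm
  rw [← hT] at htR hdisj hun hbd hcyc
  -- For an edge on a cycle of the graph, the edges of that cycle form a chain with empty boundary,
  -- so `hcyc` puts the edge on the boundary of a region. All other edges are hair by definition.
  have hBH : (⋃ t ∈ T, GraphReconstruction.boundary (R t)) ∪
      GraphReconstruction.lift '' GraphReconstruction.hairEdges Ghat = Γ := by
    apply Set.Subset.antisymm
    · refine Set.union_subset (Set.iUnion₂_subset hbd) (Set.image_mono ?_)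
      rintro e ⟨x, hx, hs, -⟩
      exact ⟨x, hx, hs⟩
    · rintro _ ⟨e, ⟨x, hx, hs⟩, rfl⟩
      by_cases hcycle : ∀ (v : GraphReconstruction.Plane) (c : Ghat.Walk v v),
          c.IsCycle → x ∉ c.edges
      · exact Or.inr ⟨e, ⟨x, hx, hs, hcycle⟩, rfl⟩
      · push Not at hcycle
        obtain ⟨v, c, hc, hxc⟩ := hcycle
        obtain ⟨t, ht, het⟩ := hcyc
          (GraphReconstruction.lift '' {e | ∃ x ∈ c.edges, GraphReconstruction.Spans x e})
          (Set.image_mono fun e ⟨x, hx, hs⟩ => ⟨x, c.edges_subset_edgeSet hx, hs⟩)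
          (by
            rw [GraphReconstruction.boundary_lift_eq_empty,
              GraphReconstruction.boundary_walk c hc.isTrail, symmDiff_self]
            rfl)
          (GraphReconstruction.lift e) ⟨e, ⟨x, hxc, hs⟩, rfl⟩
        exact Or.inl (Set.mem_biUnion ht het)
  have hreal := GraphReconstruction.isGeometricRealization_augmented hK
  have hfirst : GraphReconstruction.DeformationRetractsTo
      (⋃ t ∈ T, GraphReconstruction.realize GraphReconstruction.pos
        (GraphReconstruction.regionMinus (R t) t))
      (GraphReconstruction.realize GraphReconstruction.pos
        (GraphReconstruction.lift '' Ω.faces)) := by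
    rw [GraphReconstruction.iUnion_realize_regionMinus _ hne h.down_closed
      (fun s hs => GraphReconstruction.augmented_pure hK hs) (fun t ht => ht.1) htR hdisj hun, hT]
    refine h.collapses_outside.deformationRetractsTo hreal (h.finite.subset Set.sdiff_subset)
      Set.sdiff_subset ?_
    rintro s ⟨hs, hsT⟩ t hts ht
    refine ⟨h.down_closed s hs t hts ht, fun htT => hsT ?_⟩
    rwa [← Finset.eq_of_subset_of_card_le hts (by rw [htT.1.2]; exact h.card_le s hs)]
  have hinside : ∀ A, GraphReconstruction.Collapses (GraphReconstruction.lift '' Ω.faces) A →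
      GraphReconstruction.DeformationRetractsTo
        (GraphReconstruction.realize GraphReconstruction.pos
          (GraphReconstruction.lift '' Ω.faces))
        (GraphReconstruction.realize GraphReconstruction.pos A) := fun A hA =>
    hA.deformationRetractsTo hreal (h.finite.subset h.sub) h.sub h.sub_down
  have hsecond : ¬ ContractibleSpace G → GraphReconstruction.DeformationRetractsTo
        (GraphReconstruction.realize GraphReconstruction.pos
          (GraphReconstruction.lift '' Ω.faces))
        (GraphReconstruction.realize GraphReconstruction.pos Γ) := by
    intro hG'
    -- Without essential edges a single vertex is an admissible target of the collapse of `Ω`, and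
    -- then `G` would be contractible. This is where the output graph could be empty.
    have hEne : (GraphReconstruction.essentialEdges (GraphReconstruction.augmented K)
        (GraphReconstruction.lift '' Ω.faces) r').Nonempty := by
      by_contra hempty
      rw [Set.not_nonempty_iff_eq_empty] at hempty
      refine hG' (GraphReconstruction.contractibleSpace_of_retracts hρ.retracts
        (p := GraphReconstruction.pos (some s₁)) ?_)
      rw [← GraphReconstruction.realize_singleton]
      refine hinside _ (h.collapses_inside ?_ ?_ (by rw [hempty]; exact Set.empty_subset _) ?_
        ⟨some s₁, rfl⟩ ?_)
      · rintro _ rfl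
        exact GraphReconstruction.some_singleton_mem_sub.2 hs₁
      · rintro _ rfl t hts ht
        exact (Finset.subset_singleton_iff.1 hts).resolve_left ht.ne_empty
      · rintro _ rfl
        exact Or.inl (Finset.card_singleton _)
      · intro u v hu hv
        rw [Finset.singleton_injective hu, Finset.singleton_injective hv]
        exact GraphReconstruction.Linked.refl
    obtain ⟨e₀, he₀⟩ := hEne
    have hΓne : ∀ s ∈ Γ, s.Nonempty := fun s hs => hne s (hΓ2 hs).1
    -- `Γ` contains only edges; their endpoints are added to obtain a subcomplex with the same
    -- realization.
    rw [← GraphReconstruction.realize_faces _ hΓne]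
    refine hinside _ (h.collapses_inside ?_ ?_ ?_ ?_ ?_ ?_)
    · rintro s ⟨hs, e, he, hse⟩
      exact h.sub_down e (hsub e he).1 s hse hs
    · rintro s ⟨-, e, he, hse⟩ t hts ht
      exact ⟨ht, e, he, hts.trans hse⟩
    · exact fun e he => ⟨hΓne e (hess he), e, hess he, subset_rfl⟩
    · rintro s ⟨hs, e, he, hse⟩
      by_cases h1 : s.card = 1
      · exact Or.inl h1
      · have h2 := (hΓ2 he).2
        have h3 := hs.card_pos
        rw [Finset.eq_of_subset_of_card_le hse (by omega)]
        exact Or.inr (hsub e he).2.symm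
    · obtain ⟨v, hv⟩ := hΓne e₀ (hess he₀)
      exact ⟨v, Finset.singleton_nonempty v, e₀, hess he₀, by simpa using hv⟩
    · have key : ∀ u, {u} ∈ {s : Finset (Option GraphReconstruction.Plane) |
          s.Nonempty ∧ ∃ e ∈ Γ, s ⊆ e} → GraphReconstruction.Linked
            ({s | s.Nonempty ∧ ∃ e ∈ Γ, s ⊆ e} ∩ GraphReconstruction.negativeEdges
              (GraphReconstruction.augmented K) r') u (some s₁) := by
        rintro u ⟨-, e, he, hue⟩
        exact GraphReconstruction.Linked.mono (E' := {s | s.Nonempty ∧ ∃ e ∈ Γ, s ⊆ e} ∩ _)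
          (fun x hx => ⟨⟨hΓne x hx.1, x, hx.1, subset_rfl⟩, hx.2⟩)
          (hlink e he u (by simpa using hue))
      exact fun u v hu hv => (key u hu).trans (key v hv).symm
  refine ⟨R, ?_⟩
  intro BH
  have hBH' : BH = Γ := hBH
  rw [hBH']
  exact ⟨htR, hdisj, hun, hfirst, fun hG' => ⟨hsecond hG', hfirst.trans (hsecond hG')⟩, rfl⟩
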